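/- An instance of the Restricted Shortest Path problem (RSP) consists of a weakly connected directed graph $G=(V,E,c,r)$ with $E\subseteq V\times V$, $n=|V|$, $m=|E|$, edge costs $c:E\to\mathbb{R}_{\ge 0}$ and edge resource consumptions $r:E\to\mathbb{R}_{\ge 0}$, nodes $s\neq t$ in $V$, and a bound $R\in\mathbb{R}_{\ge 0}$. A solution is a path $p$ from $s$ to $t$ (visiting no node twice) with $\sum_{e\in p} r(e)\le R$; if a solution exists, $C_{\mathrm{opt}}(G)$ denotes the minimum of $\sum_{e\in p}c(e)$ over all solutions $p$. For $\varepsilon>0$, a $(1+\varepsilon)$-approximation is a solution $p$ with $\sum_{e\in p}c(e)\le(1+\varepsilon)\,C_{\mathrm{opt}}(G)$. Consider random access machines with memory cells for natural numbers and for real numbers and with indirect addressing, on which each of the following takes one time step: addition and truncated subtraction of natural numbers; addition, subtraction, multiplication and division of real numbers (exact); conversion of a natural number to a real number; comparison; memory access; control. (Rounding of real numbers and multiplication of natural numbers are not among the operations.) The input is $n$, $m$, $s$, $t$, $R$, $\varepsilon$ and a list of the edges in arbitrary order with their costs and resource consumptions. Theorem. There is a single program for this machine with the following property. For every constant $C>0$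 there is a constant $K$ such that for every RSP instance and every $\varepsilon$ with $0<\varepsilon<C$ the program halts after at most $$K\cdot nm\left(\frac1\varepsilon+\log\log\log n\right)$$ time steps and returns a $(1+\varepsilon)$-approximation if the instance has a solution, and reports that there is none otherwise. Here $\log$ is the logarithm to base $2$, and $\log\log\log n$ is read as $0$ where it is negative or undefined (that is, for $n\le 4$). -/

import Mathlib

/-! ### The restricted shortest path problem -/

/-- An instance of the restricted shortest path problem: a finite, weakly connected directed graph
`G = (V, E, c, r)` with `V = {0, …, n - 1}` and `E = {e_0, …, e_(m-1)} ⊆ V × V`, edge costs and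
edge resource consumptions in `[0, ∞)`, distinct nodes `s`, `t`, and a resource bound `R ≥ 0`. -/
structure RSPInstance where
  n : ℕ
  m : ℕ
  src : Fin m → Fin n
  dst : Fin m → Fin n
  edge_injective : Function.Injective fun e => (src e, dst e)
  weaklyConnected : (SimpleGraph.fromRel fun u v => ∃ e, src e = u ∧ dst e = v).Connected
  cost : Fin m → ℝ
  cost_nonneg : ∀ e, 0 ≤ cost e
  res : Fin m → ℝ
  res_nonneg : ∀ e, 0 ≤ res e
  s : Fin n
  t : Fin n
  s_ne_t : s ≠ t
  R : ℝ
  R_nonneg : 0 ≤ R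

namespace RSPInstance

variable (I : RSPInstance)

/-- The edge sequence `p` leads from `u` to `v`. -/
def IsWalk : Fin I.n → List (Fin I.m) → Fin I.n → Prop
  | u, [], v => u = v
  | u, e :: p, v => I.src e = u ∧ IsWalk (I.dst e) p v

/-- The edge sequence `p` is a path from `u` to `v`: a walk that visits no node twice. -/
def IsPath (u : Fin I.n) (p : List (Fin I.m)) (v : Fin I.n) : Prop :=
  I.IsWalk u p v ∧ (u :: p.map I.dst).Nodup

/-- The cost of a path. -/
def pathCost (p : List (Fin I.m)) : ℝ := (p.map I.cost).sum

/-- The resource consumption of a path. -/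
def pathRes (p : List (Fin I.m)) : ℝ := (p.map I.res).sum

/-- A solution is a path from `s` to `t` whose resource consumption is at most `R`. -/
def IsSolution (p : List (Fin I.m)) : Prop :=
  I.IsPath I.s p I.t ∧ I.pathRes p ≤ I.R

/-- `c` is the optimal cost, the minimum of the costs of all solutions. -/
def IsOptCost (c : ℝ) : Prop :=
  IsLeast {x : ℝ | ∃ p, I.IsSolution p ∧ I.pathCost p = x} c

/-- `p` is a `(1 + ε)`-approximation: a solution of cost at most `1 + ε` times the optimal cost. -/
def IsApprox (ε : ℝ) (p : List (Fin I.m)) : Prop :=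
  I.IsSolution p ∧ ∃ c, I.IsOptCost c ∧ I.pathCost p ≤ (1 + ε) * c

end RSPInstance

/-! ### Random access machine programs over the natural numbers and the reals

The memory consists of registers and arrays for natural numbers and of registers and arrays for
real numbers; array cells are addressed by computed natural numbers. On natural numbers the
operations are addition and truncated subtraction, on real numbers the four exact field operations;
natural numbers can be converted to reals, and both kinds of numbers can be compared. There is
no rounding of reals and no multiplication of natural numbers. Every occurrence of an operation,
of a comparison, of a memory access or of a control instruction costs one time step whenever it
is executed. -/

namespace RAM

/-- A memory state. Registers and arrays are numbered; a program mentions only finitely many. -/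
@[ext] structure Store where
  nat : ℕ → ℕ
  real : ℕ → ℝ
  natArr : ℕ → ℕ → ℕ
  realArr : ℕ → ℕ → ℝ

/-- Natural number expressions: constants, registers, array cells, sums, differences. -/
inductive NExp where
  | const (k : ℕ)
  | reg (x : ℕ)
  | get (a : ℕ) (i : NExp)
  | add (e f : NExp)
  | sub (e f : NExp)

namespace NExp

/-- The value of an expression. -/
def eval (σ : Store) : NExp → ℕ
  | const k => k
  | reg x => σ.nat x
  | get a i => σ.natArr a (i.eval σ)
  | add e f => e.eval σ + f.eval σ
  | sub e f => e.eval σ - f.eval σ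

/-- The time needed to evaluate an expression. -/
def time : NExp → ℕ
  | const _ => 1
  | reg _ => 1
  | get _ i => i.time + 1
  | add e f => e.time + f.time + 1
  | sub e f => e.time + f.time + 1

end NExp

/-- Real number expressions. -/
inductive RExp where
  | ofNat (e : NExp)
  | reg (x : ℕ)
  | get (a : ℕ) (i : NExp)
  | add (e f : RExp)
  | sub (e f : RExp)
  | mul (e f : RExp)
  | div (e f : RExp)

namespace RExp

/-- The value of an expression; division by zero returns zero. -/
noncomputable def eval (σ : Store) : RExp → ℝ
  | ofNat e => (e.eval σ : ℝ)
  | reg x => σ.real x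
  | get a i => σ.realArr a (i.eval σ)
  | add e f => e.eval σ + f.eval σ
  | sub e f => e.eval σ - f.eval σ
  | mul e f => e.eval σ * f.eval σ
  | div e f => e.eval σ / f.eval σ

/-- The time needed to evaluate an expression. -/
def time : RExp → ℕ
  | ofNat e => e.time + 1
  | reg _ => 1
  | get _ i => i.time + 1
  | add e f => e.time + f.time + 1
  | sub e f => e.time + f.time + 1
  | mul e f => e.time + f.time + 1
  | div e f => e.time + f.time + 1

end RExp

/-- Tests. -/
inductive Test where
  | natLt (e f : NExp)
  | natEq (e f : NExp)
  | realLt (e f : RExp)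
  | realEq (e f : RExp)
  | not (b : Test)
  | and (b c : Test)

namespace Test

/-- The test succeeds in the given state. -/
def Holds (σ : Store) : Test → Prop
  | natLt e f => e.eval σ < f.eval σ
  | natEq e f => e.eval σ = f.eval σ
  | realLt e f => e.eval σ < f.eval σ
  | realEq e f => e.eval σ = f.eval σ
  | not b => ¬ b.Holds σ
  | and b c => b.Holds σ ∧ c.Holds σ

/-- The time needed to carry out a test. -/
def time : Test → ℕ
  | natLt e f => e.time + f.time + 1
  | natEq e f => e.time + f.time + 1
  | realLt e f => e.time + f.time + 1
  | realEq e f => e.time + f.time + 1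
  | not b => b.time + 1
  | and b c => b.time + c.time + 1

end Test

/-- Programs. -/
inductive Prog where
  | skip
  | setNat (x : ℕ) (e : NExp)
  | setReal (x : ℕ) (e : RExp)
  | putNat (a : ℕ) (i : NExp) (e : NExp)
  | putReal (a : ℕ) (i : NExp) (e : RExp)
  | seq (p q : Prog)
  | ite (b : Test) (p q : Prog)
  | loop (b : Test) (p : Prog)

/-- `Exec p σ k τ`: started in state `σ`, the program `p` halts after exactly `k` time steps in
state `τ`. Here `loop b p` repeats `p` as long as the test `b` succeeds. -/
inductive Exec : Prog → Store → ℕ → Store → Prop where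
  | skip (σ : Store) : Exec .skip σ 1 σ
  | setNat (x : ℕ) (e : NExp) (σ : Store) :
      Exec (.setNat x e) σ (e.time + 1)
        { σ with nat := Function.update σ.nat x (e.eval σ) }
  | setReal (x : ℕ) (e : RExp) (σ : Store) :
      Exec (.setReal x e) σ (e.time + 1)
        { σ with real := Function.update σ.real x (e.eval σ) }
  | putNat (a : ℕ) (i e : NExp) (σ : Store) :
      Exec (.putNat a i e) σ (i.time + e.time + 1)
        { σ with natArr :=
            Function.update σ.natArr a (Function.update (σ.natArr a) (i.eval σ) (e.eval σ)) }
  | putReal (a : ℕ) (i : NExp) (e : RExp) (σ : Store) :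
      Exec (.putReal a i e) σ (i.time + e.time + 1)
        { σ with realArr :=
            Function.update σ.realArr a (Function.update (σ.realArr a) (i.eval σ) (e.eval σ)) }
  | seq {p q : Prog} {σ τ ρ : Store} {k l : ℕ} :
      Exec p σ k τ → Exec q τ l ρ → Exec (.seq p q) σ (k + l) ρ
  | iteTrue {b : Test} {p q : Prog} {σ τ : Store} {k : ℕ} :
      b.Holds σ → Exec p σ k τ → Exec (.ite b p q) σ (b.time + 1 + k) τ
  | iteFalse {b : Test} {p q : Prog} {σ τ : Store} {k : ℕ} :
      ¬ b.Holds σ → Exec q σ k τ → Exec (.ite b p q) σ (b.time + 1 + k) τ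
  | loopTrue {b : Test} {p : Prog} {σ τ ρ : Store} {k l : ℕ} :
      b.Holds σ → Exec p σ k τ → Exec (.loop b p) τ l ρ →
        Exec (.loop b p) σ (b.time + 1 + k + l) ρ
  | loopFalse {b : Test} {p : Prog} {σ : Store} :
      ¬ b.Holds σ → Exec (.loop b p) σ (b.time + 1) σ

/-- The array with the entries of `f`, followed by zeros. -/
def table {m : ℕ} {α : Type} [Zero α] (f : Fin m → α) (i : ℕ) : α :=
  if h : i < m then f ⟨i, h⟩ else 0

/-- The input encoding. Natural number registers `0, 1, 2, 3` hold `n, m, s, t`, real registers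
`0, 1` hold `R, ε`, natural number arrays `0, 1` hold the tails and the heads of the edges, real
arrays `0, 1` hold their costs and resource consumptions; everything else is zero. -/
def input (I : RSPInstance) (ε : ℝ) : Store where
  nat x := match x with
    | 0 => I.n
    | 1 => I.m
    | 2 => I.s
    | 3 => I.t
    | _ => 0
  real x := match x with
    | 0 => I.R
    | 1 => ε
    | _ => 0
  natArr a := match a with
    | 0 => table fun e => (I.src e : ℕ)
    | 1 => table fun e => (I.dst e : ℕ)
    | _ => fun _ => 0
  realArr a := match a with
    | 0 => table I.cost
    | 1 => table I.res
    | _ => fun _ => 0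

/-- The sequence of numbers returned in a final state: its length is in natural number register
`1`, its entries are in natural number array `2`. -/
def outputList (σ : Store) : List ℕ :=
  (List.range (σ.nat 1)).map (σ.natArr 2)

/-- The final state `σ` answers the instance `I` with accuracy `ε`: either register `0` is `1` and
the returned sequence lists the edge numbers of a `(1 + ε)`-approximation in the order of the path,
or register `0` is `0` and the instance has no solution. -/
def Answers (I : RSPInstance) (ε : ℝ) (σ : Store) : Prop :=
  (σ.nat 0 = 1 ∧ ∃ p : List (Fin I.m), I.IsApprox ε p ∧ outputList σ = p.map (fun e => (e : ℕ))) ∨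
  (σ.nat 0 = 0 ∧ ¬ ∃ p : List (Fin I.m), I.IsSolution p)

end RAM

/-!
The program follows the usual scheme for the restricted shortest path problem: bracket the optimal
cost ever more tightly with approximate tests, and finally solve the instance with costs rounded to
multiples of a small unit. The bound `n m (1 / ε + log log log n)` leaves no room for a logarithmic
factor anywhere, and the work is in how the tests are balanced.

All tests are runs of one dynamic program, `layered`. It rounds the costs to multiples of a unit
`δ` (by counting in unary, as there is no rounding operation) and computes, for weights
`0, 1, …, X`, a layer of labels: the label of a node in layer `k` is the least resource consumption
of a walk to the target of weight at most `k`. There are two modes.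

* With costs rounded down, edges may have weight `0`, and each layer has to be completed by
  Dijkstra's algorithm, at a cost of `O(m log n)` per layer. Success yields a solution of cost at
  most `(X + n) δ`; failure shows that every solution costs more than `X δ`.
* With costs rounded up, every edge has a positive weight and a layer takes time `O(m)`. Success
  yields a solution of cost at most `X δ`, failure shows that every solution costs more than
  `(X - n) δ`.

The runs are arranged as follows, with `l = ⌈log n⌉`.

* `bottleneck` finds the least `B` such that there is a solution using edges of cost at most `B`
  only, by binary search in the sorted list of costs. The optimal cost lies between `B` and `n B`.
  Each test needs a single layer, so this takes time `O(m l ^ 2)`, which is `O(n m)`.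
* `narrow` reduces the factor `n` to `2 (1 + l ^ 2)`. It doubles the unit until a test in the first
  mode with `n / l ^ 2 + 1` layers succeeds. These are at most `l + 1` tests of time
  `O((n / l ^ 2 + 1) m l)` each, which is `O(n m)` in total.
* `tighten` reduces that factor to `4` by bisecting its exponent, with tests in the second mode
  and `2 n + 1` layers. The exponent is `O(log log n)`, so there are `log log log n + O(1)` tests,
  each of time `O(n m)`.
* `finish` runs the second mode with the unit `ε L / n`, where `L` is the lower bound found, and
  `n + ⌈4 n / ε⌉ + 1` layers. The rounding error of a path is at most `ε L`. The edges that the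
  labels in the first successful layer are due to form a walk of least weight, and this walk is a
  path (`wp_backtrack`), so it is read off without removing cycles.

If the optimal cost is `0`, then `B = 0` and all units are `0`, and everything above holds verbatim.

Programs are verified with a weakest precondition `WP` that carries a number of time credits:
preconditions of loops state how many credits are left, which bounds the running time and proves
termination at once (`wp_loop`). What a program does not write to is handled by the syntactic
criterion `Exec.frame`. The correctness of the parts is collected in `wp_scheme`, and the credits
are bounded in `schemeTime_le` and `rounds_le`.
-/

namespace RAM

/-! ### A program logic with time credits -/

/-- Overwrite a natural number register. -/
def Store.setN (σ : Store) (x v : ℕ) : Store := { σ with nat := Function.update σ.nat x v }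

/-- Overwrite a real number register. -/
noncomputable def Store.setR (σ : Store) (x : ℕ) (v : ℝ) : Store :=
  { σ with real := Function.update σ.real x v }

/-- Overwrite a cell of a natural number array. -/
def Store.putN (σ : Store) (a i v : ℕ) : Store :=
  { σ with natArr := Function.update σ.natArr a (Function.update (σ.natArr a) i v) }

/-- Overwrite a cell of a real number array. -/
noncomputable def Store.putR (σ : Store) (a i : ℕ) (v : ℝ) : Store :=
  { σ with realArr := Function.update σ.realArr a (Function.update (σ.realArr a) i v) }

section Projections

variable (σ : Store) (x y a b i v : ℕ) (r : ℝ)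

@[simp] theorem setN_nat : (σ.setN x v).nat y = if y = x then v else σ.nat y := by
  simp [Store.setN, Function.update_apply]
@[simp] theorem setN_real : (σ.setN x v).real = σ.real := rfl
@[simp] theorem setN_natArr : (σ.setN x v).natArr = σ.natArr := rfl
@[simp] theorem setN_realArr : (σ.setN x v).realArr = σ.realArr := rfl
@[simp] theorem setR_nat : (σ.setR x r).nat = σ.nat := rfl
@[simp] theorem setR_real : (σ.setR x r).real y = if y = x then r else σ.real y := by
  simp [Store.setR, Function.update_apply]
@[simp] theorem setR_natArr : (σ.setR x r).natArr = σ.natArr := rfl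
@[simp] theorem setR_realArr : (σ.setR x r).realArr = σ.realArr := rfl
@[simp] theorem putN_nat : (σ.putN a i v).nat = σ.nat := rfl
@[simp] theorem putN_real : (σ.putN a i v).real = σ.real := rfl
@[simp] theorem putN_natArr : (σ.putN a i v).natArr b =
    if b = a then Function.update (σ.natArr a) i v else σ.natArr b := by
  simp [Store.putN, Function.update_apply]
@[simp] theorem putN_realArr : (σ.putN a i v).realArr = σ.realArr := rfl
@[simp] theorem putR_nat : (σ.putR a i r).nat = σ.nat := rfl
@[simp] theorem putR_real : (σ.putR a i r).real = σ.real := rfl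
@[simp] theorem putR_natArr : (σ.putR a i r).natArr = σ.natArr := rfl
@[simp] theorem putR_realArr : (σ.putR a i r).realArr b =
    if b = a then Function.update (σ.realArr a) i r else σ.realArr b := by
  simp [Store.putR, Function.update_apply]

end Projections

namespace Prog

/-- The program assigns natural number register `x` somewhere. -/
def writesNat (x : ℕ) : Prog → Bool
  | setNat y _ => Nat.beq x y
  | seq p q => p.writesNat x || q.writesNat x
  | ite _ p q => p.writesNat x || q.writesNat x
  | loop _ p => p.writesNat x
  | _ => false

/-- The program assigns real number register `x` somewhere. -/
def writesReal (x : ℕ) : Prog → Bool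
  | setReal y _ => Nat.beq x y
  | seq p q => p.writesReal x || q.writesReal x
  | ite _ p q => p.writesReal x || q.writesReal x
  | loop _ p => p.writesReal x
  | _ => false

/-- The program writes to natural number array `a` somewhere. -/
def writesNatArr (a : ℕ) : Prog → Bool
  | putNat b _ _ => Nat.beq a b
  | seq p q => p.writesNatArr a || q.writesNatArr a
  | ite _ p q => p.writesNatArr a || q.writesNatArr a
  | loop _ p => p.writesNatArr a
  | _ => false

/-- The program writes to real number array `a` somewhere. -/
def writesRealArr (a : ℕ) : Prog → Bool
  | putReal b _ _ => Nat.beq a b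
  | seq p q => p.writesRealArr a || q.writesRealArr a
  | ite _ p q => p.writesRealArr a || q.writesRealArr a
  | loop _ p => p.writesRealArr a
  | _ => false

end Prog

/-- The states `σ` and `τ` agree on everything that `p` does not syntactically write to. -/
structure Frame (p : Prog) (σ τ : Store) : Prop where
  nat : ∀ x, p.writesNat x = false → τ.nat x = σ.nat x
  real : ∀ x, p.writesReal x = false → τ.real x = σ.real x
  natArr : ∀ a, p.writesNatArr a = false → τ.natArr a = σ.natArr a
  realArr : ∀ a, p.writesRealArr a = false → τ.realArr a = σ.realArr a

theorem Frame.refl (p : Prog) (σ : Store) : Frame p σ σ :=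
  ⟨fun _ _ => rfl, fun _ _ => rfl, fun _ _ => rfl, fun _ _ => rfl⟩

theorem Frame.trans {p : Prog} {σ τ ρ : Store} (h : Frame p σ τ) (h' : Frame p τ ρ) :
    Frame p σ ρ :=
  ⟨fun x hx => (h'.nat x hx).trans (h.nat x hx), fun x hx => (h'.real x hx).trans (h.real x hx),
    fun x hx => (h'.natArr x hx).trans (h.natArr x hx),
    fun x hx => (h'.realArr x hx).trans (h.realArr x hx)⟩

theorem Frame.mono {p q : Prog} {σ τ : Store} (h : Frame p σ τ)
    (h1 : ∀ x, q.writesNat x = false → p.writesNat x = false)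
    (h2 : ∀ x, q.writesReal x = false → p.writesReal x = false)
    (h3 : ∀ x, q.writesNatArr x = false → p.writesNatArr x = false)
    (h4 : ∀ x, q.writesRealArr x = false → p.writesRealArr x = false) : Frame q σ τ :=
  ⟨fun x hx => h.nat x (h1 x hx), fun x hx => h.real x (h2 x hx),
    fun x hx => h.natArr x (h3 x hx), fun x hx => h.realArr x (h4 x hx)⟩

theorem Frame.of_loop {b : Test} {p : Prog} {σ τ : Store} (h : Frame p σ τ) :
    Frame (.loop b p) σ τ :=
  h.mono (fun _ h => h) (fun _ h => h) (fun _ h => h) (fun _ h => h)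

theorem beq_eq_false {x y : ℕ} (h : Nat.beq x y = false) : x ≠ y := by
  rintro rfl; simp at h

/-- What a program does not write to according to its text stays unchanged. -/
theorem Exec.frame {p : Prog} {σ τ : Store} {k : ℕ} (h : Exec p σ k τ) : Frame p σ τ := by
  induction h with
  | skip σ => exact Frame.refl _ _
  | setNat x e σ =>
    refine ⟨fun y hy => Function.update_of_ne (beq_eq_false hy) _ _, fun _ _ => rfl,
      fun _ _ => rfl, fun _ _ => rfl⟩
  | setReal x e σ =>
    refine ⟨fun _ _ => rfl, fun y hy => Function.update_of_ne (beq_eq_false hy) _ _,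
      fun _ _ => rfl, fun _ _ => rfl⟩
  | putNat a i e σ =>
    refine ⟨fun _ _ => rfl, fun _ _ => rfl,
      fun y hy => Function.update_of_ne (beq_eq_false hy) _ _, fun _ _ => rfl⟩
  | putReal a i e σ =>
    refine ⟨fun _ _ => rfl, fun _ _ => rfl, fun _ _ => rfl,
      fun y hy => Function.update_of_ne (beq_eq_false hy) _ _⟩
  | seq _ _ h1 h2 =>
    refine (h1.mono ?_ ?_ ?_ ?_).trans (h2.mono ?_ ?_ ?_ ?_) <;>
      simp +contextual [Prog.writesNat, Prog.writesReal, Prog.writesNatArr, Prog.writesRealArr]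
  | iteTrue _ _ h1 =>
    refine h1.mono ?_ ?_ ?_ ?_ <;>
      simp +contextual [Prog.writesNat, Prog.writesReal, Prog.writesNatArr, Prog.writesRealArr]
  | iteFalse _ _ h1 =>
    refine h1.mono ?_ ?_ ?_ ?_ <;>
      simp +contextual [Prog.writesNat, Prog.writesReal, Prog.writesNatArr, Prog.writesRealArr]
  | loopTrue _ _ _ h1 h2 => exact h1.of_loop.trans h2
  | loopFalse _ => exact Frame.refl _ _

/-- Weakest precondition with time credits: started in `σ` with `T` credits, the program `p` halts
within `T` steps, and `Q` holds of the credits left over and the final state. -/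
def WP (p : Prog) (σ : Store) (T : ℕ) (Q : ℕ → Store → Prop) : Prop :=
  ∃ k τ, Exec p σ k τ ∧ k ≤ T ∧ Q (T - k) τ

section Rules

variable {σ : Store} {T : ℕ} {Q : ℕ → Store → Prop}

theorem wp_skip (h : 1 ≤ T) (hQ : Q (T - 1) σ) : WP .skip σ T Q := ⟨1, σ, .skip σ, h, hQ⟩

theorem wp_setNat {x : ℕ} {e : NExp} (h : e.time + 1 ≤ T)
    (hQ : Q (T - (e.time + 1)) (σ.setN x (e.eval σ))) : WP (.setNat x e) σ T Q :=
  ⟨_, _, .setNat x e σ, h, hQ⟩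

theorem wp_setReal {x : ℕ} {e : RExp} (h : e.time + 1 ≤ T)
    (hQ : Q (T - (e.time + 1)) (σ.setR x (e.eval σ))) : WP (.setReal x e) σ T Q :=
  ⟨_, _, .setReal x e σ, h, hQ⟩

theorem wp_putNat {a : ℕ} {i e : NExp} (h : i.time + e.time + 1 ≤ T)
    (hQ : Q (T - (i.time + e.time + 1)) (σ.putN a (i.eval σ) (e.eval σ))) :
    WP (.putNat a i e) σ T Q :=
  ⟨_, _, .putNat a i e σ, h, hQ⟩

theorem wp_putReal {a : ℕ} {i : NExp} {e : RExp} (h : i.time + e.time + 1 ≤ T)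
    (hQ : Q (T - (i.time + e.time + 1)) (σ.putR a (i.eval σ) (e.eval σ))) :
    WP (.putReal a i e) σ T Q :=
  ⟨_, _, .putReal a i e σ, h, hQ⟩

theorem wp_seq {p q : Prog} (h : WP p σ T fun T' τ => WP q τ T' Q) : WP (.seq p q) σ T Q := by
  obtain ⟨k, τ, h1, hk, l, ρ, h2, hl, hQ⟩ := h
  exact ⟨k + l, ρ, .seq h1 h2, by omega, by rwa [Nat.sub_add_eq]⟩

theorem wp_ite {b : Test} {p q : Prog} (h : b.time + 1 ≤ T)
    (hp : b.Holds σ → WP p σ (T - (b.time + 1)) Q)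
    (hq : ¬ b.Holds σ → WP q σ (T - (b.time + 1)) Q) : WP (.ite b p q) σ T Q := by
  by_cases hb : b.Holds σ
  · obtain ⟨k, τ, h1, hk, hQ⟩ := hp hb
    exact ⟨_, τ, .iteTrue hb h1, by omega, by rwa [Nat.sub_add_eq]⟩
  · obtain ⟨k, τ, h1, hk, hQ⟩ := hq hb
    exact ⟨_, τ, .iteFalse hb h1, by omega, by rwa [Nat.sub_add_eq]⟩

/-- The loop rule. The credits are part of the invariant, and as every round consumes some, they
also prove termination. Everything the body does not write to stays as it was before the loop. -/
theorem wp_loop {b : Test} {p : Prog} (Inv : ℕ → Store → Prop) (h0 : Inv T σ)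
    (hb : ∀ T' τ, Frame (.loop b p) σ τ → Inv T' τ → b.time + 1 ≤ T' ∧
      (b.Holds τ → WP p τ (T' - (b.time + 1)) Inv) ∧
      (¬ b.Holds τ → Q (T' - (b.time + 1)) τ)) : WP (.loop b p) σ T Q := by
  suffices H : ∀ T' τ, Frame (.loop b p) σ τ → Inv T' τ → WP (.loop b p) τ T' Q from
    H T σ (Frame.refl _ _) h0
  intro T'
  induction T' using Nat.strong_induction_on with
  | _ T' ih =>
    intro τ hf hI
    obtain ⟨ht, h1, h2⟩ := hb T' τ hf hI
    by_cases hh : b.Holds τ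
    · obtain ⟨k, ρ, he, hk, hI'⟩ := h1 hh
      obtain ⟨l, π, he', hl, hQ⟩ := ih _ (by omega) ρ (hf.trans he.frame.of_loop) hI'
      exact ⟨_, π, .loopTrue hh he he', by omega, by rwa [Nat.sub_add_eq, Nat.sub_add_eq]⟩
    · exact ⟨_, τ, .loopFalse hh, ht, h2 hh⟩

/-- Using the specification of a subprogram: only the credits it may need are handed to it. -/
theorem wp_call {p : Prog} {B : ℕ} {Post : Store → Prop} (h : WP p σ B fun _ τ => Post τ)
    (hB : B ≤ T) (hQ : ∀ T' τ, T - B ≤ T' → Frame p σ τ → Post τ → Q T' τ) : WP p σ T Q := by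
  obtain ⟨k, τ, he, hk, hP⟩ := h
  exact ⟨k, τ, he, by omega, hQ _ τ (by omega) he.frame hP⟩

end Rules

section Characterizations

variable {σ : Store} {T : ℕ} {Q : ℕ → Store → Prop}

@[simp] theorem wp_skip_iff : WP .skip σ T Q ↔ 1 ≤ T ∧ Q (T - 1) σ := by
  refine ⟨?_, fun h => wp_skip h.1 h.2⟩
  rintro ⟨k, τ, ⟨⟩, hk, hQ⟩
  exact ⟨hk, hQ⟩

@[simp] theorem wp_setNat_iff {x : ℕ} {e : NExp} : WP (.setNat x e) σ T Q ↔
    e.time + 1 ≤ T ∧ Q (T - (e.time + 1)) (σ.setN x (e.eval σ)) := by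
  refine ⟨?_, fun h => wp_setNat h.1 h.2⟩
  rintro ⟨k, τ, ⟨⟩, hk, hQ⟩
  exact ⟨hk, hQ⟩

@[simp] theorem wp_setReal_iff {x : ℕ} {e : RExp} : WP (.setReal x e) σ T Q ↔
    e.time + 1 ≤ T ∧ Q (T - (e.time + 1)) (σ.setR x (e.eval σ)) := by
  refine ⟨?_, fun h => wp_setReal h.1 h.2⟩
  rintro ⟨k, τ, ⟨⟩, hk, hQ⟩
  exact ⟨hk, hQ⟩

@[simp] theorem wp_putNat_iff {a : ℕ} {i e : NExp} : WP (.putNat a i e) σ T Q ↔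
    i.time + e.time + 1 ≤ T ∧
      Q (T - (i.time + e.time + 1)) (σ.putN a (i.eval σ) (e.eval σ)) := by
  refine ⟨?_, fun h => wp_putNat h.1 h.2⟩
  rintro ⟨k, τ, ⟨⟩, hk, hQ⟩
  exact ⟨hk, hQ⟩

@[simp] theorem wp_putReal_iff {a : ℕ} {i : NExp} {e : RExp} : WP (.putReal a i e) σ T Q ↔
    i.time + e.time + 1 ≤ T ∧
      Q (T - (i.time + e.time + 1)) (σ.putR a (i.eval σ) (e.eval σ)) := by
  refine ⟨?_, fun h => wp_putReal h.1 h.2⟩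
  rintro ⟨k, τ, ⟨⟩, hk, hQ⟩
  exact ⟨hk, hQ⟩

@[simp] theorem wp_seq_iff {p q : Prog} : WP (.seq p q) σ T Q ↔
    WP p σ T fun T' τ => WP q τ T' Q := by
  refine ⟨?_, wp_seq⟩
  rintro ⟨k, τ, h, hk, hQ⟩
  cases h with
  | seq h1 h2 => exact ⟨_, _, h1, by omega, _, _, h2, by omega, by rwa [← Nat.sub_add_eq]⟩

@[simp] theorem wp_ite_iff {b : Test} {p q : Prog} : WP (.ite b p q) σ T Q ↔
    b.time + 1 ≤ T ∧ (b.Holds σ → WP p σ (T - (b.time + 1)) Q) ∧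
      (¬ b.Holds σ → WP q σ (T - (b.time + 1)) Q) := by
  refine ⟨?_, fun h => wp_ite h.1 h.2.1 h.2.2⟩
  rintro ⟨k, τ, h, hk, hQ⟩
  cases h with
  | iteTrue hb h =>
    exact ⟨by omega, fun _ => ⟨_, _, h, by omega, by rwa [← Nat.sub_add_eq]⟩,
      fun hn => absurd hb hn⟩
  | iteFalse hb h =>
    exact ⟨by omega, fun hn => absurd hn hb,
      fun _ => ⟨_, _, h, by omega, by rwa [← Nat.sub_add_eq]⟩⟩

end Characterizations

attribute [simp] NExp.eval NExp.time RExp.eval RExp.time Test.Holds Test.time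

/-! ### Memory layout -/

infixr:30 " ;; " => Prog.seq

-- Natural number registers. The first four hold the input.
notation "rn" => 0
notation "rm" => 1
notation "rs" => 2
notation "rt" => 3
-- The number of leaves of the tournament tree, and the position in `blab` of the current layer.
notation "rsize" => 4
notation "rbase" => 5
-- A node of the tournament tree and its left child.
notation "rnode" => 6
notation "rleft" => 7
-- In Dijkstra's algorithm: the number of settled nodes, the node settled last, and a slot
-- (or a counter).
notation "rcnt" => 8
notation "ru" => 9
notation "rj" => 10
-- The current edge.
notation "redge" => 11
-- The greatest weight of a layer, and `n` or `0`, depending on whether costs are rounded up.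
notation "rX" => 12
notation "rmode" => 13
-- A counter, the current entry for `aoff`, and the current node.
notation "rk" => 14
notation "roff" => 15
notation "rv" => 16
-- The range of a binary search, and its middle.
notation "rlo" => 17
notation "rhi" => 18
notation "rmid" => 19
-- The position in an array, the number of edges of the path, and an entry of `apred`.
notation "rpos" => 20
notation "rlen" => 21
notation "rpred" => 22
-- A power of two, its exponent `⌈log n⌉`, the exponent of a bracket, half of it, and `⌈log n⌉ ^ 2`.
notation "rpow" => 23
notation "rlog" => 24
notation "rexp" => 25
notation "rhalf" => 26
notation "racc" => 27

-- Natural number arrays: tails and heads of the edges, and the output.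
notation "asrc" => 0
notation "adst" => 1
notation "aout" => 2
-- The edges ordered by their heads, and the first slot of each head.
notation "aperm" => 3
notation "astart" => 4
-- The weights of the edges, multiplied by `n` so that they are differences of positions in `blab`.
notation "aoff" => 5
-- The entries of the tournament tree: node numbers plus one, or `0` for an empty node.
notation "awin" => 6
-- The order in which nodes are settled.
notation "aord" => 7
-- For each label, the number of the edge it is due to plus one, or `0`.
notation "apred" => 8
-- The function `x ↦ x / 2`.
notation "ahalf" => 9

-- Real number registers: the input `R` and `ε`, the unit for rounding, a lower bound for the
-- optimal cost, and a power of two.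
notation "xR" => 0
notation "xeps" => 1
notation "xunit" => 2
notation "xlow" => 3
notation "xpow" => 4

-- Real number arrays: costs and resource consumptions of the edges, labels, the keys of the
-- tournament tree, and the costs in increasing order.
notation "bcost" => 0
notation "bres" => 1
notation "blab" => 2
notation "bkey" => 3
notation "bsort" => 4

/-! ### Halving -/

/-- Tabulate `x ↦ x / 2` for `x < 2 * (n + m)`, as the machine cannot halve numbers. -/
def halfTable : Prog :=
  .setNat rj (.const 0) ;;
  .loop (.natLt (.reg rj) (.add (.reg rn) (.reg rm)))
    (.putNat ahalf (.add (.reg rj) (.reg rj)) (.reg rj) ;;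
     .putNat ahalf (.add (.add (.reg rj) (.reg rj)) (.const 1)) (.reg rj) ;;
     .setNat rj (.add (.reg rj) (.const 1)))

theorem wp_halfTable (σ : Store) : WP halfTable σ (30 * (σ.nat rn + σ.nat rm) + 10) fun _ τ =>
    ∀ x < 2 * (σ.nat rn + σ.nat rm), τ.natArr ahalf x = x / 2 := by
  unfold halfTable
  simp only [wp_seq_iff, wp_setNat_iff, NExp.time, NExp.eval]
  refine ⟨by omega, ?_⟩
  refine wp_loop (fun T τ => 30 * (σ.nat rn + σ.nat rm - τ.nat rj) + 6 ≤ T ∧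
    ∀ x < 2 * τ.nat rj, τ.natArr ahalf x = x / 2) ⟨by simp, by simp⟩ ?_
  intro T τ hf ⟨hT, hx⟩
  have e0 := hf.nat rn rfl
  have e1 := hf.nat rm rfl
  simp at e0 e1
  simp [e0, e1]
  refine ⟨by omega, fun h => ⟨by omega, by omega, by omega, by omega, ?_⟩,
    fun h x hx' => hx x (by omega)⟩
  intro x hx'
  simp only [Function.update_apply]
  split_ifs
  · omega
  · omega
  · exact hx x (by omega)

/-! ### Tournament trees -/

/-- Node `j` of a tournament tree holds the contents of one of its children `2 * j` and
`2 * j + 1`: of one with the smaller key among those that are not empty (have an entry `≠ 0`). -/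
def GoodNode (W : ℕ → ℕ) (K : ℕ → ℝ) (j : ℕ) : Prop :=
  (W j = W (2 * j) ∧ K j = K (2 * j) ∨ W j = W (2 * j + 1) ∧ K j = K (2 * j + 1)) ∧
  (W (2 * j) ≠ 0 → W j ≠ 0 ∧ K j ≤ K (2 * j)) ∧
  (W (2 * j + 1) ≠ 0 → W j ≠ 0 ∧ K j ≤ K (2 * j + 1))

/-- A tournament tree with leaves `N, …, 2 * N - 1`, in heap order with root `1`. -/
def IsTournament (N : ℕ) (W : ℕ → ℕ) (K : ℕ → ℝ) : Prop :=
  ∀ j, 1 ≤ j → j < N → GoodNode W K j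

theorem GoodNode.congr {W W' : ℕ → ℕ} {K K' : ℕ → ℝ} {j : ℕ} (h : GoodNode W K j)
    (hW : ∀ x, x = j ∨ x / 2 = j → W' x = W x) (hK : ∀ x, x = j ∨ x / 2 = j → K' x = K x) :
    GoodNode W' K' j := by
  unfold GoodNode
  rw [hW j (by omega), hW (2 * j) (by omega), hW (2 * j + 1) (by omega),
    hK j (by omega), hK (2 * j) (by omega), hK (2 * j + 1) (by omega)]
  exact h

/-- The root is minimal: its key is at most that of any node that is not empty. -/
theorem IsTournament.root_le {N : ℕ} {W : ℕ → ℕ} {K : ℕ → ℝ} (h : IsTournament N W K) (x : ℕ)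
    (hx : 1 ≤ x) (hxN : x < 2 * N) (hW : W x ≠ 0) : W 1 ≠ 0 ∧ K 1 ≤ K x := by
  induction x using Nat.strong_induction_on with
  | _ x ih =>
    obtain rfl | hx1 := hx.eq_or_lt
    · exact ⟨hW, le_rfl⟩
    obtain ⟨-, h1, h2⟩ := h (x / 2) (by omega) (by omega)
    have key : W (x / 2) ≠ 0 ∧ K (x / 2) ≤ K x := by
      obtain h' | h' : x = 2 * (x / 2) ∨ x = 2 * (x / 2) + 1 := by omega
      · rw [← h'] at h1; exact h1 hW
      · rw [← h'] at h2; exact h2 hW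
    obtain ⟨h3, h4⟩ := ih (x / 2) (by omega) (by omega) (by omega) key.1
    exact ⟨h3, h4.trans key.2⟩

/-- Every node holds the contents of some leaf. -/
theorem IsTournament.exists_leaf {N : ℕ} {W : ℕ → ℕ} {K : ℕ → ℝ} (h : IsTournament N W K) (j : ℕ)
    (hj : 1 ≤ j) (hjN : j < 2 * N) : ∃ v < N, W j = W (N + v) ∧ K j = K (N + v) := by
  obtain ⟨d, hd⟩ : ∃ d, d = 2 * N - j := ⟨_, rfl⟩
  induction d using Nat.strong_induction_on generalizing j with
  | _ d ih =>
    by_cases hN : N ≤ j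
    · exact ⟨j - N, by omega, by rw [Nat.add_sub_cancel' hN], by rw [Nat.add_sub_cancel' hN]⟩
    · obtain ⟨h' | h', -⟩ := h j hj (by omega)
      · obtain ⟨v, hv, hv'⟩ := ih _ (by omega) (2 * j) (by omega) (by omega) rfl
        exact ⟨v, hv, h'.1.trans hv'.1, h'.2.trans hv'.2⟩
      · obtain ⟨v, hv, hv'⟩ := ih _ (by omega) (2 * j + 1) (by omega) (by omega) rfl
        exact ⟨v, hv, h'.1.trans hv'.1, h'.2.trans hv'.2⟩

/-- Recompute the node in register `rnode` from its children. -/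
def pull : Prog :=
  .setNat rleft (.add (.reg rnode) (.reg rnode)) ;;
  .ite (.and (.not (.natEq (.get awin (.reg rleft)) (.const 0)))
      (.not (.and (.not (.natEq (.get awin (.add (.reg rleft) (.const 1))) (.const 0)))
        (.realLt (.get bkey (.add (.reg rleft) (.const 1))) (.get bkey (.reg rleft))))))
    (.putNat awin (.reg rnode) (.get awin (.reg rleft)) ;;
     .putReal bkey (.reg rnode) (.get bkey (.reg rleft)))
    (.putNat awin (.reg rnode) (.get awin (.add (.reg rleft) (.const 1))) ;;
     .putReal bkey (.reg rnode) (.get bkey (.add (.reg rleft) (.const 1))))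

theorem wp_pull (σ : Store) (h : 1 ≤ σ.nat rnode) : WP pull σ 40 fun _ τ =>
    GoodNode (τ.natArr awin) (τ.realArr bkey) (σ.nat rnode) ∧ ∀ x, x ≠ σ.nat rnode →
      τ.natArr awin x = σ.natArr awin x ∧ τ.realArr bkey x = σ.realArr bkey x := by
  set j := σ.nat rnode with hj
  have h1 : 2 * j ≠ j := by omega
  have h2 : 2 * j + 1 ≠ j := by omega
  have h3 : j + j = 2 * j := by omega
  simp [pull, ← hj, GoodNode, h1, h2, h3, Function.update_apply]
  refine ⟨fun a b => ⟨fun h => ⟨a, b h⟩, ?_⟩, fun a => ⟨fun h => ⟨(a h).1, (a h).2.le⟩, ?_⟩⟩ <;>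
    exact fun x hx => ⟨fun h => absurd h hx, fun h => absurd h hx⟩

/-- Recompute all proper ancestors of the node in register `rnode`. -/
def climb : Prog :=
  .loop (.natLt (.const 1) (.reg rnode)) (.setNat rnode (.get ahalf (.reg rnode)) ;; pull)

/-- Changing a leaf spoils only the tree property at its parent; recomputing a node moves the
defect to the parent of that node, until it disappears at the root. -/
theorem wp_climb (σ : Store) (N L : ℕ) (hhalf : ∀ x < 2 * N, σ.natArr ahalf x = x / 2)
    (h1 : 1 ≤ σ.nat rnode) (h2 : σ.nat rnode < 2 * N) (hL : σ.nat rnode < 2 ^ (L + 1))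
    (hT : ∀ j, 1 ≤ j → j < N → j ≠ σ.nat rnode / 2 →
      GoodNode (σ.natArr awin) (σ.realArr bkey) j) :
    WP climb σ (60 * L + 10) fun _ τ => IsTournament N (τ.natArr awin) (τ.realArr bkey) ∧
      ∀ x, N ≤ x → τ.natArr awin x = σ.natArr awin x ∧ τ.realArr bkey x = σ.realArr bkey x := by
  refine wp_loop (fun T τ => ∃ L, 60 * L + 10 ≤ T ∧ 1 ≤ τ.nat rnode ∧ τ.nat rnode < 2 * N ∧
    τ.nat rnode < 2 ^ (L + 1) ∧ (∀ j, 1 ≤ j → j < N → j ≠ τ.nat rnode / 2 →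
      GoodNode (τ.natArr awin) (τ.realArr bkey) j) ∧
    ∀ x, N ≤ x → τ.natArr awin x = σ.natArr awin x ∧ τ.realArr bkey x = σ.realArr bkey x)
    ⟨L, le_rfl, h1, h2, hL, hT, fun _ _ => ⟨rfl, rfl⟩⟩ ?_
  rintro T τ hf ⟨L, hT, h1, h2, hL, hG, hx⟩
  have eh := hf.natArr ahalf rfl
  have eh' : τ.natArr ahalf (τ.nat rnode) = τ.nat rnode / 2 := by rw [eh]; exact hhalf _ h2
  simp [eh']
  refine ⟨by omega, fun h => ?_, fun h => ⟨?_, hx⟩⟩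
  · obtain ⟨L, rfl⟩ : ∃ L', L = L' + 1 := by
      cases L with
      | zero => simp at hL; omega
      | succ L => exact ⟨L, rfl⟩
    refine ⟨by omega, wp_call (wp_pull _ (by simp; omega)) (by omega) ?_⟩
    rintro T' ρ hT' hf' ⟨hg, hu⟩
    simp at hg hu
    have e1 : ρ.nat rnode = τ.nat rnode / 2 := by rw [hf'.nat rnode rfl]; simp
    rw [e1]
    refine ⟨L, by omega, by omega, by omega, by rw [pow_succ] at hL; omega, ?_, ?_⟩
    · intro j hj hjN hne
      by_cases hj' : j = τ.nat rnode / 2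
      · rw [hj']; exact hg
      · refine (hG j hj hjN hj').congr ?_ ?_
        · exact fun x hx => (hu x (by omega)).1
        · exact fun x hx => (hu x (by omega)).2
    · intro x hxN
      rw [(hu x (by omega)).1, (hu x (by omega)).2]
      exact hx x hxN
  · intro j hj hjN
    exact hG j hj hjN (by omega)

/-- Build the tournament tree over the `rsize` entries of `blab` that start at index `rbase`. -/
def buildTree : Prog :=
  .setNat rj (.const 0) ;;
  .loop (.natLt (.reg rj) (.reg rsize))
    (.putNat awin (.add (.reg rsize) (.reg rj)) (.add (.reg rj) (.const 1)) ;;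
     .putReal bkey (.add (.reg rsize) (.reg rj)) (.get blab (.add (.reg rbase) (.reg rj))) ;;
     .setNat rj (.add (.reg rj) (.const 1))) ;;
  .setNat rnode (.reg rsize) ;;
  .loop (.natLt (.const 1) (.reg rnode)) (.setNat rnode (.sub (.reg rnode) (.const 1)) ;; pull)

theorem wp_buildTree (σ : Store) : WP buildTree σ (100 * σ.nat rsize + 30) fun _ τ =>
    IsTournament (σ.nat rsize) (τ.natArr awin) (τ.realArr bkey) ∧
    ∀ v < σ.nat rsize, τ.natArr awin (σ.nat rsize + v) = v + 1 ∧
      τ.realArr bkey (σ.nat rsize + v) = σ.realArr blab (σ.nat rbase + v) := by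
  simp only [buildTree, wp_seq_iff, wp_setNat_iff, NExp.time, NExp.eval]
  refine ⟨by omega, ?_⟩
  refine wp_loop (fun T τ => 30 * (σ.nat rsize - τ.nat rj) + 70 * σ.nat rsize + 20 ≤ T ∧
    ∀ v < τ.nat rj, τ.natArr awin (σ.nat rsize + v) = v + 1 ∧
      τ.realArr bkey (σ.nat rsize + v) = σ.realArr blab (σ.nat rbase + v))
    ⟨by simp; omega, by simp⟩ ?_
  intro T τ hf ⟨hT, hx⟩
  have e0 := hf.nat rsize rfl
  have e1 := hf.nat rbase rfl
  have e2 := hf.realArr blab rfl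
  simp at e0 e1 e2
  simp [e0, e1, e2]
  refine ⟨by omega, fun h => ⟨by omega, by omega, by omega, by omega, ?_⟩,
    fun h => ⟨by omega, ?_⟩⟩
  · intro v hv
    simp only [Function.update_apply]
    by_cases hv' : v = τ.nat rj
    · simp [hv']
    · simp [hv', hx v (by omega)]
  refine wp_loop (fun T ρ => 60 * ρ.nat rnode + 10 ≤ T ∧ ρ.nat rnode ≤ σ.nat rsize ∧
    (∀ j, 1 ≤ j → ρ.nat rnode ≤ j → j < σ.nat rsize →
      GoodNode (ρ.natArr awin) (ρ.realArr bkey) j) ∧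
    ∀ v < σ.nat rsize, ρ.natArr awin (σ.nat rsize + v) = v + 1 ∧
      ρ.realArr bkey (σ.nat rsize + v) = σ.realArr blab (σ.nat rbase + v))
    ⟨by simp; omega, by simp, ?_, ?_⟩ ?_
  · intro j h1 h2 h3
    simp at h2; omega
  · simpa using fun v hv => hx v (by omega)
  · rintro T' ρ hf ⟨hT', h1, h2, h3⟩
    simp
    refine ⟨by omega, fun h => ⟨by omega, wp_call (wp_pull _ (by simp; omega)) (by omega) ?_⟩,
      fun h => ⟨fun j hj hjN => h2 j hj (by omega) hjN, h3⟩⟩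
    rintro T'' π hT'' hf' ⟨hg, hu⟩
    simp at hg hu
    have e1 : π.nat rnode = ρ.nat rnode - 1 := by rw [hf'.nat rnode rfl]; simp
    rw [e1]
    refine ⟨by omega, by omega, ?_, ?_⟩
    · intro j hj hjN hjs
      by_cases hj' : j = ρ.nat rnode - 1
      · rw [hj']; exact hg
      · refine (h2 j hj (by omega) hjs).congr ?_ ?_
        · exact fun x hx => (hu x (by omega)).1
        · exact fun x hx => (hu x (by omega)).2
    · intro v hv
      rw [(hu _ (by omega)).1, (hu _ (by omega)).2]
      exact h3 v hv

/-! ### Dijkstra's algorithm -/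

/-- Dijkstra's algorithm on the entries of `blab` at `rbase, …, rbase + rsize - 1`, which are
labels of the nodes `0, …, rsize - 1`. The edges into node `u` are listed in `aperm` in the slots
from `astart[u]` up to `astart[u + 1]`; those with offset `0` are relaxed. The order in which
nodes are settled is recorded in `aord`. -/
def dijkstra : Prog :=
  buildTree ;;
  .setNat rcnt (.const 0) ;;
  .loop (.natLt (.reg rcnt) (.reg rsize))
    (.setNat ru (.sub (.get awin (.const 1)) (.const 1)) ;;
     .putNat aord (.reg rcnt) (.reg ru) ;;
     .setNat rnode (.add (.reg rsize) (.reg ru)) ;;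
     .putNat awin (.reg rnode) (.const 0) ;;
     climb ;;
     .setNat rj (.get astart (.reg ru)) ;;
     .loop (.natLt (.reg rj) (.get astart (.add (.reg ru) (.const 1))))
       (.setNat redge (.get aperm (.reg rj)) ;;
        .setNat rv (.get asrc (.reg redge)) ;;
        .setNat rj (.add (.reg rj) (.const 1)) ;;
        .ite (.and (.natEq (.get aoff (.reg redge)) (.const 0))
            (.realLt (.add (.get blab (.add (.reg rbase) (.reg ru))) (.get bres (.reg redge)))
              (.get blab (.add (.reg rbase) (.reg rv)))))
          (.putReal blab (.add (.reg rbase) (.reg rv))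
             (.add (.get blab (.add (.reg rbase) (.reg ru))) (.get bres (.reg redge))) ;;
           .setNat rnode (.add (.reg rsize) (.reg rv)) ;;
           .putReal bkey (.reg rnode) (.get blab (.add (.reg rbase) (.reg rv))) ;;
           climb)
          .skip) ;;
     .setNat rcnt (.add (.reg rcnt) (.const 1)))

/-- The state of Dijkstra's algorithm when the nodes in `U` are still unsettled: `W` and `K` form
the tournament tree, `D` holds the labels, which were `D₀` initially and satisfy a predicate `P`
preserved by relaxations, and `ord` lists the `cnt` settled nodes by increasing label. -/
structure DijkstraState (N base : ℕ) (D₀ : ℕ → ℝ) (P : ℕ → ℝ → Prop) (cnt : ℕ) (U : Finset ℕ)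
    (W : ℕ → ℕ) (K D : ℕ → ℝ) (ord : ℕ → ℕ) : Prop where
  sub : U ⊆ Finset.range N
  card : U.card + cnt = N
  tree : IsTournament N W K
  leaf : ∀ v < N, W (N + v) = if v ∈ U then v + 1 else 0
  key : ∀ v ∈ U, K (N + v) = D (base + v)
  mono : ∀ w < N, w ∉ U → ∀ u ∈ U, D (base + w) ≤ D (base + u)
  sound : ∀ v < N, P v (D (base + v))
  outside : ∀ x, x < base ∨ base + N ≤ x → D x = D₀ x
  le : ∀ x, D x ≤ D₀ x
  ord_mem : ∀ i < cnt, ord i < N ∧ ord i ∉ U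
  ord_surj : ∀ v < N, v ∉ U → ∃ i < cnt, ord i = v
  ord_mono : ∀ i j, i < j → j < cnt → D (base + ord i) ≤ D (base + ord j)

section

variable {N base cnt : ℕ} {D₀ : ℕ → ℝ} {P : ℕ → ℝ → Prop} {U : Finset ℕ} {W : ℕ → ℕ}
  {K D : ℕ → ℝ} {ord : ℕ → ℕ}

/-- The root of the tree names an unsettled node with the least label. -/
theorem DijkstraState.root (h : DijkstraState N base D₀ P cnt U W K D ord) (hc : cnt < N) :
    W 1 = W 1 - 1 + 1 ∧ W 1 - 1 ∈ U ∧ ∀ x ∈ U, D (base + (W 1 - 1)) ≤ D (base + x) := by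
  have hcard := h.card
  obtain ⟨x, hx⟩ : U.Nonempty := by
    rw [← Finset.card_pos]; omega
  have hle : ∀ x ∈ U, W 1 ≠ 0 ∧ K 1 ≤ D (base + x) := by
    intro x hx
    have hxN := Finset.mem_range.1 (h.sub hx)
    rw [← h.key x hx]
    exact h.tree.root_le (N + x) (by omega) (by omega) (by simp [h.leaf x hxN, hx])
  obtain ⟨v, hv, h1, h2⟩ := h.tree.exists_leaf 1 le_rfl (by omega)
  have h0 := (hle x hx).1
  rw [h.leaf v hv] at h1
  by_cases hvU : v ∈ U
  · rw [if_pos hvU] at h1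
    rw [h1]
    refine ⟨rfl, hvU, fun y hy => ?_⟩
    rw [Nat.add_sub_cancel, ← h.key v hvU, ← h2]
    exact (hle y hy).2
  · rw [if_neg hvU] at h1
    exact absurd h1 h0

/-- Settling the node `u` named by the root. -/
theorem DijkstraState.settle (h : DijkstraState N base D₀ P cnt U W K D ord) (hc : cnt < N)
    {u : ℕ} (hu : u ∈ U) (hmin : ∀ x ∈ U, D (base + u) ≤ D (base + x)) {W' : ℕ → ℕ} {K' : ℕ → ℝ}
    (ht : IsTournament N W' K')
    (hW : ∀ v < N, W' (N + v) = if v = u then 0 else W (N + v))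
    (hK : ∀ v < N, K' (N + v) = K (N + v)) :
    DijkstraState N base D₀ P (cnt + 1) (U.erase u) W' K' D (Function.update ord cnt u) := by
  have huN := Finset.mem_range.1 (h.sub hu)
  have hcard := h.card
  have hpos : 0 < U.card := Finset.card_pos.2 ⟨u, hu⟩
  refine ⟨(Finset.erase_subset _ _).trans h.sub, ?_, ht, ?_, ?_, ?_, h.sound, h.outside, h.le,
    ?_, ?_, ?_⟩
  · rw [Finset.card_erase_of_mem hu]; omega
  · intro v hv
    rw [hW v hv, h.leaf v hv]
    by_cases hvu : v = u <;> simp [hvu]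
  · intro v hv
    have hv' := Finset.mem_of_mem_erase hv
    rw [hK v (Finset.mem_range.1 (h.sub hv')), h.key v hv']
  · intro w hw hwU x hx
    by_cases hwu : w = u
    · rw [hwu]; exact hmin x (Finset.mem_of_mem_erase hx)
    · exact h.mono w hw (fun h' => hwU (Finset.mem_erase.2 ⟨hwu, h'⟩)) x
        (Finset.mem_of_mem_erase hx)
  · intro i hi
    by_cases hic : i = cnt
    · subst hic; simp [huN]
    · have := h.ord_mem i (by omega)
      simp [Function.update_of_ne hic, this]
  · intro v hv hvU
    by_cases hvu : v = u
    · exact ⟨cnt, by omega, by simp [hvu]⟩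
    · obtain ⟨i, hi, hi'⟩ := h.ord_surj v hv fun h' => hvU (Finset.mem_erase.2 ⟨hvu, h'⟩)
      exact ⟨i, by omega, by rw [Function.update_of_ne (by omega), hi']⟩
  · intro i j hij hj
    have hi := h.ord_mem i (by omega)
    rw [Function.update_of_ne (show i ≠ cnt by omega)]
    by_cases hjc : j = cnt
    · subst hjc
      rw [Function.update_self]
      exact h.mono _ hi.1 hi.2 u hu
    · rw [Function.update_of_ne hjc]
      exact h.ord_mono i j hij (by omega)

/-- Relaxing an edge into the node `u` settled last improves the label of an unsettled node only,
and does not make it smaller than that of a settled node. -/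
theorem DijkstraState.relax (h : DijkstraState N base D₀ P cnt U W K D ord)
    {u v : ℕ} {d : ℝ}
    (hmax : ∀ w < N, w ∉ U → D (base + w) ≤ D (base + u)) (hv : v < N) (hd : D (base + u) ≤ d)
    (hlt : d < D (base + v)) (hP : P v d) {W' : ℕ → ℕ} {K' : ℕ → ℝ} (ht : IsTournament N W' K')
    (hW : ∀ v < N, W' (N + v) = W (N + v))
    (hK : ∀ x < N, K' (N + x) = if x = v then d else K (N + x)) :
    v ∈ U ∧ DijkstraState N base D₀ P cnt U W' K' (Function.update D (base + v) d) ord := by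
  have hvU : v ∈ U := by
    by_contra hvU
    exact absurd (hmax v hv hvU) (not_le.2 (hd.trans_lt hlt))
  have hne : ∀ w, w ∉ U → Function.update D (base + v) d (base + w) = D (base + w) := by
    intro w hw
    refine Function.update_of_ne ?_ _ _
    rintro h'
    obtain rfl : w = v := by omega
    exact hw hvU
  refine ⟨hvU, h.sub, h.card, ht, ?_, ?_, ?_, ?_, ?_, ?_, h.ord_mem, h.ord_surj, ?_⟩
  · intro x hx; rw [hW x hx, h.leaf x hx]
  · intro x hx
    rw [hK x (Finset.mem_range.1 (h.sub hx)), Function.update_apply]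
    by_cases hxv : x = v <;> simp [hxv, h.key x hx]
  · intro w hw hwU x hx
    rw [hne w hwU, Function.update_apply]
    split_ifs
    · exact (hmax w hw hwU).trans hd
    · exact h.mono w hw hwU x hx
  · intro x hx
    rw [Function.update_apply]
    split_ifs with h'
    · obtain rfl : x = v := by omega
      exact hP
    · exact h.sound x hx
  · intro x hx
    rw [Function.update_of_ne (by omega), h.outside x hx]
  · intro x
    rw [Function.update_apply]
    split_ifs with h'
    · rw [h']; exact hlt.le.trans (h.le _)
    · exact h.le x
  · intro i j hij hj
    rw [hne _ (h.ord_mem i (by omega)).2, hne _ (h.ord_mem j hj).2]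
    exact h.ord_mono i j hij hj

end

/-- All edges with offset `0` in the slots of the nodes `w ∈ S` are relaxed. -/
def RelaxedFrom (σ : Store) (base : ℕ) (D : ℕ → ℝ) (S : ℕ → ℕ → Prop) : Prop :=
  ∀ w j, S w j → σ.natArr astart w ≤ j → j < σ.natArr astart (w + 1) →
    σ.natArr aoff (σ.natArr aperm j) = 0 →
    D (base + σ.natArr asrc (σ.natArr aperm j)) ≤ D (base + w) + σ.realArr bres (σ.natArr aperm j)

/-- For every predicate `P` on labels that is preserved by relaxations, Dijkstra's algorithm keeps
`P`, and in the end all edges with offset `0` are relaxed and the nodes are sorted by their labels.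
The edges in the slots need not come from a problem instance, and `E` bounds their number. -/
theorem wp_dijkstra (σ : Store) (N L E base : ℕ) (P : ℕ → ℝ → Prop)
    (hN : σ.nat rsize = N) (hN0 : 1 ≤ N) (hbase : σ.nat rbase = base)
    (hhalf : ∀ x < 2 * N, σ.natArr ahalf x = x / 2) (hL : N ≤ 2 ^ L)
    (hE : ∑ u ∈ Finset.range N, (σ.natArr astart (u + 1) - σ.natArr astart u) ≤ E)
    (hslot : ∀ u < N, ∀ j, σ.natArr astart u ≤ j → j < σ.natArr astart (u + 1) →
      σ.natArr asrc (σ.natArr aperm j) < N ∧ 0 ≤ σ.realArr bres (σ.natArr aperm j) ∧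
      (σ.natArr aoff (σ.natArr aperm j) = 0 → ∀ x, P u x →
        P (σ.natArr asrc (σ.natArr aperm j)) (x + σ.realArr bres (σ.natArr aperm j))))
    (hP : ∀ v < N, P v (σ.realArr blab (base + v))) :
    WP dijkstra σ ((N + E) * (60 * L + 200) + 50) fun _ τ =>
      (∃ W K, DijkstraState N base (σ.realArr blab) P N ∅ W K (τ.realArr blab) (τ.natArr aord)) ∧
      RelaxedFrom σ base (τ.realArr blab) (fun w _ => w < N) := by
  simp only [dijkstra, wp_seq_iff]
  have hNE : 100 * N + 30 ≤ (N + E) * (60 * L + 200) + 50 := by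
    nlinarith [Nat.zero_le (E * (60 * L + 200)), Nat.zero_le (N * L)]
  refine wp_call (B := 100 * N + 30) (by rw [← hN]; exact wp_buildTree σ) hNE ?_
  rintro T τ hT hf ⟨ht, hl⟩
  rw [hN] at ht hl
  rw [hbase] at hl
  replace hT : N * (60 * L + 100) + E * (60 * L + 100) + 15 ≤ T := by
    have : (N + E) * (60 * L + 200) =
        N * (60 * L + 100) + 100 * N + E * (60 * L + 100) + 100 * E := by ring
    omega
  simp
  refine ⟨by omega, ?_⟩
  refine wp_loop (fun T ρ => ∃ U W, W = ρ.natArr awin ∧ ∃ K, K = ρ.realArr bkey ∧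
    DijkstraState N base (σ.realArr blab) P (ρ.nat rcnt) U W K (ρ.realArr blab) (ρ.natArr aord) ∧
    RelaxedFrom σ base (ρ.realArr blab) (fun w _ => w < N ∧ w ∉ U) ∧
    -- the credits pay for the nodes still to be settled and for the edges into them
    (N - ρ.nat rcnt) * (60 * L + 100) +
      (∑ u ∈ U, (σ.natArr astart (u + 1) - σ.natArr astart u)) * (60 * L + 100) + 10 ≤ T) ?_ ?_
  · refine ⟨Finset.range N, _, rfl, _, rfl, ?_, ?_, ?_⟩
    · have e1 := hf.realArr blab rfl
      simp only [setN_nat, setN_natArr, setN_realArr, e1]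
      refine ⟨subset_rfl, by simp, ht, ?_, ?_, ?_, hP, fun _ _ => rfl, fun _ => le_rfl, ?_, ?_, ?_⟩
      · intro v hv; simp [hl v hv, hv]
      · intro v hv; exact (hl v (Finset.mem_range.1 hv)).2
      · intro w hw hw'; simp [hw] at hw'
      · intro i hi; simp at hi
      · intro v hv hv'; simp [hv] at hv'
      · intro i j hij hj; simp at hj
    · rintro w j ⟨h1, h2⟩; simp [h1] at h2
    · simp
      have := Nat.mul_le_mul_right (60 * L + 100) hE
      omega
  · rintro T' ρ hf' ⟨U, W, rfl, K, rfl, hD, hR, hT'⟩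
    have e1 : ρ.nat rsize = N := ((hf'.nat rsize rfl).trans (hf.nat rsize rfl)).trans hN
    have e2 : ρ.nat rbase = base := ((hf'.nat rbase rfl).trans (hf.nat rbase rfl)).trans hbase
    have e3 : ρ.natArr asrc = σ.natArr asrc := (hf'.natArr asrc rfl).trans (hf.natArr asrc rfl)
    have e4 : ρ.natArr aperm = σ.natArr aperm :=
      (hf'.natArr aperm rfl).trans (hf.natArr aperm rfl)
    have e5 : ρ.natArr astart = σ.natArr astart :=
      (hf'.natArr astart rfl).trans (hf.natArr astart rfl)
    have e6 : ρ.natArr aoff = σ.natArr aoff := (hf'.natArr aoff rfl).trans (hf.natArr aoff rfl)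
    have e7 : ρ.natArr ahalf = σ.natArr ahalf :=
      (hf'.natArr ahalf rfl).trans (hf.natArr ahalf rfl)
    have e8 : ρ.realArr bres = σ.realArr bres :=
      (hf'.realArr bres rfl).trans (hf.realArr bres rfl)
    simp [e1]
    refine ⟨by omega, fun hc => ?_, fun hc => ?_⟩
    swap
    · have hcard := hD.card
      obtain rfl : U = ∅ := by rw [← Finset.card_eq_zero]; omega
      have hcnt : ρ.nat rcnt = N := by simpa using hcard
      rw [hcnt] at hD
      exact ⟨⟨_, _, hD⟩, fun w j hw => hR w j ⟨hw, by simp⟩⟩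
    obtain ⟨hroot, huU, hmin⟩ := hD.root hc
    obtain ⟨u, hu⟩ : ∃ u, ρ.natArr awin 1 - 1 = u := ⟨_, rfl⟩
    rw [hu] at hroot huU hmin
    simp only [hu]
    have huN := Finset.mem_range.1 (hD.sub huU)
    have hpowL : 2 ^ (L + 1) = 2 * 2 ^ L := by ring
    have hsplit : (N - ρ.nat rcnt) * (60 * L + 100) =
        (N - (ρ.nat rcnt + 1)) * (60 * L + 100) + (60 * L + 100) := by
      rw [show N - ρ.nat rcnt = N - (ρ.nat rcnt + 1) + 1 by omega]; ring
    have hsum := Finset.add_sum_erase U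
      (fun u => σ.natArr astart (u + 1) - σ.natArr astart u) huU
    beta_reduce at hsum
    rw [hsplit, ← hsum, add_mul] at hT'
    refine ⟨by omega, by omega, by omega, by omega, ?_⟩
    refine wp_call (wp_climb _ N L ?_ ?_ ?_ ?_ ?_) (by omega) ?_
    · simpa [e7] using hhalf
    · simp; omega
    · simp; omega
    · simp; omega
    · intro j hj hjN hj'
      simp at hj' ⊢
      refine (hD.tree j hj hjN).congr (fun x hx => Function.update_of_ne (by omega) _ _)
        fun _ _ => rfl
    rintro T1 τ1 hT1 hf1 ⟨ht1, hu1⟩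
    simp only [Nat.reduceEqDiff, reduceIte, setN_natArr, setN_realArr,
      putN_natArr, putN_realArr] at hT1 hu1
    have a1 : τ1.nat rsize = N := by rw [hf1.nat rsize rfl]; simpa using e1
    have a2 : τ1.nat rbase = base := by rw [hf1.nat rbase rfl]; simpa using e2
    have a3 : τ1.natArr asrc = σ.natArr asrc := by rw [hf1.natArr asrc rfl]; simpa using e3
    have a4 : τ1.natArr aperm = σ.natArr aperm := by rw [hf1.natArr aperm rfl]; simpa using e4
    have a5 : τ1.natArr astart = σ.natArr astart := by
      rw [hf1.natArr astart rfl]; simpa using e5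
    have a6 : τ1.natArr aoff = σ.natArr aoff := by rw [hf1.natArr aoff rfl]; simpa using e6
    have a7 : τ1.natArr ahalf = σ.natArr ahalf := by rw [hf1.natArr ahalf rfl]; simpa using e7
    have a8 : τ1.realArr bres = σ.realArr bres := by rw [hf1.realArr bres rfl]; simpa using e8
    have a9 : τ1.nat ru = u := by rw [hf1.nat ru rfl]; simp
    have a10 : τ1.nat rcnt = ρ.nat rcnt := by rw [hf1.nat rcnt rfl]; simp
    have a11 : τ1.realArr blab = ρ.realArr blab := by rw [hf1.realArr blab rfl]; simp
    have a12 : τ1.natArr aord = Function.update (ρ.natArr aord) (ρ.nat rcnt) u := by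
      rw [hf1.natArr aord rfl]; simp
    have hD1 := hD.settle hc huU hmin ht1 (fun v hv => by
      rw [(hu1 (N + v) (by omega)).1]
      simp [Function.update_apply]) (fun v hv => (hu1 (N + v) (by omega)).2)
    have hmax1 : ∀ w < N, w ∉ U.erase u →
        ρ.realArr blab (base + w) ≤ ρ.realArr blab (base + u) := by
      intro w hw hwU
      by_cases hwu : w = u
      · rw [hwu]
      · exact hD.mono w hw (fun h => hwU (Finset.mem_erase.2 ⟨hwu, h⟩)) u huU
    have huV := Finset.notMem_erase u U
    obtain ⟨V, hV⟩ : ∃ V, U.erase u = V := ⟨_, rfl⟩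
    rw [hV] at hD1 hmax1 huV hT'
    simp only [a9, a5]
    refine ⟨by omega, ?_⟩
    -- the tails of the edges in the slots of `u` before the current one are relaxed already
    refine wp_loop (fun T π => ∃ W K, W = π.natArr awin ∧ K = π.realArr bkey ∧
      DijkstraState N base (σ.realArr blab) P (ρ.nat rcnt + 1) (V) W K (π.realArr blab)
        (π.natArr aord) ∧
      (∀ w < N, w ∉ V → π.realArr blab (base + w) ≤ π.realArr blab (base + u)) ∧
      σ.natArr astart u ≤ π.nat rj ∧
      RelaxedFrom σ base (π.realArr blab)
        (fun w j => w < N ∧ w ∉ V ∧ (w = u → j < π.nat rj)) ∧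
      (σ.natArr astart (u + 1) - π.nat rj) * (60 * L + 100) +
        (∑ x ∈ V, (σ.natArr astart (x + 1) - σ.natArr astart x)) * (60 * L + 100) +
        (N - (ρ.nat rcnt + 1)) * (60 * L + 100) + 30 ≤ T) ?_ ?_
    · refine ⟨_, _, rfl, rfl, ?_, ?_, ?_, ?_, ?_⟩
      · simpa [a11, a12] using hD1
      · simpa [a11] using hmax1
      · simp
      · rintro w j ⟨h1, h2, h3⟩ h4 h5 h6
        simp [a11] at h3 ⊢
        by_cases hwu : w = u
        · subst hwu; have := h3 rfl; omega
        · exact hR w j ⟨h1, fun h => h2 (hV ▸ Finset.mem_erase.2 ⟨hwu, h⟩)⟩ h4 h5 h6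
      · simp; omega
    · rintro T2 π hf2 ⟨W, K, rfl, rfl, hD2, hmax2, hj2, hR2, hT2⟩
      have b1 : π.nat rsize = N := (hf2.nat rsize rfl).trans a1
      have b2 : π.nat rbase = base := (hf2.nat rbase rfl).trans a2
      have b3 : π.natArr asrc = σ.natArr asrc := (hf2.natArr asrc rfl).trans a3
      have b4 : π.natArr aperm = σ.natArr aperm := (hf2.natArr aperm rfl).trans a4
      have b5 : π.natArr astart = σ.natArr astart := (hf2.natArr astart rfl).trans a5
      have b6 : π.natArr aoff = σ.natArr aoff := (hf2.natArr aoff rfl).trans a6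
      have b7 : π.natArr ahalf = σ.natArr ahalf := (hf2.natArr ahalf rfl).trans a7
      have b8 : π.realArr bres = σ.realArr bres := (hf2.realArr bres rfl).trans a8
      have b9 : π.nat ru = u := (hf2.nat ru rfl).trans a9
      have b10 : π.nat rcnt = ρ.nat rcnt := (hf2.nat rcnt rfl).trans a10
      simp [b1, b2, b3, b4, b5, b6, b8, b9, b10, -Order.lt_add_one_iff]
      refine ⟨by omega, fun hj => ?_, fun hj => ?_⟩
      swap
      · refine ⟨by omega, V, hD2, ?_, by omega⟩
        rintro w j ⟨h1, h2⟩ h3 h4 h5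
        exact hR2 w j ⟨h1, h2, fun h => by subst h; omega⟩ h3 h4 h5
      obtain ⟨j, hj'⟩ : ∃ j, π.nat rj = j := ⟨_, rfl⟩
      simp only [hj'] at *
      obtain ⟨hv, hr, hstep⟩ := hslot u huN j hj2 hj
      set e := σ.natArr aperm j with he
      set v := σ.natArr asrc e with hve
      have hsplit2 : (σ.natArr astart (u + 1) - j) * (60 * L + 100) =
          (σ.natArr astart (u + 1) - (j + 1)) * (60 * L + 100) + (60 * L + 100) := by
        rw [show σ.natArr astart (u + 1) - j = σ.natArr astart (u + 1) - (j + 1) + 1 by omega]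
        ring
      -- labels `D` that result from treating slot `j` are relaxed with regard to that slot, too
      have hext : ∀ D : ℕ → ℝ, D (base + u) = π.realArr blab (base + u) →
          (∀ w < N, w ∉ V → D (base + w) = π.realArr blab (base + w)) →
          (∀ x, D x ≤ π.realArr blab x) →
          (σ.natArr aoff e = 0 → D (base + v) ≤ D (base + u) + σ.realArr bres e) →
          RelaxedFrom σ base D (fun w j' => w < N ∧ w ∉ V ∧ (w = u → j' < j + 1)) := by
        rintro D hDu hDw hDle hDe w j' ⟨h1, h2, h3⟩ h4 h5 h6
        by_cases hwj : w = u ∧ j' = j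
        · obtain ⟨rfl, rfl⟩ := hwj
          exact hDe h6
        · rw [hDw w h1 h2]
          refine (hDle _).trans (hR2 w j' ⟨h1, h2, fun h => ?_⟩ h4 h5 h6)
          have := h3 h
          omega
      refine ⟨by omega, by omega, by omega, by omega, fun hoff hlt => ?_, fun hno => ?_⟩
      · refine ⟨by omega, by omega, by omega, ?_⟩
        refine wp_call (wp_climb _ N L ?_ ?_ ?_ ?_ ?_) (by omega) ?_
        · simpa [b7] using hhalf
        · simp; omega
        · simp; omega
        · simp; omega
        · intro j hj hjN hj'
          simp at hj' ⊢
          refine (hD2.tree j hj hjN).congr (fun _ _ => rfl)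
            fun x hx => Function.update_of_ne (by omega) _ _
        rintro T3 τ3 hT3 hf3 ⟨ht3, hu3⟩
        simp at hT3 hu3
        have c1 : τ3.nat rj = j + 1 := by rw [hf3.nat rj rfl]; simp
        have c2 : τ3.realArr blab = Function.update (π.realArr blab) (base + v)
            (π.realArr blab (base + u) + σ.realArr bres e) := by
          rw [hf3.realArr blab rfl]; simp
        have c3 : τ3.natArr aord = π.natArr aord := by rw [hf3.natArr aord rfl]; simp
        obtain ⟨hvU, hD3⟩ := hD2.relax hmax2 hv (by linarith) hlt (hstep hoff _ (hD2.sound u huN))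
          ht3 (fun x hx => (hu3 _ (by omega)).1)
          (fun x hx => by rw [(hu3 _ (by omega)).2]; simp [Function.update_apply])
        have hne : ∀ w, w ∉ V → τ3.realArr blab (base + w) = π.realArr blab (base + w) := by
          intro w hw
          rw [c2, Function.update_of_ne]
          intro h
          obtain rfl : w = v := by omega
          exact hw hvU
        have hnu := hne u (huV)
        rw [← c2] at hD3
        rw [c1, c3]
        refine ⟨hD3, fun w hw hwU => ?_, by omega, hext _ hnu (fun w _ => hne w) (fun x => ?_)
          (fun _ => ?_), by omega⟩
        · rw [hne w hwU, hnu]; exact hmax2 w hw hwU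
        · rw [c2, Function.update_apply]
          split_ifs with h
          · rw [h]; exact hlt.le
          · exact le_rfl
        · rw [hnu, c2, Function.update_self]
      · refine ⟨by omega, hD2, hmax2, by omega, hext _ rfl (fun _ _ _ => rfl) (fun _ => le_rfl)
          hno, by omega⟩

/-! ### Grouping the edges by their heads -/

/-- Write the edges into `aperm`, sorted by heads; those with head `u` fill the slots from
`astart[u]` up to `astart[u + 1]`. -/
def groupEdges : Prog :=
  .setNat rpos (.const 0) ;;
  .setNat rv (.const 0) ;;
  .putNat astart (.const 0) (.const 0) ;;
  .loop (.natLt (.reg rv) (.reg rn))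
    (.setNat redge (.const 0) ;;
     .loop (.natLt (.reg redge) (.reg rm))
       (.ite (.natEq (.get adst (.reg redge)) (.reg rv))
          (.putNat aperm (.reg rpos) (.reg redge) ;;
           .setNat rpos (.add (.reg rpos) (.const 1)))
          .skip ;;
        .setNat redge (.add (.reg redge) (.const 1))) ;;
     .setNat rv (.add (.reg rv) (.const 1)) ;;
     .putNat astart (.reg rv) (.reg rpos))

/-- The edges `0, …, m - 1` with heads given by `dst` are grouped by their heads. -/
structure Grouped (n m : ℕ) (dst perm start : ℕ → ℕ) : Prop where
  slot : ∀ u < n, ∀ j, start u ≤ j → j < start (u + 1) → perm j < m ∧ dst (perm j) = u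
  cover : ∀ e < m, dst e < n → ∃ j, start (dst e) ≤ j ∧ j < start (dst e + 1) ∧ perm j = e
  degree : ∀ u < n, start (u + 1) = start u + ((Finset.range m).filter (dst · = u)).card

theorem Grouped.sum_degree {n m : ℕ} {dst perm start : ℕ → ℕ} (h : Grouped n m dst perm start)
    (hdst : ∀ e < m, dst e < n) : ∑ u ∈ Finset.range n, (start (u + 1) - start u) = m := by
  have h1 := Finset.card_eq_sum_card_fiberwise (s := Finset.range m) (t := Finset.range n)
    (f := dst) (by intro e he; simpa using hdst e (by simpa using he))
  rw [Finset.card_range] at h1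
  rw [h1]
  refine Finset.sum_congr rfl fun u hu => ?_
  rw [h.degree u (Finset.mem_range.1 hu), Nat.add_sub_cancel_left]

theorem wp_groupEdges (σ : Store) :
    WP groupEdges σ (σ.nat rn * (40 * σ.nat rm + 40) + 30) fun _ τ =>
      Grouped (σ.nat rn) (σ.nat rm) (σ.natArr adst) (τ.natArr aperm) (τ.natArr astart) := by
  simp [groupEdges]
  refine wp_loop (fun T τ => (σ.nat rn - τ.nat rv) * (40 * σ.nat rm + 40) + 10 ≤ T ∧
    τ.nat rv ≤ σ.nat rn ∧ τ.natArr astart (τ.nat rv) = τ.nat rpos ∧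
    (∀ u ≤ τ.nat rv, τ.natArr astart u ≤ τ.nat rpos) ∧
    Grouped (τ.nat rv) (σ.nat rm) (σ.natArr adst) (τ.natArr aperm) (τ.natArr astart)) ?_ ?_
  · refine ⟨by simp, by simp, by simp, by simp, ?_⟩
    refine ⟨fun u hu => ?_, fun e he h0 => ?_, fun u hu => ?_⟩
    · simp at hu
    · simp at h0
    · simp at hu
  rintro T τ hf ⟨hT, hv, hst, hle, hG⟩
  have e0 : τ.nat rn = σ.nat rn := by rw [hf.nat rn rfl]; simp
  have e1 : τ.nat rm = σ.nat rm := by rw [hf.nat rm rfl]; simp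
  have e2 : τ.natArr adst = σ.natArr adst := by rw [hf.natArr adst rfl]; simp
  simp [e0]
  refine ⟨by omega, fun h => ?_, fun h => by rwa [show σ.nat rn = τ.nat rv by omega]⟩
  have hsplit : (σ.nat rn - τ.nat rv) * (40 * σ.nat rm + 40) =
      (σ.nat rn - (τ.nat rv + 1)) * (40 * σ.nat rm + 40) + (40 * σ.nat rm + 40) := by
    rw [show σ.nat rn - τ.nat rv = σ.nat rn - (τ.nat rv + 1) + 1 by omega]; ring
  obtain ⟨v, hv'⟩ : ∃ v, τ.nat rv = v := ⟨_, rfl⟩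
  obtain ⟨p, hp⟩ : ∃ p, τ.nat rpos = p := ⟨_, rfl⟩
  rw [hv'] at hT hv hst hle hG hsplit h
  rw [hp] at hst hle
  refine ⟨by omega, ?_⟩
  refine wp_loop (fun T ρ => 30 * (σ.nat rm - ρ.nat redge) +
      (σ.nat rn - (v + 1)) * (40 * σ.nat rm + 40) + 25 ≤ T ∧ ρ.nat redge ≤ σ.nat rm ∧
    ρ.nat rpos = p + ((Finset.range (ρ.nat redge)).filter (σ.natArr adst · = v)).card ∧
    (∀ j < p, ρ.natArr aperm j = τ.natArr aperm j) ∧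
    (∀ j, p ≤ j → j < ρ.nat rpos → ρ.natArr aperm j < σ.nat rm ∧
      σ.natArr adst (ρ.natArr aperm j) = v) ∧
    ∀ e < ρ.nat redge, σ.natArr adst e = v → ∃ j, p ≤ j ∧ j < ρ.nat rpos ∧
      ρ.natArr aperm j = e) ?_ ?_
  · refine ⟨by simp; omega, by simp, by simp [hp], by simp, ?_, by simp⟩
    intro j h1 h2
    simp [hp] at h2; omega
  rintro T' ρ hf' ⟨hT', hem, hpos, hold, hnew, hcov⟩
  have b1 : ρ.nat rm = σ.nat rm := by rw [hf'.nat rm rfl]; simp [e1]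
  have b2 : ρ.natArr adst = σ.natArr adst := by rw [hf'.natArr adst rfl]; simp [e2]
  have b3 : ρ.nat rv = v := by rw [hf'.nat rv rfl]; simp [hv']
  have b4 : ρ.natArr astart = τ.natArr astart := by rw [hf'.natArr astart rfl]; simp
  simp [b1, b2, b3, b4, -Order.lt_add_one_iff]
  refine ⟨by omega, fun he => ⟨by omega, fun hd => ?_, fun hd => ?_⟩,
    fun he => ⟨by omega, by omega, by omega, by omega, ?_, ?_⟩⟩
  · refine ⟨by omega, by omega, by omega, by omega, by omega, ?_, ?_, ?_, ?_⟩
    · rw [hpos, Finset.range_add_one, Finset.filter_insert, if_pos hd, Finset.card_insert_of_notMem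
        (by simp)]
      omega
    · intro j hj
      rw [Function.update_of_ne (by omega), hold j hj]
    · intro j h1 h2
      rw [Function.update_apply]
      split_ifs with hj
      · exact ⟨he, hd⟩
      · exact hnew j h1 (by omega)
    · intro e h1 h2
      by_cases hee : e = ρ.nat redge
      · exact ⟨ρ.nat rpos, by omega, by omega, by simp [hee]⟩
      · obtain ⟨j, h3, h4, h5⟩ := hcov e (by omega) h2
        exact ⟨j, h3, by omega, by rw [Function.update_of_ne (by omega), h5]⟩
  · refine ⟨by omega, by omega, by omega, by omega, ?_, hold, hnew, ?_⟩
    · rw [Finset.range_add_one, Finset.filter_insert, if_neg hd, hpos]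
    · intro e h1 h2
      refine hcov e ?_ h2
      have : e ≠ ρ.nat redge := by rintro rfl; exact hd h2
      omega
  · intro u hu
    rw [Function.update_apply]
    split_ifs with h'
    · exact le_rfl
    · exact (hle u (by omega)).trans (by omega)
  · have hme : ρ.nat redge = σ.nat rm := by omega
    rw [hme] at hpos hcov
    refine ⟨fun u hu j h1 h2 => ?_, fun e he hd => ?_, fun u hu => ?_⟩
    · rw [Function.update_of_ne (by omega)] at h1
      by_cases huv : u = v
      · subst huv
        rw [Function.update_self] at h2
        exact hnew j (by omega) h2
      · rw [Function.update_of_ne (by omega)] at h2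
        have := hle (u + 1) (by omega)
        rw [hold j (by omega)]
        exact hG.slot u (by omega) j h1 h2
    · rw [Function.update_of_ne (show σ.natArr adst e ≠ v + 1 by omega)]
      by_cases huv : σ.natArr adst e = v
      · rw [huv, Function.update_self, hst]
        exact hcov e he huv
      · obtain ⟨j, h1, h2, h3⟩ := hG.cover e he (by omega)
        have := hle (σ.natArr adst e + 1) (by omega)
        refine ⟨j, h1, ?_, ?_⟩
        · rwa [Function.update_of_ne (by omega)]
        · rw [hold j (by omega), h3]
    · rw [Function.update_of_ne (show u ≠ v + 1 by omega)]
      by_cases huv : u = v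
      · subst huv
        rw [Function.update_self, hst, hpos]
      · rw [Function.update_of_ne (by omega)]
        exact hG.degree u (by omega)

/-! ### Rounding the costs -/

/-- `k` is the rounding of the cost `c` with unit `δ`, capped at `X + 1`: unless the cap
interferes, `k * δ < c ≤ (k + 1) * δ`, or `k = 0` and `c ≤ δ`. -/
structure IsRounding (c δ : ℝ) (X k : ℕ) : Prop where
  cap : k ≤ X + 1
  le : k ≤ X → c ≤ (k + 1) * δ
  lt : k = 0 ∨ k * δ < c

/-- Round all costs with unit `xunit` and cap `rX + 1` and store `n` times the rounded cost, plus
`rmode`, in `aoff`. -/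
def roundCosts : Prog :=
  .setNat redge (.const 0) ;;
  .loop (.natLt (.reg redge) (.reg rm))
    (.setNat rk (.const 0) ;;
     .setNat roff (.reg rmode) ;;
     .loop (.and (.natLt (.reg rk) (.add (.reg rX) (.const 1)))
         (.realLt (.mul (.ofNat (.add (.reg rk) (.const 1))) (.reg xunit))
           (.get bcost (.reg redge))))
       (.setNat rk (.add (.reg rk) (.const 1)) ;;
        .setNat roff (.add (.reg roff) (.reg rn))) ;;
     .putNat aoff (.reg redge) (.reg roff) ;;
     .setNat redge (.add (.reg redge) (.const 1)))

theorem wp_roundCosts (σ : Store) :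
    WP roundCosts σ (σ.nat rm * (60 * σ.nat rX + 150) + 30) fun _ τ =>
      ∀ e < σ.nat rm, ∃ k, IsRounding (σ.realArr bcost e) (σ.real xunit) (σ.nat rX) k ∧
        τ.natArr aoff e = σ.nat rmode + k * σ.nat rn := by
  simp [roundCosts]
  refine wp_loop (fun T τ => (σ.nat rm - τ.nat redge) * (60 * σ.nat rX + 150) + 10 ≤ T ∧
    ∀ e < τ.nat redge, ∃ k, IsRounding (σ.realArr bcost e) (σ.real xunit) (σ.nat rX) k ∧
        τ.natArr aoff e = σ.nat rmode + k * σ.nat rn) ⟨by simp, by simp⟩ ?_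
  rintro T τ hf ⟨hT, he⟩
  have e0 : τ.nat rn = σ.nat rn := by rw [hf.nat rn rfl]; simp
  have e1 : τ.nat rm = σ.nat rm := by rw [hf.nat rm rfl]; simp
  have e2 : τ.nat rX = σ.nat rX := by rw [hf.nat rX rfl]; simp
  have e3 : τ.nat rmode = σ.nat rmode := by rw [hf.nat rmode rfl]; simp
  have e4 : τ.real xunit = σ.real xunit := by rw [hf.real xunit rfl]; simp
  have e5 : τ.realArr bcost = σ.realArr bcost := by rw [hf.realArr bcost rfl]; simp
  simp [e1]
  refine ⟨by omega, fun h => ?_, fun h e he' => he e (by omega)⟩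
  have hsplit : (σ.nat rm - τ.nat redge) * (60 * σ.nat rX + 150) =
      (σ.nat rm - (τ.nat redge + 1)) * (60 * σ.nat rX + 150) + (60 * σ.nat rX + 150) := by
    rw [show σ.nat rm - τ.nat redge = σ.nat rm - (τ.nat redge + 1) + 1 by omega]; ring
  refine ⟨by omega, by omega, ?_⟩
  refine wp_loop (fun T ρ => 30 * (σ.nat rX + 1 - ρ.nat rk) +
      (σ.nat rm - (τ.nat redge + 1)) * (60 * σ.nat rX + 150) + 40 ≤ T ∧ ρ.nat rk ≤ σ.nat rX + 1 ∧
    (ρ.nat rk = 0 ∨ ρ.nat rk * σ.real xunit < σ.realArr bcost (τ.nat redge)) ∧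
    ρ.nat roff = σ.nat rmode + ρ.nat rk * σ.nat rn) ?_ ?_
  · exact ⟨by simp; omega, by simp, by simp, by simp [e3]⟩
  rintro T' ρ hf' ⟨hT', hk, hlt, hoff⟩
  have b0 : ρ.nat rn = σ.nat rn := by rw [hf'.nat rn rfl]; simp [e0]
  have b2 : ρ.nat rX = σ.nat rX := by rw [hf'.nat rX rfl]; simp [e2]
  have b3 : ρ.nat redge = τ.nat redge := by rw [hf'.nat redge rfl]; simp
  have b4 : ρ.real xunit = σ.real xunit := by rw [hf'.real xunit rfl]; simp [e4]
  have b5 : ρ.realArr bcost = σ.realArr bcost := by rw [hf'.realArr bcost rfl]; simp [e5]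
  have b6 : ρ.natArr aoff = τ.natArr aoff := by rw [hf'.natArr aoff rfl]; simp
  simp [b0, b2, b3, b4, b5, b6, -Order.lt_add_one_iff, -not_and]
  refine ⟨by omega, fun h1 h2 => ⟨by omega, by omega, by omega, by omega, h2, ?_⟩,
    fun h' => ⟨by omega, by omega, by omega, fun e he' => ?_⟩⟩
  · rw [hoff]; ring
  · rw [Function.update_apply]
    split_ifs with hee
    · refine ⟨ρ.nat rk, ⟨hk, fun hkX => ?_, ?_⟩, hoff⟩
      · rw [hee]
        by_contra hc
        exact h' ⟨by omega, not_le.1 hc⟩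
      · rwa [hee]
    · exact he e (by omega)

/-! ### Walks with bounded weight and resource consumption -/

/-- There is a walk from node `v` to the target of weight at most `k` and resource consumption at
most `x`. -/
def Reach (I : RSPInstance) (w : Fin I.m → ℕ) (k v : ℕ) (x : ℝ) : Prop :=
  ∀ h : v < I.n, ∃ p, I.IsWalk ⟨v, h⟩ p I.t ∧ (p.map w).sum ≤ k ∧ I.pathRes p ≤ x

theorem Reach.mono {I : RSPInstance} {w : Fin I.m → ℕ} {k k' v : ℕ} {x x' : ℝ}
    (h : Reach I w k v x) (hk : k ≤ k') (hx : x ≤ x') : Reach I w k' v x' := by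
  intro hv
  obtain ⟨p, h1, h2, h3⟩ := h hv
  exact ⟨p, h1, h2.trans hk, h3.trans hx⟩

theorem Reach.cons {I : RSPInstance} {w : Fin I.m → ℕ} {k : ℕ} {x : ℝ} (e : Fin I.m)
    (h : Reach I w k (I.dst e) x) : Reach I w (k + w e) (I.src e) (x + I.res e) := by
  intro hv
  obtain ⟨p, h1, h2, h3⟩ := h (I.dst e).2
  refine ⟨e :: p, ⟨rfl, h1⟩, ?_, ?_⟩
  · simp; omega
  · simp only [RSPInstance.pathRes, List.map_cons, List.sum_cons] at h3 ⊢; linarith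

/-- Layer `j ≥ 1` of the label array `D`, at the indices `j * n + v`: the label of `v` is the least
resource consumption of a walk from `v` to the target of weight less than `j`, as far as this is at
most `R`. With `mode ≠ 0`, the array `pred` names an edge which `v` owes its label to, or is `0` if
the label is that of the previous layer. -/
structure LayerOK (I : RSPInstance) (w : Fin I.m → ℕ) (mode : ℕ) (D : ℕ → ℝ) (pred : ℕ → ℕ)
    (j : ℕ) : Prop where
  mono : ∀ v < I.n, D (j * I.n + v) ≤ D ((j - 1) * I.n + v)
  -- weights start at `0` and layers at `1`, so an edge of weight `w e` leads into layer
  -- `j - w e`, which has to be a proper one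
  closed : ∀ e : Fin I.m, w e + 1 ≤ j →
    D (j * I.n + I.src e) ≤ D ((j - w e) * I.n + I.dst e) + I.res e
  sound : ∀ v < I.n, D (j * I.n + v) ≤ I.R → Reach I w (j - 1) v (D (j * I.n + v))
  pred : mode ≠ 0 → ∀ v < I.n,
    (pred (j * I.n + v) = 0 ∧ D (j * I.n + v) = D ((j - 1) * I.n + v)) ∨
    ∃ e : Fin I.m, pred (j * I.n + v) = e + 1 ∧ (I.src e : ℕ) = v ∧ 0 < w e ∧ w e + 1 ≤ j ∧
      D (j * I.n + v) = D ((j - w e) * I.n + I.dst e) + I.res e ∧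
      D (j * I.n + v) < D ((j - 1) * I.n + v)

theorem layer_index_lt {n i j v : ℕ} (hij : i ≤ j) (hv : v < n) : i * n + v < (j + 1) * n := by
  have := Nat.mul_le_mul_right n hij
  rw [add_mul]; omega

theorem LayerOK.congr {I : RSPInstance} {w : Fin I.m → ℕ} {mode : ℕ} {D D' : ℕ → ℝ}
    {pred pred' : ℕ → ℕ} {j : ℕ} (h : LayerOK I w mode D pred j)
    (hD : ∀ x < (j + 1) * I.n, D' x = D x) (hp : ∀ x < (j + 1) * I.n, pred' x = pred x) :
    LayerOK I w mode D' pred' j := by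
  have hD' : ∀ i ≤ j, ∀ v < I.n, D' (i * I.n + v) = D (i * I.n + v) :=
    fun i hi v hv => hD _ (layer_index_lt hi hv)
  refine ⟨fun v hv => ?_, fun e he => ?_, fun v hv => ?_, fun hm v hv => ?_⟩
  · rw [hD' _ le_rfl v hv, hD' _ (by omega) v hv]; exact h.mono v hv
  · rw [hD' _ le_rfl _ (I.src e).2, hD' _ (by omega) _ (I.dst e).2]; exact h.closed e he
  · rw [hD' _ le_rfl v hv]; exact h.sound v hv
  · rw [hD' _ le_rfl v hv, hD' _ (by omega) v hv, hp _ (layer_index_lt le_rfl hv)]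
    refine (h.pred hm v hv).imp id ?_
    rintro ⟨e, h1, h2, h3, h4, h5, h6⟩
    exact ⟨e, h1, h2, h3, h4, by rw [hD' _ (by omega) _ (I.dst e).2]; exact h5, h6⟩

/-- The labels are lower bounds for the resource consumption of walks of bounded weight. -/
theorem label_le {I : RSPInstance} {w : Fin I.m → ℕ} {mode : ℕ} {D : ℕ → ℝ} {pred : ℕ → ℕ}
    {J : ℕ} (h0 : D I.t = 0) (h : ∀ j, 1 ≤ j → j ≤ J → LayerOK I w mode D pred j)
    (p : List (Fin I.m)) (v : Fin I.n) (j : ℕ) (hj : j ≤ J) (hp : I.IsWalk v p I.t)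
    (hw : (p.map w).sum + 1 ≤ j) : D (j * I.n + v) ≤ I.pathRes p := by
  induction p generalizing v j with
  | nil =>
    obtain rfl : v = I.t := hp
    clear hw
    have : D (j * I.n + I.t) ≤ 0 := by
      induction j with
      | zero => simp [h0]
      | succ j ih =>
        exact ((h (j + 1) (by omega) hj).mono _ I.t.2).trans (ih (by omega))
    simpa [RSPInstance.pathRes] using this
  | cons e p ih =>
    obtain ⟨rfl, hp⟩ := hp
    simp only [List.map_cons, List.sum_cons] at hw
    have h1 := (h j (by omega) hj).closed e (by omega)
    have h2 := ih (I.dst e) (j - w e) (by omega) hp (by omega)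
    simp only [RSPInstance.pathRes, List.map_cons, List.sum_cons] at h2 ⊢
    linarith

/-! ### The layered dynamic program -/

/-- The state holds the instance `I` in the format of `input`. -/
structure HoldsInput (I : RSPInstance) (σ : Store) : Prop where
  n : σ.nat rn = I.n
  m : σ.nat rm = I.m
  s : σ.nat rs = I.s
  t : σ.nat rt = I.t
  R : σ.real xR = I.R
  src : ∀ e : Fin I.m, σ.natArr asrc e = I.src e
  dst : ∀ e : Fin I.m, σ.natArr adst e = I.dst e
  cost : ∀ e : Fin I.m, σ.realArr bcost e = I.cost e
  res : ∀ e : Fin I.m, σ.realArr bres e = I.res e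

/-- The program does not overwrite the input. -/
def Prog.keepsInput (p : Prog) : Bool :=
  !(p.writesNat rn || p.writesNat rm || p.writesNat rs || p.writesNat rt || p.writesReal xR ||
    p.writesNatArr asrc || p.writesNatArr adst || p.writesRealArr bcost || p.writesRealArr bres)

theorem HoldsInput.frame {I : RSPInstance} {p : Prog} {σ τ : Store} (h : HoldsInput I σ)
    (hf : Frame p σ τ) (hp : p.keepsInput = true) : HoldsInput I τ := by
  simp only [Prog.keepsInput, Bool.not_eq_true', Bool.or_eq_false_iff] at hp
  obtain ⟨⟨⟨⟨⟨⟨⟨⟨h1, h2⟩, h3⟩, h4⟩, h5⟩, h6⟩, h7⟩, h8⟩, h9⟩ := hp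
  refine ⟨?_, ?_, ?_, ?_, ?_, ?_, ?_, ?_, ?_⟩
  · rw [hf.nat _ h1, h.n]
  · rw [hf.nat _ h2, h.m]
  · rw [hf.nat _ h3, h.s]
  · rw [hf.nat _ h4, h.t]
  · rw [hf.real _ h5, h.R]
  · rw [hf.natArr _ h6]; exact h.src
  · rw [hf.natArr _ h7]; exact h.dst
  · rw [hf.realArr _ h8]; exact h.cost
  · rw [hf.realArr _ h9]; exact h.res

/-- The state holds the instance `I`, a table for halving, and the edges grouped by heads. -/
structure Ready (I : RSPInstance) (σ : Store) : Prop extends HoldsInput I σ where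
  size : σ.nat rsize = I.n
  half : ∀ x < 2 * (I.n + I.m), σ.natArr ahalf x = x / 2
  grouped : Grouped I.n I.m (σ.natArr adst) (σ.natArr aperm) (σ.natArr astart)

/-- The program overwrites neither the input nor the precomputed tables. -/
def Prog.keepsTables (p : Prog) : Bool :=
  p.keepsInput && !(p.writesNat rsize || p.writesNatArr ahalf || p.writesNatArr aperm ||
    p.writesNatArr astart)

theorem Ready.frame {I : RSPInstance} {p : Prog} {σ τ : Store} (h : Ready I σ)
    (hf : Frame p σ τ) (hp : p.keepsTables = true) : Ready I τ := by
  simp only [Prog.keepsTables, Bool.not_eq_true', Bool.or_eq_false_iff, Bool.and_eq_true] at hp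
  obtain ⟨h0, ⟨⟨h1, h2⟩, h3⟩, h4⟩ := hp
  refine ⟨h.toHoldsInput.frame hf h0, ?_, ?_, ?_⟩
  · rw [hf.nat _ h1, h.size]
  · rw [hf.natArr _ h2]; exact h.half
  · simp only [Prog.keepsInput, Bool.not_eq_true', Bool.or_eq_false_iff] at h0
    rw [hf.natArr _ h3, hf.natArr _ h4, hf.natArr _ h0.1.1.2]; exact h.grouped

theorem HoldsInput.setN {I : RSPInstance} {σ : Store} (h : HoldsInput I σ) {x v : ℕ}
    (hx : 4 ≤ x) : HoldsInput I (σ.setN x v) := by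
  obtain ⟨h1, h2, h3, h4, h5, h6, h7, h8, h9⟩ := h
  constructor <;> simpa [show 0 ≠ x by omega, show 1 ≠ x by omega, show 2 ≠ x by omega,
    show 3 ≠ x by omega]

theorem HoldsInput.setR {I : RSPInstance} {σ : Store} (h : HoldsInput I σ) {x : ℕ} {v : ℝ}
    (hx : 1 ≤ x) : HoldsInput I (σ.setR x v) := by
  obtain ⟨h1, h2, h3, h4, h5, h6, h7, h8, h9⟩ := h
  constructor <;> simpa [show 0 ≠ x by omega]

theorem HoldsInput.putN {I : RSPInstance} {σ : Store} (h : HoldsInput I σ) {a i v : ℕ}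
    (ha : 2 ≤ a) : HoldsInput I (σ.putN a i v) := by
  obtain ⟨h1, h2, h3, h4, h5, h6, h7, h8, h9⟩ := h
  constructor <;> simpa [show 0 ≠ a by omega, show 1 ≠ a by omega]

theorem HoldsInput.putR {I : RSPInstance} {σ : Store} (h : HoldsInput I σ) {a i : ℕ} {v : ℝ}
    (ha : 2 ≤ a) : HoldsInput I (σ.putR a i v) := by
  obtain ⟨h1, h2, h3, h4, h5, h6, h7, h8, h9⟩ := h
  constructor <;> simpa [show 0 ≠ a by omega, show 1 ≠ a by omega]

theorem Ready.setN {I : RSPInstance} {σ : Store} (h : Ready I σ) {x v : ℕ} (hx : 5 ≤ x) :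
    Ready I (σ.setN x v) :=
  ⟨h.toHoldsInput.setN (by omega), by simpa [show 4 ≠ x by omega] using h.size, h.half, h.grouped⟩

theorem Ready.setR {I : RSPInstance} {σ : Store} (h : Ready I σ) {x : ℕ} {v : ℝ} (hx : 1 ≤ x) :
    Ready I (σ.setR x v) :=
  ⟨h.toHoldsInput.setR hx, h.size, h.half, h.grouped⟩

theorem Ready.putR {I : RSPInstance} {σ : Store} (h : Ready I σ) {a i : ℕ} {v : ℝ} (ha : 2 ≤ a) :
    Ready I (σ.putR a i v) :=
  ⟨h.toHoldsInput.putR ha, h.size, h.half, h.grouped⟩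

theorem RSPInstance.n_pos (I : RSPInstance) : 0 < I.n := I.s.pos

/-- Dijkstra's algorithm completes a layer with respect to the edges of weight `0`. -/
theorem wp_dijkstra_layer (I : RSPInstance) (σ : Store) (hσ : Ready I σ) (L j : ℕ)
    (hL : I.n ≤ 2 ^ L) (w : Fin I.m → ℕ) (hw : ∀ e : Fin I.m, σ.natArr aoff e = w e * I.n)
    (hbase : σ.nat rbase = j * I.n)
    (hsound : ∀ v < I.n, σ.realArr blab (j * I.n + v) ≤ I.R →
      Reach I w (j - 1) v (σ.realArr blab (j * I.n + v))) :
    WP dijkstra σ ((I.n + I.m) * (60 * L + 200) + 50) fun _ τ =>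
      (∀ x, τ.realArr blab x ≤ σ.realArr blab x) ∧
      (∀ x < j * I.n, τ.realArr blab x = σ.realArr blab x) ∧
      (∀ v < I.n, τ.realArr blab (j * I.n + v) ≤ I.R →
        Reach I w (j - 1) v (τ.realArr blab (j * I.n + v))) ∧
      ∀ e : Fin I.m, w e = 0 →
        τ.realArr blab (j * I.n + I.src e) ≤ τ.realArr blab (j * I.n + I.dst e) + I.res e := by
  have hn := RSPInstance.n_pos I
  have hdst : ∀ e < I.m, σ.natArr adst e < I.n := fun e he => by
    rw [show e = ((⟨e, he⟩ : Fin I.m) : ℕ) from rfl, hσ.dst]; exact Fin.is_lt _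
  refine wp_call (wp_dijkstra σ I.n L I.m (j * I.n)
    (fun v x => x ≤ I.R → Reach I w (j - 1) v x) hσ.size hn hbase
    (fun x hx => hσ.half x (by omega)) hL (hσ.grouped.sum_degree hdst).le ?_ hsound) le_rfl ?_
  · intro u hu i h1 h2
    obtain ⟨h3, h4⟩ := hσ.grouped.slot u hu i h1 h2
    obtain ⟨e, he⟩ : ∃ e : Fin I.m, (e : ℕ) = σ.natArr aperm i := ⟨⟨_, h3⟩, rfl⟩
    rw [← he] at h4 ⊢
    rw [hσ.src, hσ.res, hw]
    rw [hσ.dst] at h4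
    refine ⟨Fin.is_lt _, I.res_nonneg e, fun h0 x hx hxR => ?_⟩
    have hr := I.res_nonneg e
    have h0' : w e = 0 := by
      rcases Nat.mul_eq_zero.1 h0 with h | h
      · exact h
      · omega
    have := hx (by linarith)
    rw [← h4] at this
    simpa [h0'] using this.cons e
  · rintro _ τ _ hf ⟨⟨W, K, hD⟩, hR⟩
    refine ⟨hD.le, fun x hx => hD.outside x (.inl hx), hD.sound, fun e he => ?_⟩
    obtain ⟨i, h1, h2, h3⟩ := hσ.grouped.cover e e.2 (hdst e e.2)
    rw [hσ.dst] at h1 h2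
    have := hR (I.dst e) i (I.dst e).2 h1 h2
    rw [h3, hw, he, hσ.src, hσ.res] at this
    exact this (by simp)

/-- Copy the labels of the previous layer to the current one, and clear the entries of `apred`. -/
def copyLayer : Prog :=
  .setNat rv (.const 0) ;;
  .loop (.natLt (.reg rv) (.reg rn))
    (.putReal blab (.add (.reg rbase) (.reg rv))
       (.get blab (.add (.sub (.reg rbase) (.reg rn)) (.reg rv))) ;;
     .putNat apred (.add (.reg rbase) (.reg rv)) (.const 0) ;;
     .setNat rv (.add (.reg rv) (.const 1)))

/-- Relax the edges from earlier layers into the current one. -/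
def relaxLayer : Prog :=
  .setNat redge (.const 0) ;;
  .loop (.natLt (.reg redge) (.reg rm))
    (.ite (.and (.natLt (.const 0) (.get aoff (.reg redge)))
        (.and (.natLt (.add (.get aoff (.reg redge)) (.reg rn)) (.add (.reg rbase) (.const 1)))
          (.realLt
            (.add (.get blab (.add (.sub (.reg rbase) (.get aoff (.reg redge)))
                (.get adst (.reg redge)))) (.get bres (.reg redge)))
            (.get blab (.add (.reg rbase) (.get asrc (.reg redge)))))))
      (.putReal blab (.add (.reg rbase) (.get asrc (.reg redge)))
          (.add (.get blab (.add (.sub (.reg rbase) (.get aoff (.reg redge)))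
                (.get adst (.reg redge)))) (.get bres (.reg redge))) ;;
       .putNat apred (.add (.reg rbase) (.get asrc (.reg redge)))
          (.add (.reg redge) (.const 1)))
      .skip ;;
     .setNat redge (.add (.reg redge) (.const 1)))

/-- Compute layers of labels, one for each weight up to `rX`, until the label of the source is at
most `R`. The weight of an edge is its rounded cost, plus one if `rmode` is `n` instead of `0`. -/
def layered : Prog :=
  roundCosts ;;
  .setNat rv (.const 0) ;;
  .loop (.natLt (.reg rv) (.reg rn))
    (.putReal blab (.reg rv) (.add (.reg xR) (.ofNat (.const 1))) ;;
     .setNat rv (.add (.reg rv) (.const 1))) ;;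
  .putReal blab (.reg rt) (.ofNat (.const 0)) ;;
  .setNat rbase (.const 0) ;;
  .setNat rk (.const 0) ;;
  .loop (.and (.natLt (.reg rk) (.add (.reg rX) (.const 1)))
      (.realLt (.reg xR) (.get blab (.add (.reg rbase) (.reg rs)))))
    (.setNat rbase (.add (.reg rbase) (.reg rn)) ;;
     .setNat rk (.add (.reg rk) (.const 1)) ;;
     copyLayer ;;
     relaxLayer ;;
     .ite (.natEq (.reg rmode) (.const 0)) dijkstra .skip)

theorem wp_copyLayer (σ : Store) (n j : ℕ) (hn : σ.nat rn = n) (hj : 1 ≤ j)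
    (hbase : σ.nat rbase = j * n) :
    WP copyLayer σ (40 * n + 10) fun _ τ =>
      (∀ x < j * n, τ.realArr blab x = σ.realArr blab x ∧ τ.natArr apred x = σ.natArr apred x) ∧
      ∀ v < n, τ.realArr blab (j * n + v) = σ.realArr blab ((j - 1) * n + v) ∧
        τ.natArr apred (j * n + v) = 0 := by
  have hprev : j * n - n = (j - 1) * n := by rw [Nat.sub_mul, one_mul]
  have hle : (j - 1) * n + n = j * n := by
    rw [← Nat.succ_mul]; congr 1; omega
  simp [copyLayer]
  refine wp_loop (fun T τ => 40 * (n - τ.nat rv) + 5 ≤ T ∧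
    (∀ x < j * n, τ.realArr blab x = σ.realArr blab x ∧ τ.natArr apred x = σ.natArr apred x) ∧
      ∀ v < τ.nat rv, τ.realArr blab (j * n + v) = σ.realArr blab ((j - 1) * n + v) ∧
        τ.natArr apred (j * n + v) = 0) ⟨by simp, by simp, by simp⟩ ?_
  rintro T τ hf ⟨hT, hold, hnew⟩
  have e0 : τ.nat rn = n := by rw [hf.nat rn rfl]; simpa using hn
  have e1 : τ.nat rbase = j * n := by rw [hf.nat rbase rfl]; simpa using hbase
  simp [e0, e1, hprev]
  refine ⟨by omega, fun h => ⟨by omega, by omega, by omega, by omega, fun x hx => ?_,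
    fun v hv => ?_⟩, fun h => ⟨hold, fun v hv => hnew v (by omega)⟩⟩
  · rw [Function.update_of_ne (by omega), Function.update_of_ne (by omega)]
    exact hold x hx
  · simp only [Function.update_apply]
    by_cases hvv : v = τ.nat rv
    · simp [hvv, hold _ (show (j - 1) * n + τ.nat rv < j * n by omega)]
    · simp [hvv, hnew v (by omega)]

/-- After relaxing all edges of positive weight, the new layer satisfies the conditions of `LayerOK`
that concern such edges. They lead into earlier layers, which do not change meanwhile. -/
theorem wp_relaxLayer (I : RSPInstance) (σ : Store) (hσ : HoldsInput I σ) (w : Fin I.m → ℕ)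
    (hw : ∀ e : Fin I.m, σ.natArr aoff e = w e * I.n) (j : ℕ) (hj : 1 ≤ j)
    (hbase : σ.nat rbase = j * I.n)
    (hcopy : ∀ v < I.n, σ.realArr blab (j * I.n + v) = σ.realArr blab ((j - 1) * I.n + v) ∧
      σ.natArr apred (j * I.n + v) = 0)
    (hsound0 : ∀ v < I.n, σ.realArr blab ((j - 1) * I.n + v) ≤ I.R →
      Reach I w (j - 1) v (σ.realArr blab ((j - 1) * I.n + v)))
    (hsound : ∀ i, 1 ≤ i → i < j → ∀ v < I.n, σ.realArr blab (i * I.n + v) ≤ I.R →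
      Reach I w (i - 1) v (σ.realArr blab (i * I.n + v))) :
    WP relaxLayer σ (80 * I.m + 10) fun _ τ =>
      (∀ x < j * I.n, τ.realArr blab x = σ.realArr blab x ∧
        τ.natArr apred x = σ.natArr apred x) ∧
      (∀ v < I.n, τ.realArr blab (j * I.n + v) ≤ τ.realArr blab ((j - 1) * I.n + v)) ∧
      (∀ e : Fin I.m, 0 < w e → w e + 1 ≤ j → τ.realArr blab (j * I.n + I.src e) ≤
        τ.realArr blab ((j - w e) * I.n + I.dst e) + I.res e) ∧
      (∀ v < I.n, τ.realArr blab (j * I.n + v) ≤ I.R →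
        Reach I w (j - 1) v (τ.realArr blab (j * I.n + v))) ∧
      ∀ v < I.n, (τ.natArr apred (j * I.n + v) = 0 ∧
          τ.realArr blab (j * I.n + v) = τ.realArr blab ((j - 1) * I.n + v)) ∨
        ∃ e : Fin I.m, τ.natArr apred (j * I.n + v) = e + 1 ∧ (I.src e : ℕ) = v ∧ 0 < w e ∧
          w e + 1 ≤ j ∧ τ.realArr blab (j * I.n + v) =
            τ.realArr blab ((j - w e) * I.n + I.dst e) + I.res e ∧
          τ.realArr blab (j * I.n + v) < τ.realArr blab ((j - 1) * I.n + v) := by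
  have hn := RSPInstance.n_pos I
  have hidx : ∀ i < j, ∀ v < I.n, i * I.n + v < j * I.n := by
    intro i hi v hv
    have := layer_index_lt (show i ≤ j - 1 by omega) hv
    rwa [show j - 1 + 1 = j by omega] at this
  -- labels of earlier layers, in terms of the initial state
  set D := σ.realArr blab with hDdef
  simp [relaxLayer]
  refine wp_loop (fun T τ => 80 * (I.m - τ.nat redge) + 5 ≤ T ∧
      (∀ x < j * I.n, τ.realArr blab x = D x ∧ τ.natArr apred x = σ.natArr apred x) ∧
      (∀ v < I.n, τ.realArr blab (j * I.n + v) ≤ D ((j - 1) * I.n + v)) ∧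
      (∀ e : Fin I.m, (e : ℕ) < τ.nat redge → 0 < w e → w e + 1 ≤ j →
        τ.realArr blab (j * I.n + I.src e) ≤ D ((j - w e) * I.n + I.dst e) + I.res e) ∧
      (∀ v < I.n, τ.realArr blab (j * I.n + v) ≤ I.R →
        Reach I w (j - 1) v (τ.realArr blab (j * I.n + v))) ∧
      ∀ v < I.n, (τ.natArr apred (j * I.n + v) = 0 ∧
          τ.realArr blab (j * I.n + v) = D ((j - 1) * I.n + v)) ∨
        ∃ e : Fin I.m, τ.natArr apred (j * I.n + v) = e + 1 ∧ (I.src e : ℕ) = v ∧ 0 < w e ∧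
          w e + 1 ≤ j ∧ τ.realArr blab (j * I.n + v) = D ((j - w e) * I.n + I.dst e) + I.res e ∧
          τ.realArr blab (j * I.n + v) < D ((j - 1) * I.n + v)) ?_ ?_
  · refine ⟨by simp, by simp [hDdef], fun v hv => (hcopy v hv).1.le, by simp, fun v hv => ?_,
      fun v hv => .inl ⟨(hcopy v hv).2, (hcopy v hv).1⟩⟩
    simp only [setN_realArr]
    rw [← hDdef, (hcopy v hv).1]
    exact hsound0 v hv
  rintro T τ hf ⟨hT, hold, hmono, hclosed, hsnd, hpred⟩
  have hτ := HoldsInput.frame (hσ.setN (by norm_num)) hf rfl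
  have e1 : τ.nat rbase = j * I.n := by rw [hf.nat rbase rfl]; simpa using hbase
  have e2 : τ.natArr aoff = σ.natArr aoff := by rw [hf.natArr aoff rfl]; simp
  have hold' : ∀ i < j, ∀ v < I.n, τ.realArr blab (i * I.n + v) = D (i * I.n + v) :=
    fun i hi v hv => (hold _ (hidx i hi v hv)).1
  simp [e1, e2, hτ.n, hτ.m, -not_and]
  refine ⟨by omega, fun h => ?_, fun h => ⟨hold, fun v hv => ?_, fun e he1 he2 => ?_, hsnd,
    fun v hv => ?_⟩⟩
  rotate_left
  · rw [hold' (j - 1) (by omega) v hv]; exact hmono v hv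
  · rw [hold' (j - w e) (by omega) _ (Fin.is_lt _)]; exact hclosed e (by omega) he1 he2
  · rw [hold' (j - 1) (by omega) v hv]
    refine (hpred v hv).imp id ?_
    rintro ⟨e, h1, h2, h3, h4, h5, h6⟩
    exact ⟨e, h1, h2, h3, h4, by rw [hold' (j - w e) (by omega) _ (Fin.is_lt _)]; exact h5, h6⟩
  obtain ⟨e, he⟩ : ∃ e : Fin I.m, (e : ℕ) = τ.nat redge := ⟨⟨_, h⟩, rfl⟩
  simp only [← he, hw, hτ.src, hτ.dst, hτ.res, ← Nat.sub_mul]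
  simp only [← he] at hT hclosed
  have hcond : w e * I.n + I.n < j * I.n + 1 ↔ w e + 1 ≤ j := by
    rw [← Nat.succ_mul, Nat.lt_succ_iff]
    exact Nat.mul_le_mul_right_iff hn
  have hpos : 0 < w e * I.n ↔ 0 < w e := by simp [Nat.pos_iff_ne_zero, hn.ne']
  rw [Nat.lt_succ_iff] at hcond
  simp only [hcond, hpos]
  have hs := (I.src e).2
  refine ⟨by omega, ?_, fun hno => ?_⟩
  · intro h1 h2 h3
    rw [hold' (j - w e) (by omega) _ (I.dst e).2] at h3 ⊢
    refine ⟨by omega, by omega, by omega, by omega, fun x hx => ?_, fun v hv => ?_,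
      fun e' he' h1' h2' => ?_, fun v hv => ?_, fun v hv => ?_⟩
    · rw [Function.update_of_ne (by omega), Function.update_of_ne (by omega)]
      exact hold x hx
    · rw [Function.update_apply]
      split_ifs with h'
      · rw [Nat.add_left_cancel h'] at *
        exact h3.le.trans (hmono _ hs)
      · exact hmono v hv
    · have hle : ∀ x, Function.update (τ.realArr blab) (j * I.n + I.src e)
          (D ((j - w e) * I.n + I.dst e) + I.res e) x ≤ τ.realArr blab x := by
        intro x
        rw [Function.update_apply]
        split_ifs with h'
        · rw [h']; exact h3.le
        · exact le_rfl
      by_cases hee : e' = e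
      · subst hee; rw [Function.update_self]
      · refine (hle _).trans (hclosed e' ?_ h1' h2')
        have : (e' : ℕ) ≠ e := fun h => hee (Fin.ext h)
        omega
    · rw [Function.update_apply]
      split_ifs with h'
      · intro hR
        rw [Nat.add_left_cancel h']
        have hr := I.res_nonneg e
        have := (hsound (j - w e) (by omega) (by omega) _ (I.dst e).2 (by linarith)).cons e
        exact this.mono (by omega) le_rfl
      · exact hsnd v hv
    · simp only [Function.update_apply]
      by_cases hve : v = I.src e
      · right
        refine ⟨e, by simp [hve], hve.symm, h1, h2, by simp [hve], ?_⟩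
        simp only [hve, if_true]
        exact h3.trans_le (hmono _ hs)
      · simp only [Nat.add_left_cancel_iff, hve, if_false]
        exact hpred v hv
  · refine ⟨by omega, by omega, by omega, hold, hmono, fun e' he' h1' h2' => ?_, hsnd, hpred⟩
    by_cases hee : e' = e
    · subst hee
      rw [hold' (j - w e') (by omega) _ (I.dst e').2] at hno
      by_contra hc
      exact hno ⟨h1', h2', not_le.1 hc⟩
    · refine hclosed e' ?_ h1' h2'
      have : (e' : ℕ) ≠ e := fun h => hee (Fin.ext h)
      omega

/-- The result of `layered`: the layers `1, …, j` of labels, preceded by a dummy layer `0`. -/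
structure LayeredResult (I : RSPInstance) (w : Fin I.m → ℕ) (X mode : ℕ) (τ : Store) (j : ℕ) :
    Prop where
  base : τ.nat rbase = j * I.n
  off : ∀ e : Fin I.m, τ.natArr aoff e = w e * I.n
  pos : 1 ≤ j
  le : j ≤ X + 1
  target : τ.realArr blab I.t = 0
  dummy : ∀ v < I.n, v ≠ I.t → I.R < τ.realArr blab v
  layer : ∀ i, 1 ≤ i → i ≤ j → LayerOK I w mode (τ.realArr blab) (τ.natArr apred) i
  fail : ∀ i < j, I.R < τ.realArr blab (i * I.n + I.s)
  done : τ.realArr blab (j * I.n + I.s) ≤ I.R ∨ j = X + 1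

/-- The time for one layer. -/
def layerTime (n m mode L : ℕ) : ℕ :=
  120 * (n + m) + 60 + if mode = 0 then (n + m) * (60 * L + 200) + 50 else 0

/-- The time for the layered dynamic program. -/
def layeredTime (n m X mode L : ℕ) : ℕ :=
  m * (60 * X + 150) + 50 * n + 100 + (X + 1) * layerTime n m mode L

/-- The dynamic program computes correct layers for some weights `w` that are the rounded costs,
plus `μ`. Here `μ` is `0` or `1` in all uses, as set by `rmode`. -/
theorem wp_layered (I : RSPInstance) (σ : Store) (hσ : Ready I σ) (L μ X : ℕ) (hL : I.n ≤ 2 ^ L)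
    (hmode : σ.nat rmode = μ * I.n) (hX : σ.nat rX = X) :
    WP layered σ (layeredTime I.n I.m X μ L) fun _ τ => ∃ w : Fin I.m → ℕ,
      (∀ e, ∃ k, IsRounding (I.cost e) (σ.real xunit) X k ∧ w e = k + μ) ∧
      ∃ j, LayeredResult I w X μ τ j := by
  have hn := RSPInstance.n_pos I
  have hst : (I.s : ℕ) ≠ I.t := fun h => I.s_ne_t (Fin.ext h)
  unfold layeredTime
  obtain ⟨G, hG⟩ : ∃ G, layerTime I.n I.m μ L = G := ⟨_, rfl⟩
  rw [hG]
  simp only [layered, wp_seq_iff]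
  refine wp_call (wp_roundCosts σ) (by rw [hσ.m, hX]; omega) ?_
  intro T0 σ1 hT0 hf1 hround
  rw [hσ.m, hX] at hT0 hround
  have h1 := hσ.frame hf1 rfl
  have hround' : ∀ e : Fin I.m, ∃ k, IsRounding (I.cost e) (σ.real xunit) X k ∧
      σ1.natArr aoff e = μ * I.n + k * I.n := fun e => by
    obtain ⟨k, hk, hk'⟩ := hround e e.2
    exact ⟨k, by rwa [hσ.cost] at hk, by rw [hk', hmode, hσ.n]⟩
  choose k hk hoff using hround'
  have hX1 : σ1.nat rX = X := by rw [hf1.nat rX rfl, hX]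
  have hmode1 : σ1.nat rmode = μ * I.n := by rw [hf1.nat rmode rfl, hmode]
  obtain ⟨w, hw⟩ : ∃ w : Fin I.m → ℕ, ∀ e, w e = k e + μ := ⟨_, fun _ => rfl⟩
  have hoff1 : ∀ e : Fin I.m, σ1.natArr aoff e = w e * I.n := fun e => by
    rw [hoff, hw]; ring
  clear hround hoff
  simp
  refine ⟨by omega, ?_⟩
  refine wp_loop (fun T τ => 30 * (I.n - τ.nat rv) + 60 + (X + 1) * G ≤ T ∧
    ∀ v < τ.nat rv, τ.realArr blab v = I.R + 1) ⟨by simp; omega, by simp⟩ ?_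
  rintro T τ hf ⟨hT, hv⟩
  have h2 : Ready I τ := Ready.frame (h1.setN (by norm_num)) hf rfl
  have hX2 : τ.nat rX = X := by rw [hf.nat rX rfl]; simp [hX1]
  have hmode2 : τ.nat rmode = μ * I.n := by rw [hf.nat rmode rfl]; simp [hmode1]
  have hoff2 : τ.natArr aoff = σ1.natArr aoff := by rw [hf.natArr aoff rfl]; simp
  simp [h2.n, h2.R, h2.t]
  refine ⟨by omega, fun h => ⟨by omega, by omega, by omega, fun v hv' => ?_⟩,
    fun h => ⟨by omega, by omega, by omega, ?_⟩⟩
  · rw [Function.update_apply]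
    split_ifs
    · rfl
    · exact hv v (by omega)
  have h3 : Ready I (((τ.putR blab I.t 0).setN rbase 0).setN rk 0) :=
    ((h2.putR (by norm_num)).setN (by norm_num)).setN (by norm_num)
  refine wp_loop (fun T ρ => (X + 1 - ρ.nat rk) * G + 30 ≤ T ∧ ρ.nat rk ≤ X + 1 ∧
    ρ.nat rbase = ρ.nat rk * I.n ∧ ρ.realArr blab I.t = 0 ∧
    (∀ v < I.n, v ≠ I.t → ρ.realArr blab v = I.R + 1) ∧
    (∀ i, 1 ≤ i → i ≤ ρ.nat rk → LayerOK I w μ (ρ.realArr blab) (ρ.natArr apred) i) ∧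
    ∀ i < ρ.nat rk, I.R < ρ.realArr blab (i * I.n + I.s)) ?_ ?_
  · refine ⟨by simp; omega, by simp, by simp, by simp, fun v hv1 hv2 => ?_,
      fun i hi1 hi2 => ?_, by simp⟩
    swap
    · simp at hi2; omega
    simp [hv2, hv v (by omega)]
  rintro T' ρ hf3 ⟨hT', hj, hbase, htgt, hdum, hlay, hfail⟩
  obtain ⟨j, hkj⟩ : ∃ j, ρ.nat rk = j := ⟨_, rfl⟩
  rw [hkj] at hT' hj hbase hlay hfail
  have h4 := h3.frame hf3 rfl
  have hX4 : ρ.nat rX = X := by rw [hf3.nat rX rfl]; simpa using hX2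
  have hmode4 : ρ.nat rmode = μ * I.n := by rw [hf3.nat rmode rfl]; simpa using hmode2
  have hoff4 : ρ.natArr aoff = σ1.natArr aoff := by rw [hf3.natArr aoff rfl]; simpa using hoff2
  simp [hkj, hX4, h4.R, h4.s, hbase, -Order.lt_add_one_iff, -not_and]
  refine ⟨by omega, fun hjX hR => ?_, fun hno => ?_⟩
  swap
  · refine ⟨w, fun e => ⟨k e, hk e, hw e⟩, j, hbase, fun e => by rw [hoff4, hoff1], ?_, hj, htgt,
      fun v h5 h6 => by rw [hdum v h5 h6]; linarith, hlay, hfail, ?_⟩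
    · by_contra hj0
      obtain rfl : j = 0 := by omega
      refine hno ⟨by omega, ?_⟩
      simp [hdum I.s (Fin.is_lt _) hst]
    · by_contra hc
      push Not at hc
      exact hno ⟨by omega, hc.1⟩
  have hsplit : (X + 1 - j) * G = (X + 1 - (j + 1)) * G + G := by
    rw [show X + 1 - j = X + 1 - (j + 1) + 1 by omega]; ring
  have hG' : 120 * (I.n + I.m) + 60 ≤ G := by rw [← hG]; unfold layerTime; omega
  have hbase' : j * I.n + I.n = (j + 1) * I.n := by ring
  rw [h4.n, hbase']
  refine ⟨by omega, by omega, ?_⟩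
  have h5 : Ready I ((ρ.setN rbase ((j + 1) * I.n)).setN rk (j + 1)) :=
    (h4.setN (by norm_num)).setN (by norm_num)
  refine wp_call (wp_copyLayer _ I.n (j + 1) h5.n (by omega) (by simp)) (by omega) ?_
  rintro T5 ρ5 hT5 hf5 ⟨hold5, hnew5⟩
  have h6 := h5.frame hf5 rfl
  simp only [setN_realArr, setN_natArr, Nat.add_sub_cancel] at hold5 hnew5
  have hoff5 : ∀ e : Fin I.m, ρ5.natArr aoff e = w e * I.n := fun e => by
    rw [hf5.natArr aoff rfl, ← hoff1, ← hoff4]; simp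
  have hbase5 : ρ5.nat rbase = (j + 1) * I.n := by rw [hf5.nat rbase rfl]; simp
  have hk5 : ρ5.nat rk = j + 1 := by rw [hf5.nat rk rfl]; simp
  have hmode5 : ρ5.nat rmode = μ * I.n := by rw [hf5.nat rmode rfl]; simp [hmode4]
  have hidx : ∀ i ≤ j, ∀ v < I.n, ρ5.realArr blab (i * I.n + v) = ρ.realArr blab (i * I.n + v) :=
    fun i hi v hv => (hold5 _ (layer_index_lt hi hv)).1
  have hsnd : ∀ i, i ≤ j → ∀ v < I.n, ρ.realArr blab (i * I.n + v) ≤ I.R →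
      Reach I w (i - 1) v (ρ.realArr blab (i * I.n + v)) := by
    intro i hi v hv hR
    by_cases hi0 : i = 0
    · subst hi0
      simp only [zero_mul, zero_add] at hR ⊢
      by_cases hvt : v = I.t
      · subst hvt
        exact fun _ => ⟨[], rfl, by simp, by simp [RSPInstance.pathRes, htgt]⟩
      · rw [hdum v hv hvt] at hR; linarith
    · exact (hlay i (by omega) hi).sound v hv hR
  refine wp_call (wp_relaxLayer I ρ5 h6.toHoldsInput w hoff5 (j + 1) (by omega) hbase5 ?_ ?_ ?_)
    (by omega) ?_
  · intro v hv
    rw [Nat.add_sub_cancel, hidx j le_rfl v hv]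
    exact hnew5 v hv
  · intro v hv
    rw [Nat.add_sub_cancel, hidx j le_rfl v hv]
    exact fun hR => (hsnd j le_rfl v hv hR).mono (by omega) le_rfl
  · intro i hi1 hi2 v hv
    rw [hidx i (by omega) v hv]
    exact hsnd i (by omega) v hv
  rintro T6 ρ6 hT6 hf6 ⟨hold6, hmono6, hclosed6, hsnd6, hpred6⟩
  have h7 := h6.frame hf6 rfl
  have hoff6 : ∀ e : Fin I.m, ρ6.natArr aoff e = w e * I.n := fun e => by
    rw [hf6.natArr aoff rfl, hoff5]
  have hbase6 : ρ6.nat rbase = (j + 1) * I.n := by rw [hf6.nat rbase rfl, hbase5]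
  have hk6 : ρ6.nat rk = j + 1 := by rw [hf6.nat rk rfl, hk5]
  have hmode6 : ρ6.nat rmode = μ * I.n := by rw [hf6.nat rmode rfl, hmode5]
  simp only [Nat.add_sub_cancel] at hmono6 hclosed6 hsnd6 hpred6
  -- the new layer and the old ones restore the invariant
  have hfinish : ∀ (T : ℕ) (π : Store), (X + 1 - (j + 1)) * G + 30 ≤ T → π.nat rk = j + 1 →
      π.nat rbase = (j + 1) * I.n →
      (∀ x < (j + 1) * I.n, π.realArr blab x = ρ.realArr blab x ∧
        π.natArr apred x = ρ.natArr apred x) →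
      LayerOK I w μ (π.realArr blab) (π.natArr apred) (j + 1) →
      (X + 1 - π.nat rk) * G + 30 ≤ T ∧ π.nat rk ≤ X + 1 ∧
        π.nat rbase = π.nat rk * I.n ∧ π.realArr blab I.t = 0 ∧
        (∀ v < I.n, v ≠ I.t → π.realArr blab v = I.R + 1) ∧
        (∀ i, 1 ≤ i → i ≤ π.nat rk →
          LayerOK I w μ (π.realArr blab) (π.natArr apred) i) ∧
        ∀ i < π.nat rk, I.R < π.realArr blab (i * I.n + I.s) := by
    intro T π hTπ hkπ hbπ hold hnew
    have hlt : ∀ v < I.n, v < (j + 1) * I.n := fun v hv => by rw [add_mul]; omega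
    rw [hkπ]
    refine ⟨hTπ, by omega, hbπ, ?_, fun v hv1 hv2 => ?_, fun i hi1 hi2 => ?_,
      fun i hi => ?_⟩
    · rw [(hold _ (hlt _ I.t.2)).1, htgt]
    · rw [(hold _ (hlt v hv1)).1, hdum v hv1 hv2]
    · by_cases hij : i = j + 1
      · rw [hij]; exact hnew
      · have hle : (i + 1) * I.n ≤ (j + 1) * I.n := Nat.mul_le_mul_right _ (by omega)
        exact (hlay i hi1 (by omega)).congr (fun x hx => (hold x (by omega)).1)
          fun x hx => (hold x (by omega)).2
    · rw [(hold _ (layer_index_lt (by omega) I.s.2)).1]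
      by_cases hij : i = j
      · rw [hij]; exact hR
      · exact hfail i (by omega)
  have hmul0 : μ * I.n = 0 ↔ μ = 0 := by simp [hn.ne']
  simp only [hmode6, hmul0]
  refine ⟨by omega, fun hμ => ?_, fun hμ => ?_⟩
  · have hG2 : 120 * (I.n + I.m) + 60 + ((I.n + I.m) * (60 * L + 200) + 50) = G := by
      rw [← hG]; simp [layerTime, hμ]
    refine wp_call (wp_dijkstra_layer I ρ6 h7 L (j + 1) hL w hoff6 hbase6 hsnd6) (by omega) ?_
    rintro T7 ρ7 hT7 hf7 ⟨hle7, hold7, hsnd7, hclosed7⟩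
    refine hfinish T7 ρ7 (by omega) (by rw [hf7.nat rk rfl, hk6])
      (by rw [hf7.nat rbase rfl, hbase6]) (fun x hx => ?_)
      ⟨fun v hv => ?_, fun e he => ?_, hsnd7, fun h => absurd hμ h⟩
    · rw [hold7 x hx, hf7.natArr apred rfl, (hold6 x hx).1, (hold6 x hx).2, (hold5 x hx).1,
        (hold5 x hx).2]
      exact ⟨rfl, rfl⟩
    · rw [Nat.add_sub_cancel, hold7 _ (layer_index_lt le_rfl hv)]
      exact (hle7 _).trans (hmono6 v hv)
    · by_cases hwe : w e = 0
      · have := hclosed7 e hwe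
        simpa [hwe] using this
      · rw [hold7 _ (layer_index_lt (show j + 1 - w e ≤ j by omega) (I.dst e).2)]
        exact (hle7 _).trans (hclosed6 e (by omega) he)
  · refine ⟨by omega, hfinish _ ρ6 (by omega) hk6 hbase6 (fun x hx => ?_)
      ⟨hmono6, fun e he => hclosed6 e ?_ he, hsnd6, fun _ => hpred6⟩⟩
    · rw [(hold6 x hx).1, (hold6 x hx).2, (hold5 x hx).1, (hold5 x hx).2]
      exact ⟨rfl, rfl⟩
    · rw [hw]; omega

/-! ### Paths, optimal costs, and rounded costs -/

section Paths

variable {I : RSPInstance}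

theorem isWalk_append {u v x : Fin I.n} {p q : List (Fin I.m)} (hp : I.IsWalk u p v)
    (hq : I.IsWalk v q x) : I.IsWalk u (p ++ q) x := by
  induction p generalizing u with
  | nil => obtain rfl : u = v := hp; exact hq
  | cons e p ih => exact ⟨hp.1, ih hp.2⟩

theorem exists_subpath {x u v : Fin I.n} {p : List (Fin I.m)} (hp : I.IsPath x p v)
    (hu : u ∈ x :: p.map I.dst) : ∃ q, I.IsPath u q v ∧ q.Sublist p := by
  induction p generalizing x with
  | nil =>
    simp only [List.map_nil, List.mem_singleton] at hu
    subst hu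
    exact ⟨[], hp, List.Sublist.refl _⟩
  | cons e p ih =>
    obtain rfl | hu := List.mem_cons.1 hu
    · exact ⟨_, hp, List.Sublist.refl _⟩
    · obtain ⟨q, hq, hqp⟩ := ih ⟨hp.1.2, (List.nodup_cons.1 hp.2).2⟩ hu
      exact ⟨q, hq, hqp.cons e⟩

/-- Every walk contains a path with the same ends. -/
theorem exists_path {u v : Fin I.n} {p : List (Fin I.m)} (hp : I.IsWalk u p v) :
    ∃ q, I.IsPath u q v ∧ q.Sublist p := by
  induction p generalizing u with
  | nil => exact ⟨[], ⟨hp, by simp⟩, List.Sublist.refl _⟩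
  | cons e p ih =>
    obtain ⟨q, hq, hqp⟩ := ih hp.2
    by_cases hu : u ∈ I.dst e :: q.map I.dst
    · obtain ⟨q', hq', hqq⟩ := exists_subpath hq hu
      exact ⟨q', hq', (hqq.trans hqp).cons e⟩
    · exact ⟨e :: q, ⟨⟨hp.1, hq.1⟩, List.nodup_cons.2 ⟨hu, hq.2⟩⟩, hqp.cons_cons e⟩

theorem path_length_lt {u v : Fin I.n} {p : List (Fin I.m)} (hp : I.IsPath u p v) :
    p.length < I.n := by
  simpa using hp.2.length_le_card

theorem pathRes_le_of_sublist {p q : List (Fin I.m)} (h : p.Sublist q) :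
    I.pathRes p ≤ I.pathRes q :=
  (h.map I.res).sum_le_sum fun x hx => by
    obtain ⟨e, -, rfl⟩ := List.mem_map.1 hx; exact I.res_nonneg e

theorem cost_le_pathCost {p : List (Fin I.m)} {e : Fin I.m} (he : e ∈ p) :
    I.cost e ≤ I.pathCost p :=
  List.single_le_sum (fun x hx => by
    obtain ⟨e, -, rfl⟩ := List.mem_map.1 hx; exact I.cost_nonneg e) _ (List.mem_map_of_mem he)

theorem pathCost_le_mul {p : List (Fin I.m)} {B : ℝ} (h : ∀ e ∈ p, I.cost e ≤ B) :
    I.pathCost p ≤ p.length * B := by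
  simpa [RSPInstance.pathCost] using List.sum_le_card_nsmul (p.map I.cost) B (by simpa using h)

theorem solution_ne_nil {p : List (Fin I.m)} (hp : I.IsSolution p) : p ≠ [] := by
  rintro rfl
  exact I.s_ne_t hp.1.1

/-- If there is a solution, there is one of least cost. -/
theorem exists_isOptCost {p : List (Fin I.m)} (hp : I.IsSolution p) : ∃ c, I.IsOptCost c := by
  have hfin : {p : List (Fin I.m) | I.IsSolution p}.Finite :=
    (List.finite_length_lt (Fin I.m) I.n).subset fun q hq => path_length_lt hq.1
  obtain ⟨q, hq, hmin⟩ := Set.exists_min_image _ I.pathCost hfin ⟨p, hp⟩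
  refine ⟨I.pathCost q, ⟨q, hq, rfl⟩, ?_⟩
  rintro x ⟨r, hr, rfl⟩
  exact hmin r hr

end Paths

section Rounding

variable {I : RSPInstance} {w : Fin I.m → ℕ} {δ : ℝ} {X μ : ℕ}

/-- The sum `K` of the rounded costs of a path accounts for no more than its cost, and for less
unless `K = 0`. -/
theorem sum_rounding_le
    (hw : ∀ e, ∃ k, IsRounding (I.cost e) δ X k ∧ w e = k + μ) (p : List (Fin I.m)) :
    ∃ K : ℕ, (p.map w).sum = K + μ * p.length ∧ (K = 0 ∨ K * δ < I.pathCost p) ∧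
      K * δ ≤ I.pathCost p := by
  induction p with
  | nil => exact ⟨0, by simp, by simp, by simp [RSPInstance.pathCost]⟩
  | cons e p ih =>
    obtain ⟨K, h1, h2, h3⟩ := ih
    obtain ⟨k, hk, hwk⟩ := hw e
    have hc : I.pathCost (e :: p) = I.cost e + I.pathCost p := by simp [RSPInstance.pathCost]
    have hk' : (k : ℝ) * δ ≤ I.cost e := by
      obtain h | h := hk.lt
      · simpa [h] using I.cost_nonneg e
      · exact h.le
    refine ⟨k + K, ?_, ?_, ?_⟩
    · simp only [List.map_cons, List.sum_cons, h1, hwk, List.length_cons]; ring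
    · rw [hc]
      push_cast
      rcases hk.lt with h | h <;> rcases h2 with h' | h'
      · left; omega
      · right; linarith
      · right; linarith
      · right; linarith
    · rw [hc]; push_cast; linarith

/-- A path of cost at most `Y` units has rounded cost at most `Y`. -/
theorem weight_le_of_cost_le (hδ : 0 ≤ δ)
    (hw : ∀ e, ∃ k, IsRounding (I.cost e) δ X k ∧ w e = k + μ) {p : List (Fin I.m)} {Y : ℕ}
    (hp : I.pathCost p ≤ Y * δ) : (p.map w).sum ≤ Y + μ * p.length := by
  obtain ⟨K, h1, h2, -⟩ := sum_rounding_le hw p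
  rw [h1, add_le_add_iff_right]
  obtain rfl | h2 := h2
  · exact Nat.zero_le _
  · by_contra! h
    have : (Y : ℝ) * δ ≤ K * δ := mul_le_mul_of_nonneg_right (by exact_mod_cast h.le) hδ
    linarith

/-- A path of weight at most `X`, where each edge contributes at least its rounded cost and `1`,
costs at most as many units. -/
theorem cost_le_weight (hw : ∀ e, ∃ k, IsRounding (I.cost e) δ X k ∧ w e = k + μ)
    (p : List (Fin I.m)) (hp : (p.map w).sum ≤ X) (hδ : 0 ≤ δ) :
    I.pathCost p ≤ ((p.map w).sum + (1 - μ : ℕ) * p.length : ℕ) * δ := by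
  have key : ∀ q : List (Fin I.m), (∀ e ∈ q, w e ≤ X) →
      I.pathCost q ≤ ((q.map w).sum + (1 - μ : ℕ) * q.length : ℕ) * δ := by
    intro q hq
    induction q with
    | nil => simp [RSPInstance.pathCost]
    | cons e q ih =>
      have h1 := ih fun e' he' => hq e' (List.mem_cons_of_mem _ he')
      obtain ⟨k, hk, hwk⟩ := hw e
      have h2 := hk.le (by have := hq e List.mem_cons_self; omega)
      have h3 : ((k : ℝ) + 1) * δ ≤ (w e + (1 - μ) : ℕ) * δ :=
        mul_le_mul_of_nonneg_right (by exact_mod_cast (by omega)) hδ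
      have hc : I.pathCost (e :: q) = I.cost e + I.pathCost q := by simp [RSPInstance.pathCost]
      rw [hc]
      have hs : (((e :: q).map w).sum + (1 - μ) * (e :: q).length : ℕ) =
          (w e + (1 - μ)) + ((q.map w).sum + (1 - μ) * q.length) := by
        simp only [List.map_cons, List.sum_cons, List.length_cons]; ring
      rw [hs, Nat.cast_add, add_mul]
      linarith
  exact key p fun e he => (List.single_le_sum (by simp) _ (List.mem_map_of_mem he)).trans hp

end Rounding

section Outcome

variable {I : RSPInstance} {w : Fin I.m → ℕ} {X μ j : ℕ} {τ : Store}

/-- The layered dynamic program has found a solution. -/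
def Success (I : RSPInstance) (τ : Store) : Prop :=
  τ.realArr blab (τ.nat rbase + I.s) ≤ I.R

theorem LayeredResult.exists_solution (h : LayeredResult I w X μ τ j) (hs : Success I τ) :
    ∃ p, I.IsSolution p ∧ (p.map w).sum + 1 ≤ j := by
  unfold Success at hs
  rw [h.base] at hs
  obtain ⟨p, h1, h2, h3⟩ := (h.layer j h.pos le_rfl).sound I.s I.s.2 hs I.s.2
  obtain ⟨q, hq, hqp⟩ := exists_path h1
  refine ⟨q, ⟨hq, (pathRes_le_of_sublist hqp).trans (h3.trans hs)⟩, ?_⟩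
  have := (hqp.map w).sum_le_sum (by simp)
  have := h.pos
  omega

/-- The dynamic program stops at the first layer that admits a solution, so the weight of every
solution is at least that of the last layer. -/
theorem LayeredResult.le_weight (h : LayeredResult I w X μ τ j) {p : List (Fin I.m)}
    (hp : I.IsSolution p) : j ≤ (p.map w).sum + 1 := by
  by_contra! hc
  have := label_le h.target h.layer p I.s ((p.map w).sum + 1) (by omega) hp.1.1 le_rfl
  linarith [h.fail _ hc, hp.2]

/-- If the dynamic program fails, then all solutions have weights beyond the last layer. -/
theorem LayeredResult.lt_weight (h : LayeredResult I w X μ τ j) (hs : ¬ Success I τ)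
    {p : List (Fin I.m)} (hp : I.IsSolution p) : X < (p.map w).sum := by
  unfold Success at hs
  rw [h.base] at hs
  obtain rfl : j = X + 1 := h.done.resolve_left hs
  by_contra! hc
  have := label_le h.target h.layer p I.s (X + 1) le_rfl hp.1.1 (by omega)
  linarith [hp.2]

end Outcome

/-! ### Reading off the path -/

/-- Follow the array `apred` from the source in the last layer to the target, and write the edges
to `aout` and their number to `rlen`. -/
def backtrack : Prog :=
  .setNat rpos (.reg rbase) ;;
  .setNat rv (.reg rs) ;;
  .setNat rlen (.const 0) ;;
  .loop (.not (.natEq (.reg rv) (.reg rt)))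
    (.setNat rpred (.get apred (.add (.reg rpos) (.reg rv))) ;;
     .ite (.natEq (.reg rpred) (.const 0))
       (.setNat rpos (.sub (.reg rpos) (.reg rn)))
       (.setNat redge (.sub (.reg rpred) (.const 1)) ;;
        .putNat aout (.reg rlen) (.reg redge) ;;
        .setNat rlen (.add (.reg rlen) (.const 1)) ;;
        .setNat rpos (.sub (.reg rpos) (.get aoff (.reg redge))) ;;
        .setNat rv (.get adst (.reg redge))))

/-- Labels do not increase from one layer to the next. -/
theorem LayeredResult.antitone {I : RSPInstance} {w : Fin I.m → ℕ} {X μ j : ℕ} {τ : Store}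
    (h : LayeredResult I w X μ τ j) {i i' : ℕ} (hi : i ≤ j) (hi' : i' ≤ i) {v : ℕ} (hv : v < I.n) :
    τ.realArr blab (i * I.n + v) ≤ τ.realArr blab (i' * I.n + v) := by
  induction i, hi' using Nat.le_induction with
  | base => exact le_rfl
  | succ i hi' ih =>
    exact ((h.layer (i + 1) (by omega) hi).mono v hv).trans (ih (by omega))

/-- The extracted edge sequence visits no node twice: a node owes a new label to an edge only if
that is less than its label in all earlier layers, while labels do not increase along the way. -/
theorem wp_backtrack (I : RSPInstance) (σ : Store) (hσ : HoldsInput I σ) (w : Fin I.m → ℕ)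
    (X μ j : ℕ) (hμ : μ ≠ 0) (h : LayeredResult I w X μ σ j) (hs : Success I σ) :
    WP backtrack σ (60 * j + 30) fun _ τ => ∃ p : List (Fin I.m), I.IsSolution p ∧
      (p.map w).sum + 1 ≤ j ∧ τ.nat rlen = p.length ∧
      (List.range p.length).map (τ.natArr aout) = p.map Fin.val := by
  unfold Success at hs
  obtain ⟨D, hD⟩ : ∃ D, D = σ.realArr blab := ⟨_, rfl⟩
  rw [h.base] at hs
  simp [backtrack, -Order.add_one_le_iff]
  -- `i` is the current layer, `v` the current node, `p` the walk so far, and all nodes on `p`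
  -- before `v` have, in all layers up to `i`, labels greater than that of `v`; the invariant is
  -- made opaque so that `simp` does not take it apart
  obtain ⟨Inv, hInv⟩ : ∃ Inv : ℕ → Store → Prop, ∀ T ρ, Inv T ρ ↔
    ∃ (i : ℕ) (p : List (Fin I.m)) (v : Fin I.n), 60 * i + 10 ≤ T ∧ 1 ≤ i ∧
    ρ.nat rpos = i * I.n ∧ ρ.nat rv = v ∧ I.IsWalk I.s p v ∧ ρ.nat rlen = p.length ∧
    (List.range p.length).map (ρ.natArr aout) = p.map Fin.val ∧
    (p.map w).sum + i ≤ j ∧ I.pathRes p + D (i * I.n + v) ≤ I.R ∧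
    (I.s :: p.map I.dst).Nodup ∧
    ∀ x ∈ I.s :: p.map I.dst, x ≠ v → ∀ i' ≤ i, D (i * I.n + v) < D (i' * I.n + x) :=
    ⟨_, fun _ _ => Iff.rfl⟩
  refine wp_loop Inv ((hInv _ _).2 ?_) ?_
  · refine ⟨j, [], I.s, by omega, h.pos, by simp [h.base], by simp [hσ.s], rfl, by simp, by simp,
      by simp, ?_, by simp, ?_⟩
    · simpa [RSPInstance.pathRes, hD] using hs
    · intro x hx hxs
      simp at hx
      exact absurd hx hxs
  intro T ρ hf hρi
  obtain ⟨i, p, v, hT, hi, hpos, hv, hwalk, hlen, hout, hwt, hres, hnd, hvis⟩ := (hInv _ _).1 hρi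
  have hρ : HoldsInput I ρ :=
    HoldsInput.frame (((hσ.setN (by norm_num)).setN (by norm_num)).setN (by norm_num)) hf rfl
  have e1 : ρ.natArr apred = σ.natArr apred := by rw [hf.natArr apred rfl]; simp
  have e2 : ρ.natArr aoff = σ.natArr aoff := by rw [hf.natArr aoff rfl]; simp
  simp only [Test.time, NExp.time, Test.Holds, NExp.eval, hv, hρ.t, not_not]
  have hres0 : 0 ≤ I.pathRes p := List.sum_nonneg fun x hx => by
    obtain ⟨e, -, rfl⟩ := List.mem_map.1 hx; exact I.res_nonneg e
  have hij : i ≤ j := by omega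
  have hD0 : 0 ≤ D (i * I.n + v) := by
    have hle : D (i * I.n + v) ≤ I.R := by linarith
    rw [hD] at hle ⊢
    obtain ⟨q, -, -, hq⟩ := (h.layer i hi hij).sound v v.2 hle v.2
    refine le_trans ?_ hq
    exact List.sum_nonneg fun x hx => by
      obtain ⟨e, -, rfl⟩ := List.mem_map.1 hx; exact I.res_nonneg e
  refine ⟨by omega, fun hvt => ?_, fun hvt => ?_⟩
  swap
  · obtain rfl := Fin.ext hvt
    exact ⟨p, ⟨⟨hwalk, hnd⟩, by linarith⟩, by omega, hlen, hout⟩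
  simp [hv, hpos, e1, e2, hρ.n]
  refine ⟨by omega, by omega, fun hp0 => ?_, fun hp0 => ?_⟩
  -- a copied label: move to the previous layer, which is not the dummy as labels there exceed `R`
  · obtain ⟨-, hcopy⟩ | ⟨e, he, -⟩ := (h.layer i hi hij).pred hμ v v.2
    swap
    · omega
    rw [← hD] at hcopy
    have hi2 : 2 ≤ i := by
      by_contra hc
      obtain rfl : i = 1 := by omega
      have := h.dummy v v.2 hvt
      rw [← hD] at this
      simp only [Nat.sub_self, zero_mul, zero_add] at hcopy
      linarith
    refine ⟨by omega, (hInv _ _).2 ⟨i - 1, p, v, by omega, by omega, ?_, by simpa using hv,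
      hwalk, by simpa using hlen, by simpa using hout, by omega, ?_, hnd, ?_⟩⟩
    · simp [Nat.sub_mul]
    · rw [← hcopy]; exact hres
    · rw [← hcopy]
      exact fun x hx hxv i' hi' => hvis x hx hxv i' (by omega)
  · obtain ⟨hp1, -⟩ | ⟨e, he1, he2, he3, he4, he5, he6⟩ := (h.layer i hi hij).pred hμ v v.2
    · exact absurd hp1 hp0
    obtain rfl := Fin.ext he2
    have hanti : ∀ i' ≤ i - 1, ∀ x : Fin I.n, D ((i - 1) * I.n + x) ≤ D (i' * I.n + x) := by
      intro i' hi' x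
      rw [hD]
      exact h.antitone (by omega) hi' x.2
    rw [← hD] at he5 he6
    have hr := I.res_nonneg e
    rw [he1]
    simp only [Nat.add_sub_cancel, h.off, hρ.dst]
    -- the new node is distinct from all earlier ones, since its label is less
    have hnew : ∀ x ∈ I.s :: p.map I.dst, ∀ i' ≤ i - w e,
        D ((i - w e) * I.n + I.dst e) < D (i' * I.n + x) := by
      intro x hx i' hi'
      by_cases hxv : x = I.src e
      · subst hxv
        have := hanti i' (by omega) (I.src e)
        linarith
      · have := hvis x hx hxv i' (by omega)
        linarith
    have hmap : (p ++ [e]).map I.dst = p.map I.dst ++ [I.dst e] := by simp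
    refine ⟨by omega, by omega, by omega, by omega, by omega, (hInv _ _).2 ⟨i - w e, p ++ [e],
      I.dst e, by omega, by omega, ?_, by simp, isWalk_append hwalk ⟨rfl, rfl⟩, by simp [hlen],
      ?_, ?_, ?_, ?_, ?_⟩⟩
    · simp [Nat.sub_mul]
    · rw [List.length_append, List.length_singleton, List.range_succ, List.map_append,
        List.map_append, ← hout]
      simp only [setN_natArr, putN_natArr, if_true]
      congr 1
      · refine List.map_congr_left fun a ha => Function.update_of_ne ?_ _ _
        have := List.mem_range.1 ha
        omega
      · simp [hlen]
    · simp; omega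
    · simp only [RSPInstance.pathRes, List.map_append, List.sum_append] at hres ⊢
      simp; linarith
    · rw [hmap, ← List.cons_append, List.nodup_append]
      refine ⟨hnd, by simp, ?_⟩
      rintro x hx y hy rfl
      rw [List.mem_singleton] at hy
      subst hy
      exact lt_irrefl _ (hnew _ hx _ le_rfl)
    · intro x hx hxd i' hi'
      rw [hmap, ← List.cons_append, List.mem_append, List.mem_singleton] at hx
      exact hnew x (hx.resolve_right hxd) i' hi'

/-! ### Sorting the costs -/

/-- Write the costs to `bsort` in increasing order. The order is that in which Dijkstra's
algorithm settles the nodes of a graph with `m` nodes and no edges; there are no edges as long as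
`astart` holds the zeros of the initial state. -/
def sortCosts : Prog :=
  .setNat rsize (.reg rm) ;;
  .setNat rbase (.const 0) ;;
  .setNat rk (.const 0) ;;
  .loop (.natLt (.reg rk) (.reg rm))
    (.putReal blab (.reg rk) (.get bcost (.reg rk)) ;;
     .setNat rk (.add (.reg rk) (.const 1))) ;;
  dijkstra ;;
  .setNat rk (.const 0) ;;
  .loop (.natLt (.reg rk) (.reg rm))
    (.putReal bsort (.reg rk) (.get blab (.get aord (.reg rk))) ;;
     .setNat rk (.add (.reg rk) (.const 1)))

/-- The array `S` lists the edge costs in increasing order. -/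
structure Sorted (I : RSPInstance) (S : ℕ → ℝ) : Prop where
  mono : ∀ i j, i ≤ j → j < I.m → S i ≤ S j
  cover : ∀ e : Fin I.m, ∃ i < I.m, S i = I.cost e

theorem wp_sortCosts (I : RSPInstance) (σ : Store) (hσ : HoldsInput I σ) (hm : 1 ≤ I.m) (L : ℕ)
    (hL : I.m ≤ 2 ^ L) (hhalf : ∀ x < 2 * I.m, σ.natArr ahalf x = x / 2)
    (hstart : ∀ u, σ.natArr astart u = 0) :
    WP sortCosts σ (I.m * (60 * L + 300) + 150) fun _ τ => Sorted I (τ.realArr bsort) := by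
  have hB : I.m * (60 * L + 300) = I.m * (60 * L + 200) + 100 * I.m := by ring
  rw [hB]
  simp [sortCosts]
  refine wp_loop (fun T τ => 30 * (I.m - τ.nat rk) + I.m * (60 * L + 200) + 50 * I.m + 120 ≤ T ∧
    ∀ i < τ.nat rk, τ.realArr blab i = σ.realArr bcost i) ⟨by simp; omega, by simp⟩ ?_
  rintro T τ hf ⟨hT, hx⟩
  have h1 : HoldsInput I τ :=
    HoldsInput.frame (((hσ.setN (by norm_num)).setN (by norm_num)).setN (by norm_num)) hf rfl
  have e1 : τ.realArr bcost = σ.realArr bcost := by rw [hf.realArr bcost rfl]; simp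
  have e2 : τ.natArr astart = σ.natArr astart := by rw [hf.natArr astart rfl]; simp
  have e3 : τ.natArr ahalf = σ.natArr ahalf := by rw [hf.natArr ahalf rfl]; simp
  have e4 : τ.nat rbase = 0 := by rw [hf.nat rbase rfl]; simp
  have e5 : τ.nat rsize = I.m := by rw [hf.nat rsize rfl]; simp [hσ.m]
  simp [h1.m, e1]
  refine ⟨by omega, fun h => ⟨by omega, by omega, by omega, fun i hi => ?_⟩, fun h => ?_⟩
  · rw [Function.update_apply]
    split_ifs with hi'
    · rw [hi']
    · exact hx i (by omega)
  refine wp_call (B := I.m * (60 * L + 200) + 50)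
    (wp_dijkstra τ I.m L 0 0 (fun v x => x = σ.realArr bcost v) e5 hm e4
      (by rw [e3]; exact hhalf) hL (by simp [e2, hstart]) ?_ ?_) (by omega) ?_
  · intro u hu j h2 h3
    rw [e2, hstart] at h3
    omega
  · intro v hv
    rw [zero_add]; exact hx v (by omega)
  rintro T1 τ1 hT1 hf1 ⟨⟨W, K, hD⟩, -⟩
  have h2 := h1.frame hf1 rfl
  refine ⟨by omega, ?_⟩
  refine wp_loop (fun T ρ => 30 * (I.m - ρ.nat rk) + 5 ≤ T ∧
    ∀ i < ρ.nat rk, ρ.realArr bsort i = σ.realArr bcost (τ1.natArr aord i))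
    ⟨by simp; omega, by simp⟩ ?_
  rintro T2 ρ hf2 ⟨hT2, hx2⟩
  have h3 := HoldsInput.frame (h2.setN (by norm_num)) hf2 rfl
  have b1 : ρ.natArr aord = τ1.natArr aord := by rw [hf2.natArr aord rfl]; simp
  have b2 : ρ.realArr blab = τ1.realArr blab := by rw [hf2.realArr blab rfl]; simp
  have hval : ∀ i < I.m,
      τ1.realArr blab (τ1.natArr aord i) = σ.realArr bcost (τ1.natArr aord i) := by
    intro i hi
    have := hD.sound _ (hD.ord_mem i hi).1
    rwa [zero_add] at this
  simp [h3.m, b1, b2]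
  refine ⟨by omega, fun h => ⟨by omega, by omega, by omega, fun i hi => ?_⟩, fun h => ?_⟩
  · rw [Function.update_apply]
    split_ifs with hi'
    · rw [hi', hval _ h]
    · exact hx2 i (by omega)
  · refine ⟨fun i j hij hj => ?_, fun e => ?_⟩
    · obtain rfl | hij := hij.eq_or_lt
      · exact le_rfl
      · have := hD.ord_mono i j hij hj
        rw [zero_add, zero_add, hval i (by omega), hval j hj] at this
        rwa [hx2 i (by omega), hx2 j (by omega)]
    · obtain ⟨i, hi, hie⟩ := hD.ord_surj e e.2 (by simp)
      exact ⟨i, hi, by rw [hx2 i (by omega), hie, hσ.cost]⟩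

/-- All precomputations. -/
def prepare : Prog :=
  halfTable ;;
  sortCosts ;;
  groupEdges ;;
  .setNat rsize (.reg rn)

theorem wp_prepare (I : RSPInstance) (σ : Store) (hσ : HoldsInput I σ) (hm : 1 ≤ I.m) (L : ℕ)
    (hL : I.m ≤ 2 ^ L) (hstart : ∀ u, σ.natArr astart u = 0) :
    WP prepare σ (30 * (I.n + I.m) + I.m * (60 * L + 300) + I.n * (40 * I.m + 40) + 200)
      fun _ τ => Ready I τ ∧ Sorted I (τ.realArr bsort) := by
  simp only [prepare, wp_seq_iff]
  refine wp_call (wp_halfTable σ) (by rw [hσ.n, hσ.m]; omega) ?_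
  intro T1 τ1 hT1 hf1 hh1
  rw [hσ.n, hσ.m] at hT1 hh1
  have h1 := hσ.frame hf1 rfl
  refine wp_call (wp_sortCosts I τ1 h1 hm L hL (fun x hx => hh1 x (by omega)) ?_) (by omega) ?_
  · rw [hf1.natArr astart rfl]; exact hstart
  intro T2 τ2 hT2 hf2 hS
  have h2 := h1.frame hf2 rfl
  refine wp_call (wp_groupEdges τ2) (by rw [h2.n, h2.m]; omega) ?_
  intro T3 τ3 hT3 hf3 hG
  rw [h2.n, h2.m] at hT3 hG
  have h3 := h2.frame hf3 rfl
  simp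
  refine ⟨by omega, ⟨h3.setN (by norm_num), by simp [h3.n], ?_, ?_⟩, ?_⟩
  · simp only [setN_natArr]
    rw [hf3.natArr ahalf rfl, hf2.natArr ahalf rfl]; exact hh1
  · simp only [setN_natArr]
    rw [hf3.natArr adst rfl]; exact hG
  · rw [hf3.realArr bsort rfl]; exact hS

/-! ### The bottleneck cost -/

/-- There is a solution whose edges cost at most `B` each. -/
def Feasible (I : RSPInstance) (B : ℝ) : Prop :=
  ∃ p, I.IsSolution p ∧ ∀ e ∈ p, I.cost e ≤ B

theorem Feasible.mono {I : RSPInstance} {B B' : ℝ} (h : Feasible I B) (hB : B ≤ B') :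
    Feasible I B' := by
  obtain ⟨p, hp, hc⟩ := h
  exact ⟨p, hp, fun e he => (hc e he).trans hB⟩

theorem Feasible.nonneg {I : RSPInstance} {B : ℝ} (h : Feasible I B) : 0 ≤ B := by
  obtain ⟨p, hp, hc⟩ := h
  obtain ⟨e, he⟩ := List.exists_mem_of_ne_nil p (solution_ne_nil hp)
  exact (I.cost_nonneg e).trans (hc e he)

/-- Without layers for positive rounded costs, the dynamic program decides feasibility. -/
theorem success_iff_feasible {I : RSPInstance} {w : Fin I.m → ℕ} {j : ℕ} {τ : Store} {δ : ℝ}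
    (hw : ∀ e, ∃ k, IsRounding (I.cost e) δ 0 k ∧ w e = k + 0)
    (h : LayeredResult I w 0 0 τ j) : Success I τ ↔ Feasible I δ := by
  constructor
  · intro hs
    obtain ⟨p, hp, hpw⟩ := h.exists_solution hs
    have := h.le
    refine ⟨p, hp, fun e he => ?_⟩
    obtain ⟨k, hk, hwk⟩ := hw e
    have h1 := List.single_le_sum (l := p.map w) (by simp) _ (List.mem_map_of_mem he)
    have h2 := hk.le (by omega)
    obtain rfl : k = 0 := by omega
    simpa using h2
  · rintro ⟨p, hp, hc⟩
    by_contra hs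
    have h1 := h.lt_weight hs hp
    have h2 : (p.map w).sum = 0 := by
      rw [List.sum_eq_zero]
      intro x hx
      obtain ⟨e, he, rfl⟩ := List.mem_map.1 hx
      obtain ⟨k, hk, hwk⟩ := hw e
      have hδ : 0 ≤ δ := (I.cost_nonneg e).trans (hc e he)
      obtain h3 | h3 := hk.lt
      · omega
      · by_contra hne
        have h4 : (1 : ℝ) ≤ k := by exact_mod_cast (by omega : 1 ≤ k)
        nlinarith [hc e he]
    omega

/-- The optimal cost lies between `L` and `F * L`. -/
structure Bracket (I : RSPInstance) (L F : ℝ) : Prop where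
  nonneg : 0 ≤ L
  le : ∀ p, I.IsSolution p → L ≤ I.pathCost p
  exists_le : ∃ p, I.IsSolution p ∧ I.pathCost p ≤ F * L

theorem Bracket.mono {I : RSPInstance} {L F F' : ℝ} (h : Bracket I L F) (hF : F ≤ F') :
    Bracket I L F' := by
  obtain ⟨p, hp, hc⟩ := h.exists_le
  exact ⟨h.nonneg, h.le, p, hp, hc.trans (mul_le_mul_of_nonneg_right hF h.nonneg)⟩

/-- The least feasible cost determines the optimal cost up to a factor `n`. -/
theorem bracket_of_sorted {I : RSPInstance} {S : ℕ → ℝ} (hS : Sorted I S) {i : ℕ}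
    (hi : Feasible I (S i)) (hlt : ∀ j < i, ¬ Feasible I (S j)) : Bracket I (S i) I.n := by
  refine ⟨hi.nonneg, fun p hp => ?_, ?_⟩
  · -- the most expensive edge of the path
    obtain ⟨e, he, hmax⟩ := Finset.exists_max_image p.toFinset I.cost
      (by simpa using solution_ne_nil hp)
    rw [List.mem_toFinset] at he
    obtain ⟨j, hj, hje⟩ := hS.cover e
    have hfeas : Feasible I (S j) := ⟨p, hp, fun e' he' => by
      rw [hje]; exact hmax e' (List.mem_toFinset.2 he')⟩
    have hij : i ≤ j := by
      by_contra! h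
      exact hlt j h hfeas
    exact (hS.mono i j hij hj).trans (hje ▸ cost_le_pathCost he)
  · obtain ⟨p, hp, hc⟩ := hi
    refine ⟨p, hp, (pathCost_le_mul hc).trans (mul_le_mul_of_nonneg_right ?_ ?_)⟩
    · exact_mod_cast (path_length_lt hp.1).le
    · exact Feasible.nonneg ⟨p, hp, hc⟩

theorem feasible_last {I : RSPInstance} {S : ℕ → ℝ} (hS : Sorted I S) {p : List (Fin I.m)}
    (hp : I.IsSolution p) : Feasible I (S (I.m - 1)) := by
  refine ⟨p, hp, fun e _ => ?_⟩
  obtain ⟨i, hi, hie⟩ := hS.cover e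
  rw [← hie]
  exact hS.mono i _ (by omega) (by omega)

/-- Binary search for the bottleneck cost, provided that there is a solution. -/
def bottleneck : Prog :=
  .setNat rlo (.const 0) ;;
  .setNat rhi (.sub (.reg rm) (.const 1)) ;;
  .loop (.natLt (.reg rlo) (.reg rhi))
    (.setNat rmid (.get ahalf (.add (.reg rlo) (.reg rhi))) ;;
     .setReal xunit (.get bsort (.reg rmid)) ;;
     layered ;;
     .ite (.realLt (.reg xR) (.get blab (.add (.reg rbase) (.reg rs))))
       (.setNat rlo (.add (.reg rmid) (.const 1)))
       (.setNat rhi (.reg rmid))) ;;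
  .setReal xunit (.get bsort (.reg rhi))

/-- The search takes `q` rounds if `m ≤ 2 ^ q`. -/
theorem wp_bottleneck (I : RSPInstance) (σ : Store) (hσ : Ready I σ) (L q : ℕ)
    (hL : I.n ≤ 2 ^ L) (hq : I.m ≤ 2 ^ q) (hS : Sorted I (σ.realArr bsort))
    (hmode : σ.nat rmode = 0) (hX : σ.nat rX = 0)
    (hfeas : Feasible I (σ.realArr bsort (I.m - 1))) :
    WP bottleneck σ (q * (layeredTime I.n I.m 0 0 L + 30) + 40) fun _ τ =>
      Bracket I (τ.real xunit) I.n := by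
  obtain ⟨G, hG⟩ : ∃ G, layeredTime I.n I.m 0 0 L = G := ⟨_, rfl⟩
  have hm : 0 < I.m := by
    obtain ⟨p, hp, -⟩ := hfeas
    obtain ⟨e, -⟩ := List.exists_mem_of_ne_nil p (solution_ne_nil hp)
    exact e.pos
  rw [hG]
  simp [bottleneck]
  -- the bottleneck is one of the costs `rlo, …, rhi`, and `q` rounds remain
  refine wp_loop (fun T τ => ∃ q, q * (G + 30) + 20 ≤ T ∧ τ.nat rlo ≤ τ.nat rhi ∧
    τ.nat rhi < I.m ∧ τ.nat rhi - τ.nat rlo < 2 ^ q ∧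
    Feasible I (σ.realArr bsort (τ.nat rhi)) ∧
    ∀ i < τ.nat rlo, ¬ Feasible I (σ.realArr bsort i)) ?_ ?_
  · simp only [setN_nat, hσ.m]
    refine ⟨q, by omega, by simp, by simp; omega, by simp; omega, by simpa using hfeas, by simp⟩
  rintro T τ hf ⟨q, hT, hle, hlt, hq, hhi, hlo⟩
  have h1 : Ready I τ := Ready.frame ((hσ.setN (by norm_num)).setN (by norm_num)) hf rfl
  have e1 : τ.nat rmode = 0 := by rw [hf.nat rmode rfl]; simpa using hmode
  have e2 : τ.nat rX = 0 := by rw [hf.nat rX rfl]; simpa using hX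
  have e3 : τ.realArr bsort = σ.realArr bsort := by rw [hf.realArr bsort rfl]; simp
  simp [e3]
  refine ⟨by omega, fun h => ?_, fun h => ⟨by omega, ?_⟩⟩
  swap
  · exact bracket_of_sorted hS hhi fun j hj => hlo j (by omega)
  obtain ⟨q, rfl⟩ : ∃ q', q = q' + 1 := by
    cases q with
    | zero => simp at hq; omega
    | succ q => exact ⟨q, rfl⟩
  rw [pow_succ] at hq
  obtain ⟨mid, hmid⟩ : ∃ mid, (τ.nat rlo + τ.nat rhi) / 2 = mid := ⟨_, rfl⟩
  rw [h1.half _ (by omega), hmid]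
  have hsplit : (q + 1) * (G + 30) = q * (G + 30) + G + 30 := by ring
  refine ⟨by omega, by omega, ?_⟩
  have h2 : Ready I ((τ.setN rmid mid).setR xunit (σ.realArr bsort mid)) :=
    (h1.setN (by norm_num)).setR (by norm_num)
  refine wp_call (wp_layered I _ h2 L 0 0 hL (by simpa using e1) (by simpa using e2))
    (by rw [hG]; omega) ?_
  rintro T3 τ3 hT3 hf3 ⟨w, hw, j, hr⟩
  rw [hG] at hT3
  have h3 := h2.frame hf3 rfl
  have hiff := success_iff_feasible hw hr
  simp only [setR_real, if_true] at hiff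
  have c1 : τ3.nat rmid = mid := by rw [hf3.nat rmid rfl]; simp
  have c2 : τ3.nat rlo = τ.nat rlo := by rw [hf3.nat rlo rfl]; simp
  have c3 : τ3.nat rhi = τ.nat rhi := by rw [hf3.nat rhi rfl]; simp
  have hnot : I.R < τ3.realArr blab (τ3.nat rbase + I.s) ↔ ¬ Feasible I (σ.realArr bsort mid) := by
    rw [← hiff, Success, not_le]
  simp only [h3.R, h3.s, c1, c2, c3, hnot]
  refine ⟨by omega, fun hno => ⟨by omega, q, by omega, by omega, hlt, by omega, hhi,
    fun i hi => ?_⟩, fun hyes => ⟨by omega, q, by omega, by omega, by omega, by omega,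
    hiff.1 hyes, hlo⟩⟩
  exact fun hf => hno (hf.mono (hS.mono i mid (by omega) (by omega)))

/-! ### Tests of the optimal cost -/

section Tests

variable {I : RSPInstance} {w : Fin I.m → ℕ} {X j : ℕ} {τ : Store} {δ : ℝ}

/-- With costs rounded down, success gives a bound on the optimal cost with an error of one unit per
edge. -/
theorem LayeredResult.exists_cost_le_of_mode_zero (hδ : 0 ≤ δ)
    (hw : ∀ e, ∃ k, IsRounding (I.cost e) δ X k ∧ w e = k + 0)
    (h : LayeredResult I w X 0 τ j) (hs : Success I τ) :
    ∃ p, I.IsSolution p ∧ I.pathCost p ≤ (X + I.n) * δ := by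
  obtain ⟨p, hp, hpw⟩ := h.exists_solution hs
  have hj := h.le
  refine ⟨p, hp, (cost_le_weight hw p (by omega) hδ).trans (mul_le_mul_of_nonneg_right ?_ hδ)⟩
  have := path_length_lt hp.1
  exact_mod_cast (by omega : (p.map w).sum + (1 - 0) * p.length ≤ X + I.n)

/-- With costs rounded down, failure gives a bound on the optimal cost without error. -/
theorem LayeredResult.lt_cost_of_mode_zero (hδ : 0 ≤ δ)
    (hw : ∀ e, ∃ k, IsRounding (I.cost e) δ X k ∧ w e = k + 0)
    (h : LayeredResult I w X 0 τ j) (hs : ¬ Success I τ) {p : List (Fin I.m)}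
    (hp : I.IsSolution p) : X * δ < I.pathCost p := by
  by_contra! hc
  have h1 := weight_le_of_cost_le hδ hw hc
  have h2 := h.lt_weight hs hp
  omega

/-- With costs rounded up, success gives a bound on the optimal cost without error. -/
theorem LayeredResult.exists_cost_le_of_mode_one (hδ : 0 ≤ δ)
    (hw : ∀ e, ∃ k, IsRounding (I.cost e) δ X k ∧ w e = k + 1)
    (h : LayeredResult I w X 1 τ j) (hs : Success I τ) :
    ∃ p, I.IsSolution p ∧ I.pathCost p ≤ X * δ := by
  obtain ⟨p, hp, hpw⟩ := h.exists_solution hs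
  have hj := h.le
  refine ⟨p, hp, (cost_le_weight hw p (by omega) hδ).trans (mul_le_mul_of_nonneg_right ?_ hδ)⟩
  exact_mod_cast (by omega : (p.map w).sum + (1 - 1) * p.length ≤ X)

/-- With costs rounded up, failure gives a bound on the optimal cost with an error of one unit per
edge. -/
theorem LayeredResult.lt_cost_of_mode_one (hδ : 0 ≤ δ)
    (hw : ∀ e, ∃ k, IsRounding (I.cost e) δ X k ∧ w e = k + 1)
    (h : LayeredResult I w X 1 τ j) (hs : ¬ Success I τ) {Y : ℕ} (hY : Y + I.n ≤ X)
    {p : List (Fin I.m)} (hp : I.IsSolution p) : Y * δ < I.pathCost p := by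
  by_contra! hc
  have h1 := weight_le_of_cost_le hδ hw hc
  have h2 := h.lt_weight hs hp
  have h3 := path_length_lt hp.1
  omega

end Tests

/-! ### Narrowing the bracket to a polylogarithmic factor -/

/-- Compute `l = ⌈log n⌉`, `l ^ 2` and `n / l ^ 2 + 1`. -/
def computeSizes : Prog :=
  .setNat rlog (.const 0) ;;
  .setNat rpow (.const 1) ;;
  .loop (.natLt (.reg rpow) (.reg rn))
    (.setNat rpow (.add (.reg rpow) (.reg rpow)) ;;
     .setNat rlog (.add (.reg rlog) (.const 1))) ;;
  .setNat racc (.const 0) ;;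
  .setNat rk (.const 0) ;;
  .loop (.natLt (.reg rk) (.reg rlog))
    (.setNat racc (.add (.reg racc) (.reg rlog)) ;;
     .setNat rk (.add (.reg rk) (.const 1))) ;;
  .setNat rX (.const 0) ;;
  .setNat rk (.const 0) ;;
  .loop (.natLt (.reg rk) (.add (.reg rn) (.const 1)))
    (.setNat rk (.add (.reg rk) (.reg racc)) ;;
     .setNat rX (.add (.reg rX) (.const 1)))

theorem wp_computeSizes (σ : Store) (n l : ℕ) (hn : σ.nat rn = n) (hn2 : 2 ≤ n)
    (hl : Nat.clog 2 n = l) :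
    WP computeSizes σ (60 * l + 30 * (n / (l * l) + 1) + 100) fun _ τ =>
      τ.nat racc = l * l ∧ τ.nat rX = n / (l * l) + 1 := by
  have hl0 : 0 < l := by rw [← hl]; exact Nat.clog_pos (by norm_num) hn2
  have hll : 0 < l * l := Nat.mul_pos hl0 hl0
  obtain ⟨X, hX⟩ : ∃ X, n / (l * l) = X := ⟨_, rfl⟩
  rw [hX]
  simp [computeSizes]
  refine wp_loop (fun T τ => 30 * (l - τ.nat rlog) + 30 * l + 30 * (X + 1) + 80 ≤ T ∧
    τ.nat rpow = 2 ^ τ.nat rlog ∧ τ.nat rlog ≤ l) ⟨by simp; omega, by simp, by simp⟩ ?_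
  rintro T τ hf ⟨hT, hpow, hle⟩
  have e1 : τ.nat rn = n := by rw [hf.nat rn rfl]; simpa using hn
  simp [e1]
  refine ⟨by omega, fun h => ?_, fun h => ?_⟩
  · have hlt : τ.nat rlog < l := by
      rw [← hl, Nat.lt_clog_iff_pow_lt (by norm_num)]
      omega
    refine ⟨by omega, by omega, by omega, by rw [hpow, pow_succ]; omega, by omega⟩
  have hlog : τ.nat rlog = l := by
    refine le_antisymm hle ?_
    rw [← hl]
    exact Nat.clog_le_of_le_pow (by omega)
  refine ⟨by omega, by omega, ?_⟩
  refine wp_loop (fun T ρ => 30 * (l - ρ.nat rk) + 30 * (X + 1) + 60 ≤ T ∧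
    ρ.nat racc = ρ.nat rk * l ∧ ρ.nat rk ≤ l) ⟨by simp; omega, by simp, by simp⟩ ?_
  rintro T1 ρ hf1 ⟨hT1, hacc, hk⟩
  have e2 : ρ.nat rlog = l := by rw [hf1.nat rlog rfl]; simpa using hlog
  have e3 : ρ.nat rn = n := by rw [hf1.nat rn rfl]; simpa using e1
  simp [e2]
  refine ⟨by omega, fun h => ⟨by omega, by omega, by omega, by rw [hacc]; ring, by omega⟩,
    fun h => ⟨by omega, by omega, ?_⟩⟩
  obtain hk : ρ.nat rk = l := by omega
  rw [hk] at hacc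
  refine wp_loop (fun T π => 30 * (X + 1 - π.nat rX) + 30 ≤ T ∧
    π.nat rk = π.nat rX * (l * l) ∧ π.nat rX ≤ X + 1) ⟨by simp; omega, by simp, by simp⟩ ?_
  rintro T2 π hf2 ⟨hT2, hk2, hX2⟩
  have e4 : π.nat racc = l * l := by rw [hf2.nat racc rfl]; simpa using hacc
  have e5 : π.nat rn = n := by rw [hf2.nat rn rfl]; simpa using e3
  simp [e4, e5]
  refine ⟨by omega, fun h => ?_, fun h => ?_⟩
  · have : π.nat rX ≤ X := by
      rw [← hX, Nat.le_div_iff_mul_le hll]; omega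
    refine ⟨by omega, by omega, by omega, by rw [hk2]; ring, by omega⟩
  · have : X < π.nat rX := by
      rw [← hX, Nat.div_lt_iff_lt_mul hll]; omega
    omega

/-- Starting from a lower bound for the optimal cost in `xunit`, double it until the dynamic
program with Dijkstra's algorithm and `n / l ^ 2 + 1` layers succeeds. -/
def narrow : Prog :=
  computeSizes ;;
  .setNat rmode (.const 0) ;;
  .setReal xunit (.div (.reg xunit) (.ofNat (.reg rX))) ;;
  layered ;;
  .loop (.realLt (.reg xR) (.get blab (.add (.reg rbase) (.reg rs))))
    (.setReal xunit (.add (.reg xunit) (.reg xunit)) ;;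
     layered) ;;
  .setReal xlow (.div (.mul (.reg xunit) (.ofNat (.reg rX))) (.ofNat (.const 2)))

/-- As `n` is at most `2 ^ l`, the unit is doubled at most `l` times. When the test succeeds, the
optimal cost is at most `(X + n) * δ`, and it is at least `X * δ / 2` by the failure with half the
unit, or by the initial bound. The quotient is `2 * (1 + n / X)`, and `n ≤ l ^ 2 * X`. -/
theorem wp_narrow (I : RSPInstance) (σ : Store) (hσ : Ready I σ) (l X : ℕ) (hn2 : 2 ≤ I.n)
    (hl : Nat.clog 2 I.n = l) (hX : I.n / (l * l) + 1 = X)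
    (hB : Bracket I (σ.real xunit) I.n) :
    WP narrow σ (60 * l + 30 * X + 200 + (l + 1) * (layeredTime I.n I.m X 0 l + 30)) fun _ τ =>
      τ.nat racc = l * l ∧ Bracket I (τ.real xlow) (2 * (1 + l * l)) := by
  obtain ⟨G, hG⟩ : ∃ G, layeredTime I.n I.m X 0 l = G := ⟨_, rfl⟩
  have hL : I.n ≤ 2 ^ l := by rw [← hl]; exact Nat.le_pow_clog (by norm_num) _
  have hX0 : (0 : ℝ) < X := by exact_mod_cast (hX ▸ Nat.succ_pos _ : 0 < X)
  have hl0 : 0 < l := by rw [← hl]; exact Nat.clog_pos (by norm_num) hn2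
  have hnX : (I.n : ℝ) ≤ l * l * X := by
    have : I.n < l * l * X := by rw [← hX]; exact Nat.lt_mul_div_succ _ (Nat.mul_pos hl0 hl0)
    exact_mod_cast this.le
  obtain ⟨B, hBσ⟩ : ∃ B, σ.real xunit = B := ⟨_, rfl⟩
  rw [hBσ] at hB
  obtain ⟨p0, hp0, hc0⟩ := hB.exists_le
  have hsplit0 : (l + 1) * (G + 30) = l * (G + 30) + G + 30 := by ring
  rw [hG, hsplit0]
  simp only [narrow, wp_seq_iff]
  refine wp_call (B := 60 * l + 30 * X + 100) (by
    rw [← hX]; exact wp_computeSizes σ I.n l hσ.n hn2 hl) (by omega) ?_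
  rintro T1 τ1 hT1 hf1 ⟨hacc1, hX1⟩
  have h1 := hσ.frame hf1 rfl
  rw [hX] at hX1
  have e1 : τ1.real xunit = B := by rw [hf1.real xunit rfl, hBσ]
  simp [e1, hX1]
  refine ⟨by omega, by omega, ?_⟩
  have h2 : Ready I ((τ1.setN rmode 0).setR xunit (B / X)) :=
    (h1.setN (by norm_num)).setR (by norm_num)
  refine wp_call (wp_layered I _ h2 l 0 X hL (by simp) (by simpa using hX1))
    (by rw [hG]; omega) ?_
  rintro T2 τ2 hT2 hf2 ⟨w2, hw2, j2, hr2⟩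
  rw [hG] at hT2
  simp only [setR_real, if_true] at hw2
  have h3 := h2.frame hf2 rfl
  have hX3 : τ2.nat rX = X := by rw [hf2.nat rX rfl]; simpa using hX1
  have hm3 : τ2.nat rmode = 0 := by rw [hf2.nat rmode rfl]; simp
  have hacc3 : τ2.nat racc = l * l := by rw [hf2.nat racc rfl]; simpa using hacc1
  have hu3 : τ2.real xunit = B / X := by rw [hf2.real xunit rfl]; simp
  -- after `i` doublings; the invariant is made opaque so that `simp` does not take it apart
  obtain ⟨Inv, hInv⟩ : ∃ Inv : ℕ → Store → Prop, ∀ T ρ, Inv T ρ ↔ ∃ (i : ℕ) (δ : ℝ),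
      ρ.real xunit = δ ∧ δ = 2 ^ i * (B / X) ∧ (l - i) * (G + 30) + 30 ≤ T ∧
      (∀ p, I.IsSolution p → X * δ / 2 ≤ I.pathCost p) ∧
      (Success I ρ → ∃ p, I.IsSolution p ∧ I.pathCost p ≤ (X + I.n) * δ) ∧
      (¬ Success I ρ → ∀ p, I.IsSolution p → X * δ < I.pathCost p) := ⟨_, fun _ _ => Iff.rfl⟩
  have hBX : 0 ≤ B / X := div_nonneg hB.nonneg hX0.le
  refine wp_loop Inv ((hInv _ _).2 ⟨0, B / X, hu3, by simp, by rw [Nat.sub_zero]; omega,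
    fun p hp => ?_, hr2.exists_cost_le_of_mode_zero hBX hw2,
    fun hs p hp => hr2.lt_cost_of_mode_zero hBX hw2 hs hp⟩) ?_
  · rw [mul_div_cancel₀ _ hX0.ne']
    linarith [hB.le p hp, hB.nonneg]
  intro T ρ hf hI
  obtain ⟨i, δ, hδ, hδi, hT, hlow, hyes, hno⟩ := (hInv _ _).1 hI
  have h4 := h3.frame hf rfl
  have b1 : ρ.nat rX = X := (hf.nat rX rfl).trans hX3
  have b2 : ρ.nat rmode = 0 := (hf.nat rmode rfl).trans hm3
  have b3 : ρ.nat racc = l * l := (hf.nat racc rfl).trans hacc3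
  have hδ0 : 0 ≤ δ := by rw [hδi]; positivity
  simp [h4.R, h4.s, hδ, b1, b3]
  refine ⟨by omega, fun hR => ?_, fun hR => ⟨by omega, ?_, fun p hp => ?_, ?_⟩⟩
  · have hns : ¬ Success I ρ := not_le.2 hR
    have hil : i < l := by
      by_contra! h
      have h5 := hno hns p0 hp0
      have h6 : X * δ = 2 ^ i * B := by rw [hδi]; field_simp
      have h7 : (I.n : ℝ) ≤ 2 ^ i := by
        exact_mod_cast hL.trans (Nat.pow_le_pow_right (by norm_num) h)
      have h8 := mul_le_mul_of_nonneg_right h7 hB.nonneg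
      linarith
    have hsplit : (l - i) * (G + 30) = (l - (i + 1)) * (G + 30) + G + 30 := by
      rw [show l - i = l - (i + 1) + 1 by omega]; ring
    refine ⟨by omega, ?_⟩
    have h5 : Ready I (ρ.setR xunit (δ + δ)) := h4.setR (by norm_num)
    refine wp_call (wp_layered I _ h5 l 0 X hL (by simpa using b2) (by simpa using b1))
      (by rw [hG]; omega) ?_
    rintro T5 τ5 hT5 hf5 ⟨w5, hw5, j5, hr5⟩
    rw [hG] at hT5
    simp only [setR_real, if_true] at hw5
    refine (hInv _ _).2 ⟨i + 1, δ + δ, by rw [hf5.real xunit rfl]; simp, ?_, by omega,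
      fun p hp => ?_, hr5.exists_cost_le_of_mode_zero (by linarith) hw5,
      fun hs p hp => hr5.lt_cost_of_mode_zero (by linarith) hw5 hs hp⟩
    · rw [hδi, pow_succ]; ring
    · have := hno hns p hp
      linarith
  · positivity
  · have := hlow p hp
    linarith
  · obtain ⟨p, hp, hc⟩ := hyes hR
    refine ⟨p, hp, hc.trans ?_⟩
    have := mul_le_mul_of_nonneg_right hnX hδ0
    linarith

/-! ### Narrowing the bracket to a constant factor -/

/-- Given that the optimal cost lies between `xlow` and `2 * (1 + racc) * xlow`, narrow this down
to a factor `4`, by binary search for the exponent `rexp` of the factor. -/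
def tighten : Prog :=
  .setNat rexp (.const 0) ;;
  .setNat rpow (.const 1) ;;
  .loop (.natLt (.reg rpow) (.add (.add (.reg racc) (.reg racc)) (.const 2)))
    (.setNat rpow (.add (.reg rpow) (.reg rpow)) ;;
     .setNat rexp (.add (.reg rexp) (.const 1))) ;;
  .setNat rX (.add (.reg rn) (.reg rn)) ;;
  .setNat rmode (.reg rn) ;;
  .loop (.natLt (.const 2) (.reg rexp))
    (.setNat rhalf (.const 0) ;;
     .setReal xpow (.ofNat (.const 1)) ;;
     .loop (.natLt (.add (.add (.reg rhalf) (.reg rhalf)) (.const 1)) (.reg rexp))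
       (.setNat rhalf (.add (.reg rhalf) (.const 1)) ;;
        .setReal xpow (.add (.reg xpow) (.reg xpow))) ;;
     .setReal xunit (.div (.mul (.reg xlow) (.reg xpow)) (.ofNat (.reg rn))) ;;
     layered ;;
     .ite (.realLt (.reg xR) (.get blab (.add (.reg rbase) (.reg rs))))
       (.setReal xlow (.mul (.reg xlow) (.reg xpow)) ;;
        .setNat rexp (.sub (.reg rexp) (.reg rhalf)))
       (.setNat rexp (.add (.reg rhalf) (.const 1))))

/-- The optimal cost lies between `y = xlow` and `2 ^ x * y`, where `x = rexp`. With `b = ⌊x / 2⌋`,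
a test with unit `2 ^ b * y / n` and weights up to `2 * n` shows that it is at most
`2 ^ (b + 1) * y` or at least `2 ^ b * y`. Either way the excess of `x` over `2` is halved, so there
are `q` rounds if initially `x ≤ 2 ^ q`. -/
theorem wp_tighten (I : RSPInstance) (σ : Store) (hσ : Ready I σ) (l A a q : ℕ)
    (hL : I.n ≤ 2 ^ l) (hA : σ.nat racc = A) (ha : Nat.clog 2 (2 * A + 2) = a) (hq : a ≤ 2 ^ q)
    (hB : Bracket I (σ.real xlow) (2 * (1 + A))) :
    WP tighten σ (30 * a + 60 + q * (layeredTime I.n I.m (2 * I.n) 1 l + 30 * a + 70))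
      fun _ τ => Bracket I (τ.real xlow) 4 := by
  obtain ⟨G, hG⟩ : ∃ G, layeredTime I.n I.m (2 * I.n) 1 l = G := ⟨_, rfl⟩
  have hn := RSPInstance.n_pos I
  rw [hG]
  simp [tighten]
  refine ⟨by omega, by omega, ?_⟩
  refine wp_loop (fun T τ => 30 * (a - τ.nat rexp) + 40 + q * (G + 30 * a + 70) ≤ T ∧
    τ.nat rpow = 2 ^ τ.nat rexp ∧ τ.nat rexp ≤ a) ⟨by simp; omega, by simp, by simp⟩ ?_
  rintro T τ hf ⟨hT, hpow, hle⟩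
  have h1 : Ready I τ := Ready.frame ((hσ.setN (by norm_num)).setN (by norm_num)) hf rfl
  have e1 : τ.nat racc = A := by rw [hf.nat racc rfl]; simpa using hA
  have e2 : τ.real xlow = σ.real xlow := by rw [hf.real xlow rfl]; simp
  simp [e1, h1.n]
  refine ⟨by omega, fun h => ?_, fun h => ?_⟩
  · have hlt : τ.nat rexp < a := by
      rw [← ha, Nat.lt_clog_iff_pow_lt (by norm_num)]
      omega
    refine ⟨by omega, by omega, by omega, by rw [hpow, pow_succ]; omega, by omega⟩
  refine ⟨by omega, by omega, ?_⟩
  -- `q` rounds remain; the invariant is made opaque so that `simp` does not take it apart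
  obtain ⟨Inv, hInv⟩ : ∃ Inv : ℕ → Store → Prop, ∀ T ρ, Inv T ρ ↔ ∃ q,
      q * (G + 30 * a + 70) + 10 ≤ T ∧ ρ.nat rexp ≤ a ∧ ρ.nat rexp - 2 < 2 ^ q ∧
      Bracket I (ρ.real xlow) (2 ^ ρ.nat rexp) := ⟨_, fun _ _ => Iff.rfl⟩
  refine wp_loop Inv ((hInv _ _).2 ⟨q, by omega, by simpa using hle, ?_, ?_⟩) ?_
  · have := Nat.one_le_two_pow (n := q)
    simp; omega
  · simp only [setN_real, setN_nat, Nat.reduceEqDiff, if_false, e2]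
    refine hB.mono ?_
    have : (2 * (1 + A) : ℕ) ≤ 2 ^ τ.nat rexp := by omega
    exact_mod_cast this
  intro T1 ρ hf1 hI
  obtain ⟨q, hT1, hle1, hlt1, hB1⟩ := (hInv _ _).1 hI
  have h2 : Ready I ρ := Ready.frame ((h1.setN (by norm_num)).setN (by norm_num)) hf1 rfl
  have b1 : ρ.nat rX = 2 * I.n := by rw [hf1.nat rX rfl]; simp [two_mul]
  have b2 : ρ.nat rmode = I.n := by rw [hf1.nat rmode rfl]; simp
  simp
  refine ⟨by omega, fun h2 => ?_, fun h2 => ?_⟩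
  swap
  · refine hB1.mono ?_
    have : (2 ^ ρ.nat rexp : ℕ) ≤ 2 ^ 2 := Nat.pow_le_pow_right (by norm_num) h2
    exact_mod_cast this
  obtain ⟨q, rfl⟩ : ∃ q', q = q' + 1 := by
    cases q with
    | zero => simp at hlt1; omega
    | succ q => exact ⟨q, rfl⟩
  obtain ⟨x, hx⟩ : ∃ x, ρ.nat rexp = x := ⟨_, rfl⟩
  obtain ⟨y, hy⟩ : ∃ y, ρ.real xlow = y := ⟨_, rfl⟩
  rw [hx] at hle1 hlt1 hB1 h2
  rw [hy] at hB1
  rw [pow_succ] at hlt1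
  have hsplit : (q + 1) * (G + 30 * a + 70) = q * (G + 30 * a + 70) + G + 30 * a + 70 := by ring
  refine ⟨by omega, by omega, ?_⟩
  refine wp_loop (fun T π => 30 * (x / 2 - π.nat rhalf) + q * (G + 30 * a + 70) + G + 60 ≤ T ∧
    π.nat rhalf ≤ x / 2 ∧ π.real xpow = 2 ^ π.nat rhalf) ⟨by simp; omega, by simp, by simp⟩ ?_
  rintro T2 π hf2 ⟨hT2, hle2, hpow2⟩
  have h3 : Ready I π := Ready.frame (((‹Ready I ρ›).setN (by norm_num)).setR (by norm_num)) hf2 rfl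
  have c1 : π.nat rX = 2 * I.n := by rw [hf2.nat rX rfl]; simpa using b1
  have c2 : π.nat rmode = I.n := by rw [hf2.nat rmode rfl]; simpa using b2
  have c3 : π.nat rexp = x := by rw [hf2.nat rexp rfl]; simpa using hx
  have c4 : π.real xlow = y := by rw [hf2.real xlow rfl]; simpa using hy
  simp [c3, c4, h3.n]
  refine ⟨by omega, fun h => ⟨by omega, by omega, by omega, by omega, by
    rw [hpow2, pow_succ]; ring⟩, fun h => ?_⟩
  have hhalf : π.nat rhalf = x / 2 := by omega
  rw [hhalf] at hpow2
  refine ⟨by omega, ?_⟩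
  rw [hpow2]
  obtain ⟨δ, hδ⟩ : ∃ δ, y * 2 ^ (x / 2) / (I.n : ℝ) = δ := ⟨_, rfl⟩
  have hn' : (0 : ℝ) < I.n := by exact_mod_cast hn
  have hδ0 : 0 ≤ δ := by rw [← hδ]; have := hB1.nonneg; positivity
  have hδn : I.n * δ = y * 2 ^ (x / 2) := by rw [← hδ]; field_simp
  rw [hδ]
  have h4 : Ready I (π.setR xunit δ) := h3.setR (by norm_num)
  refine wp_call (wp_layered I _ h4 l 1 (2 * I.n) hL (by simpa using c2) (by simpa using c1))
    (by rw [hG]; omega) ?_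
  rintro T5 τ5 hT5 hf5 ⟨w, hw, j, hr⟩
  rw [hG] at hT5
  simp only [setR_real, if_true] at hw
  have h5 := h4.frame hf5 rfl
  have d1 : τ5.nat rhalf = x / 2 := by rw [hf5.nat rhalf rfl]; simpa using hhalf
  have d2 : τ5.nat rexp = x := by rw [hf5.nat rexp rfl]; simpa using c3
  have d3 : τ5.real xlow = y := by rw [hf5.real xlow rfl]; simpa using c4
  have d4 : τ5.real xpow = 2 ^ (x / 2) := by rw [hf5.real xpow rfl]; simpa using hpow2
  simp only [h5.R, h5.s, d1, d2, d3, d4]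
  refine ⟨by omega, fun hR => ⟨by omega, by omega, (hInv _ _).2 ⟨q, by omega, by simp; omega,
    by simp; omega, ?_⟩⟩, fun hR => ⟨by omega, (hInv _ _).2 ⟨q, by omega, by simp; omega,
    by simp; omega, ?_⟩⟩⟩
  · simp only [setN_real, setR_real, setN_nat, if_true]
    refine ⟨by have := hB1.nonneg; positivity, fun p hp => ?_, ?_⟩
    · rw [← hδn]
      exact (hr.lt_cost_of_mode_one hδ0 hw (not_le.2 hR) (by omega) hp).le
    · obtain ⟨p, hp, hc⟩ := hB1.exists_le
      refine ⟨p, hp, hc.trans (le_of_eq ?_)⟩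
      conv_lhs => rw [show x = x - x / 2 + x / 2 by omega, pow_add]
      ring
  · simp only [setN_real, setN_nat, if_true, d3]
    obtain ⟨p, hp, hc⟩ := hr.exists_cost_le_of_mode_one hδ0 hw hR
    refine ⟨hB1.nonneg, hB1.le, p, hp, hc.trans (le_of_eq ?_)⟩
    push_cast
    rw [mul_assoc, hδn, pow_succ]
    ring

/-! ### The approximation scheme -/

/-- Given a lower bound `xlow` for the optimal cost that is correct up to a factor `4`, find an
approximate solution: with the unit `ε * xlow / n`, the optimal cost is at most `⌈4 * n / ε⌉` units,
and rounding up adds at most `n`. -/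
def finish : Prog :=
  .setNat rX (.reg rn) ;;
  .setNat rk (.const 0) ;;
  .loop (.realLt (.mul (.ofNat (.reg rk)) (.reg xeps))
      (.mul (.ofNat (.const 4)) (.ofNat (.reg rn))))
    (.setNat rk (.add (.reg rk) (.const 1)) ;;
     .setNat rX (.add (.reg rX) (.const 1))) ;;
  .setNat rmode (.reg rn) ;;
  .setReal xunit (.div (.mul (.reg xeps) (.reg xlow)) (.ofNat (.reg rn))) ;;
  layered ;;
  backtrack ;;
  .setNat rm (.reg rlen) ;;
  .setNat rn (.const 1)

theorem wp_finish (I : RSPInstance) (σ : Store) (hσ : Ready I σ) (ε : ℝ) (hε : 0 < ε)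
    (hεσ : σ.real xeps = ε) (l Y : ℕ) (hL : I.n ≤ 2 ^ l) (hY : ⌈4 * (I.n : ℝ) / ε⌉₊ = Y)
    (hB : Bracket I (σ.real xlow) 4) :
    WP finish σ (100 * Y + 60 * I.n + 200 + layeredTime I.n I.m (I.n + Y) 1 l)
      fun _ τ => Answers I ε τ := by
  obtain ⟨G, hG⟩ : ∃ G, layeredTime I.n I.m (I.n + Y) 1 l = G := ⟨_, rfl⟩
  obtain ⟨y, hy⟩ : ∃ y, σ.real xlow = y := ⟨_, rfl⟩
  rw [hy] at hB
  have hn := RSPInstance.n_pos I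
  have hn' : (0 : ℝ) < I.n := by exact_mod_cast hn
  rw [hG]
  simp [finish]
  refine ⟨by omega, by omega, ?_⟩
  refine wp_loop (fun T τ => 40 * (Y - τ.nat rk) + 60 * Y + 60 * I.n + 170 + G ≤ T ∧
    τ.nat rX = I.n + τ.nat rk ∧ τ.nat rk ≤ Y) ⟨by simp; omega, by simp [hσ.n], by simp⟩ ?_
  rintro T τ hf ⟨hT, hXk, hle⟩
  have h1 : Ready I τ := Ready.frame ((hσ.setN (by norm_num)).setN (by norm_num)) hf rfl
  have e1 : τ.real xeps = ε := by rw [hf.real xeps rfl]; simpa using hεσ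
  have e2 : τ.real xlow = y := by rw [hf.real xlow rfl]; simpa using hy
  simp [e1, e2, h1.n]
  refine ⟨by omega, fun h => ?_, fun h => ?_⟩
  · have hlt : τ.nat rk < Y := by
      rw [← hY, Nat.lt_ceil, lt_div_iff₀ hε]
      exact h
    exact ⟨by omega, by omega, by omega, by omega, by omega⟩
  have hkY : τ.nat rk = Y := by
    refine le_antisymm hle ?_
    rw [← hY, Nat.ceil_le, div_le_iff₀ hε]
    exact h
  rw [hkY] at hXk h
  refine ⟨by omega, by omega, ?_⟩
  obtain ⟨δ, hδ⟩ : ∃ δ, ε * y / (I.n : ℝ) = δ := ⟨_, rfl⟩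
  have hδ0 : 0 ≤ δ := by rw [← hδ]; have := hB.nonneg; positivity
  have hδn : I.n * δ = ε * y := by rw [← hδ]; field_simp
  rw [hδ]
  have h2 : Ready I ((τ.setN rmode I.n).setR xunit δ) :=
    (h1.setN (by norm_num)).setR (by norm_num)
  refine wp_call (wp_layered I _ h2 l 1 (I.n + Y) hL (by simp) (by simpa using hXk))
    (by rw [hG]; omega) ?_
  rintro T2 τ2 hT2 hf2 ⟨w, hw, j, hr⟩
  rw [hG] at hT2
  simp only [setR_real, if_true] at hw
  have h3 := h2.frame hf2 rfl
  obtain ⟨p0, hp0, -⟩ := hB.exists_le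
  obtain ⟨c, hc⟩ := exists_isOptCost hp0
  obtain ⟨p, hp, hpc⟩ := hc.1
  have hcy : c ≤ 4 * y := by
    obtain ⟨p1, hp1, hc1⟩ := hB.exists_le
    exact (hc.2 ⟨p1, hp1, rfl⟩).trans hc1
  have hyc : y ≤ c := hpc ▸ hB.le p hp
  have hlen := path_length_lt hp.1
  have hs : Success I τ2 := by
    by_contra hs
    have h4 := hr.lt_cost_of_mode_one hδ0 hw hs (Y := Y) (by omega) hp
    have h5 : (4 : ℝ) * y ≤ Y * δ := by
      rw [← hδ, ← mul_div_assoc, le_div_iff₀ hn']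
      nlinarith [hB.nonneg]
    linarith
  have hj := hr.le
  refine wp_call (wp_backtrack I τ2 h3.toHoldsInput w _ 1 j one_ne_zero hr hs) (by omega) ?_
  rintro T3 τ3 hT3 hf3 ⟨p', hp', hpw, hlen', hout⟩
  refine ⟨by omega, by omega, Or.inl ⟨by simp, p', ⟨hp', c, hc, ?_⟩, ?_⟩⟩
  · -- the weight of `p'` is at most that of the optimal path `p`
    obtain ⟨K, hK1, -, hK2⟩ := sum_rounding_le hw p
    have h6 := hr.le_weight hp
    have h7 : ((p'.map w).sum : ℝ) ≤ K + I.n := by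
      exact_mod_cast (by omega : (p'.map w).sum ≤ K + I.n)
    have h8 := cost_le_weight hw p' (by omega) hδ0
    simp only [Nat.sub_self, zero_mul, Nat.add_zero] at h8
    have h9 := mul_le_mul_of_nonneg_right h7 hδ0
    have h10 : ε * y ≤ ε * c := mul_le_mul_of_nonneg_left hyc hε.le
    rw [hpc] at hK2
    linarith
  · simp only [outputList]
    rw [show ((τ3.setN rm (τ3.nat rlen)).setN rn 1).nat 1 = p'.length by simp [hlen']]
    -- `Answers` coerces the path to a list of numbers, which `simp` writes as a `flatMap`
    have hmap (r : List (Fin I.m)) : List.flatMap (fun a : Fin I.m => [(a : ℕ)]) r =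
        r.map Fin.val := List.map_eq_flatMap.symm
    simpa [hmap, Function.comp_def] using hout

/-- The approximation scheme. The first run of `layered`, with the greatest cost as unit and weight
`0` for all edges, decides whether there is a solution. -/
def scheme : Prog :=
  prepare ;;
  .setNat rmode (.const 0) ;;
  .setNat rX (.const 0) ;;
  .setReal xunit (.get bsort (.sub (.reg rm) (.const 1))) ;;
  layered ;;
  .ite (.realLt (.reg xR) (.get blab (.add (.reg rbase) (.reg rs))))
    (.setNat rn (.const 0))
    (bottleneck ;; narrow ;; tighten ;; finish)

/-- A weakly connected graph on `n` nodes has at least `n - 1` edges. -/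
theorem RSPInstance.n_le (I : RSPInstance) : I.n ≤ I.m + 1 := by
  classical
  have h1 := I.weaklyConnected.card_vert_le_card_edgeSet_add_one
  rw [Nat.card_eq_fintype_card, Fintype.card_fin] at h1
  refine h1.trans (Nat.add_le_add_right ?_ 1)
  have hsub : (SimpleGraph.fromRel fun u v => ∃ e, I.src e = u ∧ I.dst e = v).edgeSet ⊆
      Set.range fun e => s(I.src e, I.dst e) := by
    intro x
    induction x with
    | h u v =>
      rw [SimpleGraph.mem_edgeSet, SimpleGraph.fromRel_adj]
      rintro ⟨-, ⟨e, rfl, rfl⟩ | ⟨e, rfl, rfl⟩⟩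
      · exact ⟨e, rfl⟩
      · exact ⟨e, Sym2.eq_swap⟩
  calc _ ≤ Nat.card (Set.range fun e => s(I.src e, I.dst e)) :=
        Nat.card_mono (Set.finite_range _) hsub
    _ ≤ Nat.card (Fin I.m) := Finite.card_range_le _
    _ = I.m := by simp

theorem RSPInstance.two_le_n (I : RSPInstance) : 2 ≤ I.n := by
  have h1 := I.s.2
  have h2 := I.t.2
  have h3 : (I.s : ℕ) ≠ I.t := fun h => I.s_ne_t (Fin.ext h)
  omega

theorem RSPInstance.m_le (I : RSPInstance) : I.m ≤ I.n * I.n := by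
  simpa using Fintype.card_le_of_injective _ I.edge_injective

theorem holdsInput_input (I : RSPInstance) (ε : ℝ) : HoldsInput I (input I ε) := by
  refine ⟨rfl, rfl, rfl, rfl, rfl, ?_, ?_, ?_, ?_⟩ <;> simp [input, table]

/-- The running time of the scheme, in terms of the logarithm `l` of `n`, the number `q` of rounds
of `tighten` and the number `Y` of layers due to the optimal cost in the last run. -/
def schemeTime (n m l X a q Y : ℕ) : ℕ :=
  (30 * (n + m) + m * (60 * (2 * l) + 300) + n * (40 * m + 40) + 240) + layeredTime n m 0 0 l +
  (2 * l * (layeredTime n m 0 0 l + 30) + 40) +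
  (60 * l + 30 * X + 200 + (l + 1) * (layeredTime n m X 0 l + 30)) +
  (30 * a + 60 + q * (layeredTime n m (2 * n) 1 l + 30 * a + 70)) +
  (100 * Y + 60 * n + 200 + layeredTime n m (n + Y) 1 l)

theorem wp_scheme (I : RSPInstance) (ε : ℝ) (hε : 0 < ε) (l X a q Y : ℕ)
    (hl : Nat.clog 2 I.n = l) (hX : I.n / (l * l) + 1 = X)
    (ha : Nat.clog 2 (2 * (l * l) + 2) = a) (hq : Nat.clog 2 a = q)
    (hY : ⌈4 * (I.n : ℝ) / ε⌉₊ = Y) :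
    WP scheme (input I ε) (schemeTime I.n I.m l X a q Y) fun _ τ => Answers I ε τ := by
  have hn2 := RSPInstance.two_le_n I
  have hm : 1 ≤ I.m := by have := RSPInstance.n_le I; omega
  have hL : I.n ≤ 2 ^ l := by rw [← hl]; exact Nat.le_pow_clog (by norm_num) _
  have hL2 : I.m ≤ 2 ^ (2 * l) := by
    rw [two_mul, pow_add]; exact (RSPInstance.m_le I).trans (Nat.mul_le_mul hL hL)
  have h0 := holdsInput_input I ε
  unfold schemeTime
  -- the time bounds of the parts are made opaque, as only their sum matters
  obtain ⟨tp, htp⟩ : ∃ t, 30 * (I.n + I.m) + I.m * (60 * (2 * l) + 300) +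
    I.n * (40 * I.m + 40) + 200 = t := ⟨_, rfl⟩
  obtain ⟨t0, ht0⟩ : ∃ t, layeredTime I.n I.m 0 0 l = t := ⟨_, rfl⟩
  obtain ⟨t1, ht1⟩ : ∃ t, 2 * l * (t0 + 30) + 40 = t := ⟨_, rfl⟩
  obtain ⟨t2, ht2⟩ : ∃ t, 60 * l + 30 * X + 200 +
    (l + 1) * (layeredTime I.n I.m X 0 l + 30) = t := ⟨_, rfl⟩
  obtain ⟨t3, ht3⟩ : ∃ t, 30 * a + 60 +
    q * (layeredTime I.n I.m (2 * I.n) 1 l + 30 * a + 70) = t := ⟨_, rfl⟩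
  obtain ⟨t4, ht4⟩ : ∃ t, 100 * Y + 60 * I.n + 200 +
    layeredTime I.n I.m (I.n + Y) 1 l = t := ⟨_, rfl⟩
  rw [ht0, ht1, ht2, ht3, ht4]
  simp only [scheme, wp_seq_iff]
  refine wp_call (B := tp) (by
    rw [← htp]; exact wp_prepare I _ h0 hm (2 * l) hL2 (fun _ => rfl)) (by omega) ?_
  rintro T1 τ1 hT1 hf1 ⟨h1, hS⟩
  have e1 : τ1.real xeps = ε := by rw [hf1.real xeps rfl]; rfl
  simp [h1.m]
  refine ⟨by omega, by omega, by omega, ?_⟩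
  obtain ⟨S, hS'⟩ : ∃ S, τ1.realArr bsort = S := ⟨_, rfl⟩
  rw [hS'] at hS ⊢
  have h2 : Ready I (((τ1.setN rmode 0).setN rX 0).setR xunit (S (I.m - 1))) :=
    ((h1.setN (by norm_num)).setN (by norm_num)).setR (by norm_num)
  refine wp_call (wp_layered I _ h2 l 0 0 hL (by simp) (by simp)) (by rw [ht0]; omega) ?_
  rintro T2 τ2 hT2 hf2 ⟨w, hw, j, hr⟩
  rw [ht0] at hT2
  have h3 := h2.frame hf2 rfl
  have hiff := success_iff_feasible hw hr
  simp only [setR_real, if_true] at hiff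
  simp [h3.R, h3.s]
  refine ⟨by omega, fun hR => ⟨by omega, ?_⟩, fun hR => ?_⟩
  · right
    refine ⟨by simp, ?_⟩
    rintro ⟨p, hp⟩
    exact absurd (hiff.2 (feasible_last hS hp)) (not_le.2 hR)
  have hfeas := hiff.1 hR
  have e2 : τ2.realArr bsort = S := by rw [hf2.realArr bsort rfl]; simpa using hS'
  refine wp_call (B := t1) (by
    rw [← ht1, ← ht0]
    exact wp_bottleneck I τ2 h3 l (2 * l) hL hL2 (by rwa [e2]) (by rw [hf2.nat rmode rfl]; simp)
      (by rw [hf2.nat rX rfl]; simp) (by rwa [e2])) (by omega) ?_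
  intro T3 τ3 hT3 hf3 hB3
  have h4 := h3.frame hf3 rfl
  refine wp_call (B := t2) (by
    rw [← ht2]; exact wp_narrow I τ3 h4 l X hn2 hl hX hB3) (by omega) ?_
  rintro T4 τ4 hT4 hf4 ⟨hacc, hB4⟩
  have h5 := h4.frame hf4 rfl
  refine wp_call (B := t3) (by
    rw [← ht3]
    exact wp_tighten I τ4 h5 l (l * l) a q hL hacc ha
      (by rw [← hq]; exact Nat.le_pow_clog (by norm_num) _) (by exact_mod_cast hB4)) (by omega) ?_
  intro T5 τ5 hT5 hf5 hB5
  have h6 := h5.frame hf5 rfl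
  refine wp_call (B := t4) (by
    rw [← ht4]
    refine wp_finish I τ5 h6 ε hε ?_ l Y hL hY hB5
    rw [hf5.real xeps rfl, hf4.real xeps rfl, hf3.real xeps rfl, hf2.real xeps rfl]
    simpa using e1) (by omega) ?_
  exact fun _ _ _ _ h => h

/-! ### The running time in closed form -/

theorem sq_le_eight_mul_two_pow (k : ℕ) : (k + 1) * (k + 1) ≤ 8 * 2 ^ k := by
  induction k using Nat.strong_induction_on with
  | _ k ih =>
    match k with
    | 0 => norm_num
    | 1 => norm_num
    | 2 => norm_num
    | k + 3 =>
      have h := ih (k + 2) (by omega)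
      rw [pow_succ]
      nlinarith

theorem clog_sq_le {n : ℕ} (hn : 2 ≤ n) : Nat.clog 2 n * Nat.clog 2 n ≤ 8 * n := by
  have h1 : 0 < Nat.clog 2 n := Nat.clog_pos (by norm_num) hn
  obtain ⟨k, hk⟩ : ∃ k, Nat.clog 2 n = k + 1 := ⟨_, (Nat.succ_pred h1.ne').symm⟩
  have h2 : 2 ^ k < n := by
    have := Nat.pow_pred_clog_lt_self (b := 2) (by norm_num) (x := n) (by omega)
    rwa [hk] at this
  rw [hk]
  have := sq_le_eight_mul_two_pow k
  omega

theorem clog_le_self (x : ℕ) : Nat.clog 2 x ≤ x :=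
  Nat.clog_le_of_le_pow Nat.lt_two_pow_self.le

theorem layeredTime_zero_le {n m l : ℕ} (X : ℕ) (hm : 1 ≤ m) (hnm : n ≤ 2 * m) (hl : 1 ≤ l) :
    layeredTime n m X 0 l ≤ 2000 * ((X + 1) * (m * l)) := by
  have h1 : m ≤ m * l := Nat.le_mul_of_pos_right _ hl
  have h2 : n * l ≤ 2 * (m * l) := by nlinarith
  have h3 : layerTime n m 0 l ≤ 1500 * (m * l) := by
    simp only [layerTime, if_true]
    nlinarith
  unfold layeredTime
  nlinarith [Nat.mul_le_mul_left (X + 1) h3, Nat.mul_le_mul_left (X + 1) h1]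

theorem layeredTime_one_le {n m : ℕ} (X l : ℕ) (hm : 1 ≤ m) (hnm : n ≤ 2 * m) :
    layeredTime n m X 1 l ≤ 1000 * ((X + 1) * m) := by
  have h3 : layerTime n m 1 l ≤ 500 * m := by
    simp only [layerTime, one_ne_zero, if_false]
    omega
  unfold layeredTime
  nlinarith [Nat.mul_le_mul_left (X + 1) h3]

/-- Besides `q` rounds of `O(n m)` and `Y` layers of `O(m)`, the scheme takes time `O(n m)`: with
`X` about `n / l ^ 2` and `l ^ 2 = O(n)`, the products `m l ^ 2` and `m l ^ 2 (X + 1)` are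
`O(n m)`. -/
theorem schemeTime_le {n m l X a : ℕ} (q Y : ℕ) (hn : 2 ≤ n) (hm : 1 ≤ m) (hnm : n ≤ 2 * m)
    (hl : Nat.clog 2 n = l) (hX : n / (l * l) + 1 = X) (ha : Nat.clog 2 (2 * (l * l) + 2) = a) :
    schemeTime n m l X a q Y ≤ 200000 * (n * m * (1 + q) + m * Y) := by
  have hl1 : 1 ≤ l := hl ▸ Nat.clog_pos (by norm_num) hn
  have hll : l * l ≤ 8 * n := hl ▸ clog_sq_le hn
  have hl2 : l ≤ l * l := Nat.le_mul_of_pos_right _ hl1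
  have ha' : a ≤ 2 * (l * l) + 2 := ha ▸ clog_le_self _
  have hX1 : X ≤ n + 1 := by have := Nat.div_le_self n (l * l); omega
  have hX2 : l * l * (X + 1) ≤ 17 * n := by
    have := Nat.mul_div_le n (l * l)
    rw [← hX]; nlinarith
  have hN1 : n ≤ n * m := Nat.le_mul_of_pos_right _ hm
  have hN2 : 2 * m ≤ n * m := Nat.mul_le_mul_right _ hn
  have hml : m * (l * l) ≤ 8 * (n * m) := by nlinarith
  have hml' : m * l ≤ 8 * (n * m) := (Nat.mul_le_mul_left m hl2).trans hml
  have hmX : m * (l * l * (X + 1)) ≤ 17 * (n * m) := by nlinarith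
  have t0 := layeredTime_zero_le 0 hm hnm hl1
  have t2 := layeredTime_zero_le X hm hnm hl1
  have t3 := layeredTime_one_le (2 * n) l hm hnm
  have t4 := layeredTime_one_le (n + Y) l hm hnm
  have b1 : 2 * l * (layeredTime n m 0 0 l + 30) + 40 ≤ 4100 * (m * (l * l)) := by
    have h1 : layeredTime n m 0 0 l + 30 ≤ 2030 * (m * l) := by nlinarith
    nlinarith [Nat.mul_le_mul_left (2 * l) h1]
  have b2 : (l + 1) * (layeredTime n m X 0 l + 30) ≤ 4100 * (m * (l * l * (X + 1))) := by
    have h0 : 1 ≤ (X + 1) * (m * l) := by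
      have : 1 ≤ m * l := Nat.mul_pos hm hl1
      nlinarith
    have h1 : layeredTime n m X 0 l + 30 ≤ 2030 * ((X + 1) * (m * l)) := by omega
    calc (l + 1) * (layeredTime n m X 0 l + 30)
        ≤ (2 * l) * (2030 * ((X + 1) * (m * l))) := Nat.mul_le_mul (by omega) h1
      _ = 4060 * (m * (l * l * (X + 1))) := by ring
      _ ≤ _ := by omega
  have b3 : layeredTime n m (2 * n) 1 l + 30 * a + 70 ≤ 5000 * (n * m) := by nlinarith
  have b3' := Nat.mul_le_mul_left q b3
  have b4 : layeredTime n m (n + Y) 1 l ≤ 1000 * (n * m + m * Y + m) := by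
    refine t4.trans (le_of_eq (by ring))
  have hY : Y ≤ m * Y := Nat.le_mul_of_pos_left _ hm
  have e1 : m * (60 * (2 * l) + 300) = 120 * (m * l) + 300 * m := by ring
  have e2 : n * (40 * m + 40) = 40 * (n * m) + 40 * n := by ring
  have e3 : q * (5000 * (n * m)) = 5000 * (n * m * q) := by ring
  have e4 : n * m * (1 + q) = n * m + n * m * q := by ring
  have hl3 : l ≤ m * l := Nat.le_mul_of_pos_left _ hm
  rw [e3] at b3'
  unfold schemeTime
  rw [e1, e2, e4]
  omega

theorem clog_cast_le {x : ℕ} (hx : 1 ≤ x) : (Nat.clog 2 x : ℝ) ≤ Real.logb 2 x + 1 := by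
  have h := Real.natCeil_logb_natCast 2 x
  have h0 : 0 ≤ Real.logb 2 (x : ℝ) := Real.logb_nonneg (by norm_num) (by exact_mod_cast hx)
  push_cast at h
  rw [← h]
  exact (Nat.ceil_lt_add_one h0).le

/-- Bisecting the exponent range of `tighten` takes `log log log n + O(1)` rounds. -/
theorem rounds_le {n l a q : ℕ} (hn : 2 ≤ n) (hl : Nat.clog 2 n = l)
    (ha : Nat.clog 2 (2 * (l * l) + 2) = a) (hq : Nat.clog 2 a = q) :
    (q : ℝ) ≤ 4 + max 0 (Real.logb 2 (Real.logb 2 (Real.logb 2 (n : ℝ)))) := by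
  rcases le_total n 16 with h16 | h16
  · have h1 : l ≤ 4 := hl ▸ Nat.clog_le_of_le_pow (by omega)
    have h2 : a ≤ 6 := ha ▸ Nat.clog_le_of_le_pow (by nlinarith)
    have h3 : q ≤ 3 := hq ▸ Nat.clog_le_of_le_pow (by omega)
    have h4 : (q : ℝ) ≤ 3 := by exact_mod_cast h3
    have := le_max_left 0 (Real.logb 2 (Real.logb 2 (Real.logb 2 (n : ℝ))))
    linarith
  -- With `x = log n ≥ 4` and `y = log x ≥ 2`: `l ≤ 2 x`, so `2 l ^ 2 + 2 ≤ 16 x ^ 2` has a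
  -- logarithm of at most `4 + 2 y`, so `a ≤ 5 + 2 y ≤ 5 y ≤ 8 y`, whose logarithm is `3 + log y`.
  · have hl1 : 1 ≤ l := hl ▸ Nat.clog_pos (by norm_num) hn
    obtain ⟨x, hx⟩ : ∃ x, Real.logb 2 (n : ℝ) = x := ⟨_, rfl⟩
    obtain ⟨y, hy⟩ : ∃ y, Real.logb 2 x = y := ⟨_, rfl⟩
    have hx4 : 4 ≤ x := by
      rw [← hx, Real.le_logb_iff_rpow_le (by norm_num) (by positivity)]
      norm_num
      exact_mod_cast h16
    have hy2 : 2 ≤ y := by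
      rw [← hy, Real.le_logb_iff_rpow_le (by norm_num) (by positivity)]
      norm_num
      exact hx4
    have hxl : (l : ℝ) ≤ 2 * x := by
      have := clog_cast_le (x := n) (by omega)
      rw [hl, hx] at this
      linarith
    have ha5 : (a : ℝ) ≤ 5 * y := by
      have h1 := clog_cast_le (x := 2 * (l * l) + 2) (by omega)
      rw [ha] at h1
      have h2 : ((2 * (l * l) + 2 : ℕ) : ℝ) ≤ 2 ^ (4 : ℕ) * x ^ (2 : ℕ) := by
        have : (1 : ℝ) ≤ l := by exact_mod_cast hl1
        push_cast
        nlinarith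
      have h3 := Real.logb_le_logb_of_le (b := 2) (by norm_num) (by positivity) h2
      rw [Real.logb_mul (by positivity) (by positivity), Real.logb_pow, Real.logb_pow, hy,
        Real.logb_self_eq_one (by norm_num)] at h3
      norm_num at h3
      push_cast at h1
      linarith
    have ha1 : 1 ≤ a := ha ▸ Nat.clog_pos (by norm_num) (by omega)
    have h1 := clog_cast_le ha1
    rw [hq] at h1
    have h2 := Real.logb_le_logb_of_le (b := 2) (by norm_num)
      (by exact_mod_cast ha1) (ha5.trans (by linarith : 5 * y ≤ 2 ^ (3 : ℕ) * y))
    rw [Real.logb_mul (by positivity) (by positivity), Real.logb_pow,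
      Real.logb_self_eq_one (by norm_num)] at h2
    norm_num at h2
    rw [hx, hy]
    have := le_max_right 0 (Real.logb 2 y)
    linarith

end RAM

theorem mainTheorem3 :
    ∃ P : RAM.Prog, ∀ C : ℝ, 0 < C → ∃ K : ℝ, ∀ (I : RSPInstance) (ε : ℝ), 0 < ε → ε < C →
      ∃ (k : ℕ) (σ : RAM.Store), RAM.Exec P (RAM.input I ε) k σ ∧ RAM.Answers I ε σ ∧
        (k : ℝ) ≤ K * ((I.n : ℝ) * (I.m : ℝ) *
          (1 / ε + max 0 (Real.logb 2 (Real.logb 2 (Real.logb 2 (I.n : ℝ)))))) := by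
  refine ⟨RAM.scheme, fun C hC => ⟨200000 * (6 * C + 5), fun I ε hε hεC => ?_⟩⟩
  obtain ⟨k, σ, hexec, hk, hans⟩ := RAM.wp_scheme I ε hε _ _ _ _ _ rfl rfl rfl rfl rfl
  refine ⟨k, σ, hexec, hans, ?_⟩
  have hn := RAM.RSPInstance.two_le_n I
  have hnm := RAM.RSPInstance.n_le I
  have h1 := hk.trans (RAM.schemeTime_le _ _ hn (by omega) (by omega) rfl rfl rfl)
  have hq := RAM.rounds_le hn rfl rfl rfl
  have hY := (Nat.ceil_lt_add_one (show 0 ≤ 4 * (I.n : ℝ) / ε by positivity)).le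
  generalize Nat.clog 2 (Nat.clog 2 (2 * (Nat.clog 2 I.n * Nat.clog 2 I.n) + 2)) = q at *
  generalize ⌈4 * (I.n : ℝ) / ε⌉₊ = Y at *
  obtain ⟨z, hz⟩ : ∃ z, max 0 (Real.logb 2 (Real.logb 2 (Real.logb 2 (I.n : ℝ)))) = z := ⟨_, rfl⟩
  have hz0 : 0 ≤ z := hz ▸ le_max_left _ _
  rw [hz] at hq ⊢
  have h2 : (k : ℝ) ≤ 200000 * ((I.n : ℝ) * I.m * (1 + q) + I.m * Y) := by exact_mod_cast h1
  have hn1 : (1 : ℝ) ≤ I.n := by exact_mod_cast (by omega : 1 ≤ I.n)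
  have hN : 0 ≤ (I.n : ℝ) * I.m := by positivity
  have hY2 : (I.m : ℝ) * Y ≤ I.n * I.m * (4 / ε + 1) := by
    have : (Y : ℝ) ≤ I.n * (4 / ε + 1) := by
      refine hY.trans ?_
      rw [mul_add, mul_one, mul_div_assoc', mul_comm (4 : ℝ)]
      linarith
    nlinarith [mul_le_mul_of_nonneg_left this (Nat.cast_nonneg (α := ℝ) I.m)]
  -- as `ε < C`, constants are absorbed by `1 / ε`
  have hCe : 1 ≤ C * (1 / ε) := by
    rw [mul_one_div, le_div_iff₀ hε]
    linarith
  have hC6 : 1 + (4 + z) + (4 / ε + 1) ≤ (6 * C + 5) * (1 / ε + z) := by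
    have h3 : 0 ≤ C * z := by positivity
    have h4 : 4 / ε = 4 * (1 / ε) := by ring
    have h5 : 0 < 1 / ε := by positivity
    rw [h4]
    nlinarith
  calc (k : ℝ) ≤ 200000 * ((I.n : ℝ) * I.m * (1 + q) + I.m * Y) := h2
    _ ≤ 200000 * ((I.n : ℝ) * I.m * (1 + (4 + z) + (4 / ε + 1))) := by
      have := mul_le_mul_of_nonneg_left (show 1 + (q : ℝ) ≤ 1 + (4 + z) by linarith) hN
      nlinarith
    _ ≤ 200000 * ((I.n : ℝ) * I.m * ((6 * C + 5) * (1 / ε + z))) := by gcongr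
    _ = _ := by ring
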